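/- A (weighted) system $Az=b$ consists of $m$ linear equations in $n$ variables over $\mathbb{F}_2$, each with a positive integral weight. The excess of an assignment $z\in\mathbb{F}_2^n$ is the total weight of the equations it satisfies minus the total weight of those it falsifies. In \textsc{Max Lin AA} we are given a system and a parameter $k\in\mathbb{N}$ and must decide whether the maximum excess is at least $k$. Call a system irreducible if every equation contains at least one variable, no two equations have the same left-hand side, and $\operatorname{rank}A=n$. Programs run on a random access machine whose arithmetic operations are addition and cut-off subtraction of natural numbers. Let $p:\mathbb{N}\to\mathbb{R}$ be a fixed function with $p(n)=o(n)$, and consider the instances whose system is irreducible with $m\le 2^{p(n)}$. (a) On these instances \textsc{Max Lin AA} is (uniformly) fixed-parameter tractable: there are one program, a function $f:\mathbb{N}\to\mathbb{N}$ and a constant $c$ such that the program decides each such instance $(x,k)$ in time at most $f(k)\,|x|^{c}$, where $|x|$ is the number of bits of the instance and time is counted at logarithmic (bit) cost. (b) Moreover, there are one program, a function $g:\mathbb{N}\to\mathbb{N}$ and a constant $c$ such that, on each such instance, the program finds an assignment of excess at least $k$, or reports that there is none, in at most $g(k)\,(m+1)^{c}$ steps, each arithmetic operation on integers counting as one step.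 (c) If $p(n)=o(n)$ holds effectively, i.e. there is a computable $N:\mathbb{N}\to\mathbb{N}$ with $j\,|p(n)|\le n$ for all $j$ and all $n\ge N(j)$, then the functions $f$ in (a) and $g$ in (b) can be chosen computable. -/

import Mathlib

/-! ## A random access machine -/

namespace RAM

/-- Elementary instructions. Registers (written `R`) are addressed directly by the program, memory
cells (written `M`) only indirectly, through the contents of a register. The arithmetic is addition
and cut-off subtraction of natural numbers; there is no multiplication. -/
inductive Instr where
  /-- `R[d] := c` -/
  | const (d c : ℕ)
  /-- `R[d] := R[a] + R[b]` -/
  | add (d a b : ℕ)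
  /-- `R[d] := R[a] - R[b]`, or `0` if `R[a] < R[b]` -/
  | sub (d a b : ℕ)
  /-- `R[d] := M[R[a]]` -/
  | load (d a : ℕ)
  /-- `M[R[a]] := R[b]` -/
  | store (a b : ℕ)

/-- Programs: finite texts with structured control flow; the tests are `R[a] < R[b]`. -/
inductive Prog where
  | skip
  | instr (i : Instr)
  | seq (P Q : Prog)
  | ifLt (a b : ℕ) (P Q : Prog)
  | whileLt (a b : ℕ) (P : Prog)

/-- The contents of the registers and of the memory. -/
structure State where
  reg : ℕ → ℕ
  mem : ℕ → ℕ

/-- The effect of an elementary instruction. -/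
def Instr.run : Instr → State → State
  | const d c, s => { s with reg := Function.update s.reg d c }
  | add d a b, s => { s with reg := Function.update s.reg d (s.reg a + s.reg b) }
  | sub d a b, s => { s with reg := Function.update s.reg d (s.reg a - s.reg b) }
  | load d a, s => { s with reg := Function.update s.reg d (s.mem (s.reg a)) }
  | store a b, s => { s with mem := Function.update s.mem (s.reg a) (s.reg b) }

/-- The cost of an elementary instruction, when handling a number `v` costs `μ v` on top of the
unit cost of the instruction. -/
def Instr.cost (μ : ℕ → ℕ) : Instr → State → ℕ
  | const _ c, _ => 1 + μ c
  | add _ a b, s => 1 + μ (s.reg a) + μ (s.reg b)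
  | sub _ a b, s => 1 + μ (s.reg a) + μ (s.reg b)
  | load _ a, s => 1 + μ (s.reg a) + μ (s.mem (s.reg a))
  | store a b, s => 1 + μ (s.reg a) + μ (s.reg b)

/-- `Exec μ P s t s'`: started in the state `s`, the program `P` terminates in the state `s'` after
a computation of total cost `t`. -/
inductive Exec (μ : ℕ → ℕ) : Prog → State → ℕ → State → Prop
  | skip (s : State) : Exec μ .skip s 1 s
  | instr (i : Instr) (s : State) : Exec μ (.instr i) s (i.cost μ s) (i.run s)
  | seq {P Q : Prog} {s s' s'' : State} {t t' : ℕ}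
      (hP : Exec μ P s t s') (hQ : Exec μ Q s' t' s'') :
      Exec μ (.seq P Q) s (t + t') s''
  | ifLt_true {a b : ℕ} {P Q : Prog} {s s' : State} {t : ℕ}
      (h : s.reg a < s.reg b) (hP : Exec μ P s t s') :
      Exec μ (.ifLt a b P Q) s (1 + μ (s.reg a) + μ (s.reg b) + t) s'
  | ifLt_false {a b : ℕ} {P Q : Prog} {s s' : State} {t : ℕ}
      (h : ¬ s.reg a < s.reg b) (hQ : Exec μ Q s t s') :
      Exec μ (.ifLt a b P Q) s (1 + μ (s.reg a) + μ (s.reg b) + t) s'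
  | whileLt_true {a b : ℕ} {P : Prog} {s s' s'' : State} {t t' : ℕ}
      (h : s.reg a < s.reg b) (hP : Exec μ P s t s')
      (hW : Exec μ (.whileLt a b P) s' t' s'') :
      Exec μ (.whileLt a b P) s (1 + μ (s.reg a) + μ (s.reg b) + t + t') s''
  | whileLt_false {a b : ℕ} {P : Prog} {s : State} (h : ¬ s.reg a < s.reg b) :
      Exec μ (.whileLt a b P) s (1 + μ (s.reg a) + μ (s.reg b)) s

/-- Uniform cost: every elementary operation and every test costs one unit, so that the cost of a
computation is its number of steps. -/
def uniformCost : ℕ → ℕ := fun _ => 0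

/-- Logarithmic cost: operations and tests are charged for the binary lengths of the numbers and
memory addresses that they handle. Up to polynomials this is the time of a Turing machine. -/
def logCost : ℕ → ℕ := Nat.size

/-- The initial state on the instance `(x, k)`: `R[0] = k`, `R[1]` is the number of entries of `x`,
the entries of `x` are in `M[0], M[1], …`, and everything else is `0`. -/
def initState (x : List ℕ) (k : ℕ) : State where
  reg := fun i => if i = 0 then k else if i = 1 then x.length else 0
  mem := fun i => x.getD i 0

end RAM

/-! ## Fixed-parameter tractability -/

/-- The size of an instance that is written as a finite sequence of natural numbers: its length
when each number is written in binary and followed by a separator. -/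
def bitSize (x : List ℕ) : ℕ := (x.map fun a => Nat.size a + 1).sum

open Classical in
/-- On the class `D` of instances, membership in the parameterized problem `L` is decided in time
`f(k)·|x|^{O(1)}` by one program; the time is the logarithmic cost, and the answer (`1` for yes and
`0` for no) is left in `R[0]`. -/
def DecidableInFPTTime (D L : Set (List ℕ × ℕ)) (f : ℕ → ℕ) : Prop :=
  ∃ (P : RAM.Prog) (c : ℕ), ∀ (x : List ℕ) (k : ℕ), (x, k) ∈ D →
    ∃ (t : ℕ) (s : RAM.State), RAM.Exec RAM.logCost P (RAM.initState x k) t s ∧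
      t ≤ f k * bitSize x ^ c ∧ s.reg 0 = if (x, k) ∈ L then 1 else 0

/-- `L` is fixed-parameter tractable on the class `D`, with a computable `f`. -/
def IsFPTOn (D L : Set (List ℕ × ℕ)) : Prop :=
  ∃ f : ℕ → ℕ, Computable f ∧ DecidableInFPTTime D L f

/-- `L` is uniformly fixed-parameter tractable on the class `D`: a single program for all `k`, but
`f` is an arbitrary function. -/
def IsUniformlyFPTOn (D L : Set (List ℕ × ℕ)) : Prop :=
  ∃ f : ℕ → ℕ, DecidableInFPTTime D L f

/-! ## Max Lin Above Average -/

/-- A system `Az = b` of `m` linear equations in `n` variables over the field with two elements, in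
which each equation has a positive integral weight. -/
structure LinSystem (n m : ℕ) where
  A : Matrix (Fin m) (Fin n) (ZMod 2)
  b : Fin m → ZMod 2
  w : Fin m → ℕ
  w_pos : ∀ i, 0 < w i

namespace LinSystem

variable {n m : ℕ}

/-- Total weight of the satisfied equations minus total weight of the falsified ones. -/
def excess (S : LinSystem n m) (z : Fin n → ZMod 2) : ℤ :=
  ∑ i, if S.A.mulVec z i = S.b i then (S.w i : ℤ) else -(S.w i : ℤ)

/-- The maximum of the excess over all assignments. -/
def maxExcess (S : LinSystem n m) : ℤ :=
  Finset.univ.sup' Finset.univ_nonempty S.excess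

/-- Every equation has a variable in it, no two equations have the same left-hand side, and the
rank of `A` is the number of variables. -/
structure Irreducible (S : LinSystem n m) : Prop where
  row_ne_zero : ∀ i, S.A i ≠ 0
  row_injective : Function.Injective S.A
  rank_eq : S.A.rank = n

/-- The system as a sequence of numbers: `n`, `m`, and then, equation by equation, the `n`
coefficients, the right-hand side and the weight. -/
def encode (S : LinSystem n m) : List ℕ :=
  n :: m :: (List.finRange m).flatMap fun i =>
    (List.finRange n).map (fun j => (S.A i j).val) ++ [(S.b i).val, S.w i]

end LinSystem

/-- Max Lin AA: is the maximum excess of the system at least the parameter `k`? -/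
def MaxLinAA : Set (List ℕ × ℕ) :=
  {y | ∃ (n m : ℕ) (S : LinSystem n m), y.1 = S.encode ∧ (y.2 : ℤ) ≤ S.maxExcess}

/-- The instances whose system is irreducible with `m ≤ 2 ^ p(n)`. -/
def SparseInstances (p : ℕ → ℝ) : Set (List ℕ × ℕ) :=
  {y | ∃ (n m : ℕ) (S : LinSystem n m), y.1 = S.encode ∧ S.Irreducible ∧
    (m : ℝ) ≤ (2 : ℝ) ^ p n}

/-- For irreducible systems with `m ≤ 2 ^ p(n)`, one program finds, in `g(k)·(m+1)^{O(1)}` steps, an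
assignment of excess at least `k`, or reports that there is none. It leaves `1` in `R[0]` and the
values of the variables in `M[0], …, M[n-1]` in the first case, and `0` in `R[0]` in the second. -/
def SolutionFoundInTime (p : ℕ → ℝ) (g : ℕ → ℕ) : Prop :=
  ∃ (P : RAM.Prog) (c : ℕ), ∀ (n m : ℕ) (S : LinSystem n m) (k : ℕ),
    S.Irreducible → (m : ℝ) ≤ (2 : ℝ) ^ p n →
    ∃ (t : ℕ) (s : RAM.State), RAM.Exec RAM.uniformCost P (RAM.initState S.encode k) t s ∧
      t ≤ g k * (m + 1) ^ c ∧
      ((s.reg 0 = 1 ∧ ∃ z : Fin n → ZMod 2, (k : ℤ) ≤ S.excess z ∧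
          ∀ j : Fin n, s.mem j = (z j).val) ∨
        (s.reg 0 = 0 ∧ S.maxExcess < (k : ℤ)))

/-- `p(n) = o(n)` effectively: some computable `N` has `|p(n)| ≤ n / j` for all `n ≥ N(j)`. -/
def EffectivelySublinear (p : ℕ → ℝ) : Prop :=
  ∃ N : ℕ → ℕ, Computable N ∧ ∀ j n : ℕ, N j ≤ n → (j : ℝ) * |p n| ≤ n

/-!
Call a set of left-hand sides sum-free if it is linearly independent and no further left-hand side
of the system is a sum of some of its members. Eliminate the equations one after the other, those of
a sum-free set first, each time fixing the value of a left-hand side by the majority among the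
equations that share it. The excess of the decided equations never decreases, and it grows by at
least `1` at every member of the set, because the member still has a left-hand side of its own: so a
sum-free set of `k` equations yields an assignment of excess at least `k`.

A sum-free set is sought greedily, in passes. If a pass stops with fewer than `k` equations, then,
modulo their span, every left-hand side vanishes or coincides with another one, so that the number
of nonzero classes of left-hand sides has halved. The next pass works in the quotient. When
`m < 2 ^ l`, at most `l` passes can fail before no nonzero class is left; since the rank is `n`,
this gives `n ≤ l * k`. For `m ≤ 2 ^ p n` with `p n = o(n)` this bounds `n` in terms of `k`, and
then all `2 ^ n` assignments can be tried.

The program is written in a small language with bounded sums and loops, whose time is a polynomial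
in the values of the bounding variables. A computation of `t` steps lengthens no number by more than
`t` digits, so that the logarithmic cost is polynomial in the number of steps and the size of the
input.
-/

/-! ## Total correctness on the machine -/

namespace RAM

namespace State

/-- Assignment to a register. -/
def setReg (σ : State) (r x : ℕ) : State := { σ with reg := Function.update σ.reg r x }

/-- Assignment to a memory cell. -/
def setMem (σ : State) (i x : ℕ) : State := { σ with mem := Function.update σ.mem i x }

@[simp] lemma reg_setReg (σ : State) (r x q : ℕ) :
    (σ.setReg r x).reg q = if q = r then x else σ.reg q := by
  simp only [setReg, Function.update_apply]

@[simp] lemma mem_setReg (σ : State) (r x : ℕ) : (σ.setReg r x).mem = σ.mem := rfl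

@[simp] lemma reg_setMem (σ : State) (i x : ℕ) : (σ.setMem i x).reg = σ.reg := rfl

@[simp] lemma mem_setMem (σ : State) (i x j : ℕ) :
    (σ.setMem i x).mem j = if j = i then x else σ.mem j := by
  simp only [setMem, Function.update_apply]

end State

/-- Total correctness with a time bound: started in `σ`, the program `P` terminates within `T`
steps in a state that satisfies `Q`. -/
def Runs (P : Prog) (T : ℕ) (σ : State) (Q : State → Prop) : Prop :=
  ∃ t τ, Exec uniformCost P σ t τ ∧ t ≤ T ∧ Q τ

local notation:60 P:61 ";;" Q:60 => Prog.seq P Q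

section

variable {P P' : Prog} {T T' : ℕ} {σ : State} {Q Q' : State → Prop}

lemma Runs.mono (h : Runs P T σ Q) (hT : T ≤ T') (hQ : ∀ τ, Q τ → Q' τ) : Runs P T' σ Q' :=
  let ⟨t, τ, hP, ht, hτ⟩ := h
  ⟨t, τ, hP, ht.trans hT, hQ τ hτ⟩

lemma Runs.seq (h : Runs P T σ fun τ => Runs P' T' τ Q) : Runs (P ;; P') (T + T') σ Q :=
  let ⟨_, _, hP, ht, _, υ, hP', ht', hυ⟩ := h
  ⟨_, υ, hP.seq hP', Nat.add_le_add ht ht', hυ⟩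

lemma runs_skip (h : Q σ) : Runs .skip 1 σ Q :=
  ⟨1, σ, .skip σ, le_rfl, h⟩

lemma runs_const {d c : ℕ} (h : Q (σ.setReg d c)) : Runs (.instr (.const d c)) 1 σ Q :=
  ⟨_, _, .instr _ σ, le_rfl, h⟩

lemma runs_add {d a b : ℕ} (h : Q (σ.setReg d (σ.reg a + σ.reg b))) :
    Runs (.instr (.add d a b)) 1 σ Q :=
  ⟨_, _, .instr _ σ, le_rfl, h⟩

lemma runs_sub {d a b : ℕ} (h : Q (σ.setReg d (σ.reg a - σ.reg b))) :
    Runs (.instr (.sub d a b)) 1 σ Q :=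
  ⟨_, _, .instr _ σ, le_rfl, h⟩

lemma runs_load {d a : ℕ} (h : Q (σ.setReg d (σ.mem (σ.reg a)))) :
    Runs (.instr (.load d a)) 1 σ Q :=
  ⟨_, _, .instr _ σ, le_rfl, h⟩

lemma runs_store {a b : ℕ} (h : Q (σ.setMem (σ.reg a) (σ.reg b))) :
    Runs (.instr (.store a b)) 1 σ Q :=
  ⟨_, _, .instr _ σ, le_rfl, h⟩

lemma runs_ifLt {a b : ℕ} (hP : σ.reg a < σ.reg b → Runs P T σ Q)
    (hP' : ¬ σ.reg a < σ.reg b → Runs P' T' σ Q) :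
    Runs (.ifLt a b P P') (1 + (T + T')) σ Q := by
  by_cases h : σ.reg a < σ.reg b
  · obtain ⟨t, τ, hx, ht, hτ⟩ := hP h
    exact ⟨_, τ, .ifLt_true h hx, by simp only [uniformCost]; omega, hτ⟩
  · obtain ⟨t, τ, hx, ht, hτ⟩ := hP' h
    exact ⟨_, τ, .ifLt_false h hx, by simp only [uniformCost]; omega, hτ⟩

end

/-- `R[d] := R[a]`, with the scratch register `t`. -/
def copy (d a t : ℕ) : Prog :=
  .instr (.const t 0) ;; .instr (.add d a t)

lemma runs_copy {d a t : ℕ} {σ : State} {Q : State → Prop} (hat : a ≠ t)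
    (h : Q ((σ.setReg t 0).setReg d (σ.reg a))) : Runs (copy d a t) 2 σ Q :=
  Runs.seq (T := 1) (T' := 1) <| runs_const <| runs_add <| by simpa [hat] using h

/-- `R[c] := R[c] + 1`, with the scratch register `t`. -/
def increment (c t : ℕ) : Prog :=
  .instr (.const t 1) ;; .instr (.add c c t)

lemma runs_increment {c t : ℕ} {σ : State} {Q : State → Prop} (hct : c ≠ t)
    (h : Q ((σ.setReg t 1).setReg c (σ.reg c + 1))) : Runs (increment c t) 2 σ Q :=
  Runs.seq (T := 1) (T' := 1) <| runs_const <| runs_add <| by simpa [hct] using h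

/-- `for R[c] from 0 to R[b] - 1 do P`, with the scratch register `t`. -/
def forLt (c b t : ℕ) (P : Prog) : Prog :=
  .instr (.const c 0) ;; .whileLt c b (P ;; increment c t)

lemma runs_forLt {c b t n T : ℕ} {P : Prog} {σ : State} {I : ℕ → State → Prop} (hct : c ≠ t)
    (hI : ∀ i τ, I i τ → τ.reg c = i ∧ τ.reg b = n) (h0 : I 0 (σ.setReg c 0))
    (hstep : ∀ i < n, ∀ τ, I i τ →
      Runs P T τ fun υ => υ.reg c = i ∧ I (i + 1) ((υ.setReg t 1).setReg c (i + 1))) :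
    Runs (forLt c b t P) (2 + n * (T + 3)) σ (I n) := by
  have while_runs : ∀ j i τ, i + j = n → I i τ →
      Runs (.whileLt c b (P ;; increment c t)) (1 + j * (T + 3)) τ (I n) := by
    intro j
    induction j with
    | zero =>
      rintro i τ rfl hi
      obtain ⟨hc, hb⟩ := hI _ τ hi
      exact ⟨_, τ, .whileLt_false (by omega), by simp [uniformCost], hi⟩
    | succ j ih =>
      intro i τ hij hi
      obtain ⟨hc, hb⟩ := hI _ τ hi
      have body : Runs (P ;; increment c t) (T + 2) τ (I (i + 1)) :=
        ((hstep i (by omega) τ hi).mono le_rfl fun υ hυ =>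
          runs_increment hct (by rw [hυ.1]; exact hυ.2)).seq
      obtain ⟨t₁, υ, hP, ht₁, hυ⟩ := body
      obtain ⟨t₂, ω, hW, ht₂, hω⟩ := ih (i + 1) υ (by omega) hυ
      refine ⟨_, ω, .whileLt_true (by omega) hP hW, ?_, hω⟩
      simp only [uniformCost, Nat.succ_mul]
      omega
  exact (Runs.seq (runs_const (while_runs n 0 _ (by omega) h0))).mono (by omega) fun _ h => h

end RAM

/-! ## A language of bounded loops -/

namespace LoopLang

open Finset

/-- Expressions over natural-number variables, arrays and a tape, which initially contains the
input; `sum v b e` is the sum of `e` over the values of `v` below the variable `b`. Truth values are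
numbers, with `0` for falsehood. -/
inductive Expr where
  | const (c : ℕ)
  | var (v : ℕ)
  | tape (e : Expr)
  | read (a : ℕ) (e : Expr)
  | add (e f : Expr)
  | sub (e f : Expr)
  | lt (e f : Expr)
  | ite (c e f : Expr)
  | sum (v b : ℕ) (e : Expr)

/-- Statements. `fill a i j R C e` assigns to the entry `i * C + j` of the array `a` the value of
`e`, for all `i < R` and `j < C` in parallel, where `R` and `C` are variables: `e` may refer to the
old contents of `a`. `write e f` overwrites the entry `e` of the tape, if there is one. In
`loop v b P` the number of rounds is the initial value of the variable `b`. -/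
inductive Stmt where
  | skip
  | assign (v : ℕ) (e : Expr)
  | fill (a i j R C : ℕ) (e : Expr)
  | write (e f : Expr)
  | seq (P Q : Stmt)
  | ite (c : Expr) (P Q : Stmt)
  | loop (v b : ℕ) (P : Stmt)

/-- The values of the variables and arrays, and the tape. -/
structure Store where
  var : ℕ → ℕ
  arr : ℕ → ℕ → ℕ
  tape : List ℕ

namespace Store

/-- Assignment to a variable. -/
def setVar (s : Store) (v x : ℕ) : Store := { s with var := Function.update s.var v x }

/-- Assignment to an array. -/
def setArr (s : Store) (a : ℕ) (f : ℕ → ℕ) : Store := { s with arr := Function.update s.arr a f }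

@[simp] lemma var_setVar (s : Store) (v x u : ℕ) :
    (s.setVar v x).var u = if u = v then x else s.var u := by
  simp only [setVar, Function.update_apply]

@[simp] lemma setVar_setVar (s : Store) (v x y : ℕ) : (s.setVar v x).setVar v y = s.setVar v y := by
  simp only [setVar, Function.update_idem]

lemma setVar_comm (s : Store) {u v : ℕ} (huv : u ≠ v) (x y : ℕ) :
    (s.setVar u x).setVar v y = (s.setVar v y).setVar u x := by
  simp only [setVar, Function.update_comm huv]

@[simp] lemma setVar_var (s : Store) (v : ℕ) : s.setVar v (s.var v) = s := by
  simp only [setVar, Function.update_eq_self]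

@[simp] lemma arr_setVar (s : Store) (v x : ℕ) : (s.setVar v x).arr = s.arr := rfl

@[simp] lemma tape_setVar (s : Store) (v x : ℕ) : (s.setVar v x).tape = s.tape := rfl

@[simp] lemma var_setArr (s : Store) (a : ℕ) (f : ℕ → ℕ) : (s.setArr a f).var = s.var := rfl

@[simp] lemma arr_setArr (s : Store) (a : ℕ) (f : ℕ → ℕ) (b : ℕ) :
    (s.setArr a f).arr b = if b = a then f else s.arr b := by
  simp only [setArr, Function.update_apply]

@[simp] lemma setArr_setArr (s : Store) (a : ℕ) (f g : ℕ → ℕ) :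
    (s.setArr a f).setArr a g = s.setArr a g := by
  simp only [setArr, Function.update_idem]

@[simp] lemma setArr_arr (s : Store) (a : ℕ) : s.setArr a (s.arr a) = s := by
  simp only [setArr, Function.update_eq_self]

@[simp] lemma tape_setArr (s : Store) (a : ℕ) (f : ℕ → ℕ) : (s.setArr a f).tape = s.tape := rfl

end Store

/-- The value of an expression. -/
def Expr.eval : Expr → Store → ℕ
  | const c, _ => c
  | var v, s => s.var v
  | tape e, s => s.tape.getD (e.eval s) 0
  | read a e, s => s.arr a (e.eval s)
  | add e f, s => e.eval s + f.eval s
  | sub e f, s => e.eval s - f.eval s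
  | lt e f, s => if e.eval s < f.eval s then 1 else 0
  | ite c e f, s => if 0 < c.eval s then e.eval s else f.eval s
  | sum v b e, s => ∑ x ∈ range (s.var b), e.eval (s.setVar v x)

/-- The store after `i` rounds of a loop with the body `F` and the loop variable `v`. -/
def rounds (F : Store → Store) (v : ℕ) (s : Store) : ℕ → Store
  | 0 => s
  | i + 1 => F ((rounds F v s i).setVar v i)

/-- The effect of a statement. -/
def Stmt.run : Stmt → Store → Store
  | skip, s => s
  | assign v e, s => s.setVar v (e.eval s)
  | fill a i j R C e, s => s.setArr a fun x =>
      if x < s.var R * s.var C then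
        e.eval ((s.setVar i (x / s.var C)).setVar j (x % s.var C))
      else s.arr a x
  | write e f, s => { s with tape := s.tape.set (e.eval s) (f.eval s) }
  | seq P Q, s => Q.run (P.run s)
  | ite c P Q, s => if 0 < c.eval s then P.run s else Q.run s
  | loop v b P, s => rounds P.run v s (s.var b)

theorem Stmt.loop_induct {I : ℕ → Store → Prop} {v b : ℕ} {P : Stmt} {s : Store} (h0 : I 0 s)
    (hstep : ∀ i < s.var b, ∀ t, I i t → I (i + 1) (P.run (t.setVar v i))) :
    I (s.var b) ((loop v b P).run s) := by
  have inv : ∀ i ≤ s.var b, I i (rounds P.run v s i) := by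
    intro i
    induction i with
    | zero => exact fun _ => h0
    | succ i ih => exact fun hi => hstep i hi _ (ih (Nat.le_of_succ_le hi))
  exact inv _ le_rfl

/-- Only variables in `B` bound the sums in an expression. -/
def Expr.BoundedBy (B : Set ℕ) : Expr → Prop
  | const _ | var _ => True
  | tape e | read _ e => e.BoundedBy B
  | add e f | sub e f | lt e f => e.BoundedBy B ∧ f.BoundedBy B
  | ite c e f => c.BoundedBy B ∧ e.BoundedBy B ∧ f.BoundedBy B
  | sum _ b e => b ∈ B ∧ e.BoundedBy B

/-- Only variables in `B` bound the sums and loops in a statement, and it does not change these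
variables. The two variables of a `fill` are different. -/
def Stmt.BoundedBy (B : Set ℕ) : Stmt → Prop
  | skip => True
  | assign v e => v ∉ B ∧ e.BoundedBy B
  | fill _ i j R C e => i ≠ j ∧ R ∈ B ∧ C ∈ B ∧ e.BoundedBy B
  | write e f => e.BoundedBy B ∧ f.BoundedBy B
  | seq P Q => P.BoundedBy B ∧ Q.BoundedBy B
  | ite c P Q => c.BoundedBy B ∧ P.BoundedBy B ∧ Q.BoundedBy B
  | loop v b P => v ∉ B ∧ b ∈ B ∧ P.BoundedBy B

lemma rounds_var {F : Store → Store} {v u : ℕ} (huv : u ≠ v) (hF : ∀ s, (F s).var u = s.var u)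
    (s : Store) (i : ℕ) : (rounds F v s i).var u = s.var u := by
  induction i with
  | zero => rfl
  | succ i ih => rw [rounds, hF, Store.var_setVar, if_neg huv, ih]

lemma Stmt.BoundedBy.run_var {B : Set ℕ} {u : ℕ} (hu : u ∈ B) {P : Stmt} (hP : P.BoundedBy B)
    (s : Store) : (P.run s).var u = s.var u := by
  induction P generalizing s with
  | skip | fill | write => rfl
  | assign v e => rw [run, Store.var_setVar, if_neg (ne_of_mem_of_not_mem hu hP.1)]
  | seq P Q ihP ihQ => rw [run, ihQ hP.2, ihP hP.1]
  | ite c P Q ihP ihQ =>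
    rw [run]
    split_ifs
    exacts [ihP hP.2.1 s, ihQ hP.2.2 s]
  | loop v b P ih => exact rounds_var (ne_of_mem_of_not_mem hu hP.1) (ih hP.2.2) s _

end LoopLang

/-! ## Compilation -/

namespace LoopLang

open RAM Finset

local notation:60 P:61 ";;" Q:60 => Prog.seq P Q

/-- The register of the variable `v`. -/
def varReg (v : ℕ) : ℕ := 2 * v

/-- The registers for intermediate results. -/
def tmp (d : ℕ) : ℕ := 2 * d + 3

@[simp] lemma varReg_inj {u v : ℕ} : varReg u = varReg v ↔ u = v := by unfold varReg; omega

@[simp] lemma tmp_inj {d e : ℕ} : tmp d = tmp e ↔ d = e := by unfold tmp; omega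

@[simp] lemma varReg_ne_tmp (v d : ℕ) : varReg v ≠ tmp d := by unfold varReg tmp; omega

@[simp] lemma tmp_ne_varReg (v d : ℕ) : tmp d ≠ varReg v := by unfold varReg tmp; omega

@[simp] lemma one_ne_varReg (v : ℕ) : 1 ≠ varReg v := by unfold varReg; omega

@[simp] lemma one_ne_tmp (d : ℕ) : 1 ≠ tmp d := by unfold tmp; omega

/-- The address of the entry `x` of the machine array `a`, beyond an input of length `l`. -/
def address (l a x : ℕ) : ℕ := 2 ^ a * (2 * x + 1) + l

lemma lt_address (l a x : ℕ) : l < address l a x :=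
  Nat.lt_add_of_pos_left (by positivity)

lemma two_pow_mul_odd_inj {a b x y : ℕ} (h : 2 ^ a * (2 * x + 1) = 2 ^ b * (2 * y + 1)) :
    a = b ∧ x = y := by
  have valuation (a x : ℕ) : padicValNat 2 (2 ^ a * (2 * x + 1)) = a := by
    rw [padicValNat.mul (by positivity) (by omega), padicValNat.prime_pow,
      padicValNat.eq_zero_of_not_dvd (by omega), add_zero]
  have hab : a = b := by rw [← valuation a x, h, valuation]
  subst hab
  have := Nat.eq_of_mul_eq_mul_left (by positivity) h
  exact ⟨rfl, by omega⟩

@[simp] lemma address_inj {l a b x y : ℕ} : address l a x = address l b y ↔ a = b ∧ x = y :=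
  ⟨fun h => two_pow_mul_odd_inj (Nat.add_right_cancel h), fun h => by rw [h.1, h.2]⟩

/-- `a`-fold doubling of the register `r`. -/
def double (r : ℕ) : ℕ → Prog
  | 0 => .skip
  | a + 1 => .instr (.add r r r) ;; double r a

lemma runs_double {r a : ℕ} {σ : State} {Q : State → Prop}
    (h : Q (σ.setReg r (2 ^ a * σ.reg r))) : Runs (double r a) (a + 1) σ Q := by
  induction a generalizing σ with
  | zero => exact runs_skip (by simpa [State.setReg] using h)
  | succ a ih =>
    refine (Runs.seq (runs_add (ih ?_))).mono (T := 1 + (a + 1)) (by omega) fun _ h => h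
    convert h using 1
    simp only [State.setReg, Function.update_idem, Function.update_self]
    congr 2
    ring

/-- Write into `tmp d` the address of the entry `tmp c` of the machine array `a`; register `1`
contains the length of the input. -/
def compileAddress (a c d : ℕ) : Prog :=
  .instr (.add (tmp d) (tmp c) (tmp c)) ;; increment (tmp d) (tmp (d + 1)) ;;
    double (tmp d) a ;; .instr (.add (tmp d) (tmp d) 1)

/-- The machine state `σ` contains the store `s`. The array `a` of the store is the machine array
`a + 1`, because the machine array `0` is needed to carry out a `fill`. -/
structure Represents (σ : State) (s : Store) : Prop where
  var : ∀ v, σ.reg (varReg v) = s.var v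
  length : σ.reg 1 = s.tape.length
  tape : ∀ i < s.tape.length, σ.mem i = s.tape.getD i 0
  arr : ∀ a x, σ.mem (address s.tape.length (a + 1) x) = s.arr a x

/-- The temporaries below `d` are the same in both states. -/
def Keeps (d : ℕ) (σ τ : State) : Prop := ∀ e < d, τ.reg (tmp e) = σ.reg (tmp e)

section

variable {σ τ υ : State} {s : Store} {d e : ℕ}

lemma Represents.setReg_tmp (h : Represents σ s) (e x : ℕ) :
    Represents (σ.setReg (tmp e) x) s where
  var v := by simpa using h.var v
  length := by simpa using h.length
  tape := h.tape
  arr := h.arr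

lemma Represents.setReg_var (h : Represents σ s) (v x : ℕ) :
    Represents (σ.setReg (varReg v) x) (s.setVar v x) where
  var u := by simp [h.var u]
  length := by simpa using h.length
  tape := h.tape
  arr := h.arr

lemma Represents.setMem_shadow (h : Represents σ s) (x y : ℕ) :
    Represents (σ.setMem (address s.tape.length 0 x) y) s where
  var := h.var
  length := h.length
  tape i hi := by simpa [(hi.trans (lt_address _ 0 x)).ne] using h.tape i hi
  arr a z := by simpa using h.arr a z

lemma Represents.setMem_arr (h : Represents σ s) (a x y : ℕ) :
    Represents (σ.setMem (address s.tape.length (a + 1) x) y)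
      (s.setArr a (Function.update (s.arr a) x y)) where
  var := h.var
  length := h.length
  tape i hi := by
    have hne : i ≠ address s.tape.length (a + 1) x := (hi.trans (lt_address _ _ _)).ne
    simpa [hne] using h.tape i hi
  arr b z := by
    by_cases hb : b = a
    · subst hb
      simp [Function.update_apply, h.arr b z]
    · simp [hb, h.arr b z]

lemma Represents.setMem_tape {i : ℕ} (h : Represents σ s) (hi : i < s.tape.length) (x : ℕ) :
    Represents (σ.setMem i x) { s with tape := s.tape.set i x } where
  var := h.var
  length := by simpa using h.length
  tape j hj := by
    rw [List.length_set] at hj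
    by_cases hji : j = i
    · simp [hji, hi]
    · simpa [hji, Ne.symm hji, hj] using h.tape j hj
  arr a y := by
    simpa [(hi.trans (lt_address _ (a + 1) y)).ne'] using h.arr a y

lemma Keeps.refl : Keeps d σ σ := fun _ _ => rfl

lemma Keeps.trans (h : Keeps d σ τ) (h' : Keeps e τ υ) (hde : d ≤ e) : Keeps d σ υ :=
  fun c hc => (h' c (hc.trans_le hde)).trans (h c hc)

lemma Keeps.setReg_tmp (h : Keeps d σ τ) (hde : d ≤ e) (x : ℕ) :
    Keeps d σ (τ.setReg (tmp e) x) := fun c hc => by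
  simpa [(hc.trans_le hde).ne] using h c hc

lemma Keeps.setReg_var (h : Keeps d σ τ) (v x : ℕ) : Keeps d σ (τ.setReg (varReg v) x) :=
  fun c hc => by simpa using h c hc

end

/-- The effect of the evaluation of an expression with the value `x` from the state `σ`. -/
structure Returns (d : ℕ) (σ : State) (s : Store) (x : ℕ) (τ : State) : Prop where
  represents : Represents τ s
  keeps : Keeps d σ τ
  mem : τ.mem = σ.mem
  result : τ.reg (tmp d) = x

section

variable {σ τ υ : State} {s : Store} {d x y : ℕ}

lemma Represents.returns_setReg (h : Represents σ s) (x : ℕ) :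
    Returns d σ s x (σ.setReg (tmp d) x) :=
  ⟨h.setReg_tmp d x, Keeps.refl.setReg_tmp le_rfl x, rfl, by simp⟩

lemma Returns.setReg_tmp (h : Returns d σ s x τ) {e : ℕ} (hde : d < e) (y : ℕ) :
    Returns d σ s x (τ.setReg (tmp e) y) :=
  ⟨h.represents.setReg_tmp e y, h.keeps.setReg_tmp hde.le y, h.mem,
    by simpa [hde.ne] using h.result⟩

lemma Returns.setReg_result (h : Returns d σ s x τ) (y : ℕ) :
    Returns d σ s y (τ.setReg (tmp d) y) :=
  ⟨h.represents.setReg_tmp d y, h.keeps.setReg_tmp le_rfl y, h.mem, by simp⟩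

lemma Returns.trans (h : Returns d σ s x τ) (h' : Returns d τ s y υ) : Returns d σ s y υ :=
  ⟨h'.represents, h.keeps.trans h'.keeps le_rfl, h'.mem.trans h.mem, h'.result⟩

lemma Returns.trans_succ (h : Returns d σ s x τ) (h' : Returns (d + 1) τ s y υ) :
    Returns d σ s x υ :=
  ⟨h'.represents, h.keeps.trans h'.keeps (Nat.le_succ d), h'.mem.trans h.mem,
    (h'.keeps d (Nat.lt_succ_self d)).trans h.result⟩

lemma Represents.runs_compileAddress {c : ℕ} (h : Represents σ s) (hx : σ.reg (tmp c) = x)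
    (a : ℕ) :
    Runs (compileAddress a c d) (a + 5) σ (Returns d σ s (address s.tape.length a x)) := by
  refine (Runs.seq (runs_add (Runs.seq (runs_increment (by simp) (Runs.seq (runs_double
    (runs_add ?_))))))).mono (T := 1 + (2 + (a + 1 + 1))) (by omega) fun _ h => h
  have value : address s.tape.length a x = 2 ^ a * (x + x + 1) + σ.reg 1 := by
    rw [h.length, address, two_mul]
  rw [value, hx]
  simpa using ((((h.returns_setReg (d := d) _).setReg_tmp (Nat.lt_succ_self d) 1).setReg_result _
    ).setReg_result _).setReg_result _

end

/-- `if tmp d ≠ 0 then P else P'`. -/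
def branch (d : ℕ) (P P' : Prog) : Prog :=
  .instr (.const (tmp (d + 1)) 0) ;; .ifLt (tmp (d + 1)) (tmp d) P P'

lemma Returns.runs_branch {P P' : Prog} {T T' d x : ℕ} {s : Store} {σ τ : State}
    {Q : State → Prop} (h : Returns d σ s x τ)
    (hP : 0 < x → ∀ υ, Returns d σ s x υ → Runs P T υ Q)
    (hP' : ¬ 0 < x → ∀ υ, Returns d σ s x υ → Runs P' T' υ Q) :
    Runs (branch d P P') (T + T' + 2) τ Q := by
  have hυ := h.setReg_tmp (Nat.lt_succ_self d) 0
  have test : (τ.setReg (tmp (d + 1)) 0).reg (tmp (d + 1)) <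
      (τ.setReg (tmp (d + 1)) 0).reg (tmp d) ↔ 0 < x := by rw [hυ.result]; simp
  exact (Runs.seq (runs_const (runs_ifLt (fun hlt => hP (test.mp hlt) _ hυ)
    fun hge => hP' (hge ∘ test.mpr) _ hυ))).mono (by omega) fun _ h => h

/-- Code that leaves the value of the expression in `tmp d` and uses only temporaries from `d`
on. -/
def Expr.compile : Expr → ℕ → Prog
  | const c, d => .instr (.const (tmp d) c)
  | var v, d => copy (tmp d) (varReg v) (tmp (d + 1))
  | tape e, d => e.compile d ;;
      .ifLt (tmp d) 1 (.instr (.load (tmp d) (tmp d))) (.instr (.const (tmp d) 0))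
  | read a e, d => e.compile d ;; compileAddress (a + 1) d d ;; .instr (.load (tmp d) (tmp d))
  | add e f, d => e.compile d ;; f.compile (d + 1) ;; .instr (.add (tmp d) (tmp d) (tmp (d + 1)))
  | sub e f, d => e.compile d ;; f.compile (d + 1) ;; .instr (.sub (tmp d) (tmp d) (tmp (d + 1)))
  | lt e f, d => e.compile d ;; f.compile (d + 1) ;;
      .ifLt (tmp d) (tmp (d + 1)) (.instr (.const (tmp d) 1)) (.instr (.const (tmp d) 0))
  | ite c e f, d => c.compile d ;; branch d (e.compile d) (f.compile d)
  | sum v b e, d => .instr (.const (tmp d) 0) ;; copy (tmp (d + 1)) (varReg v) (tmp (d + 3)) ;;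
      copy (tmp (d + 2)) (varReg b) (tmp (d + 3)) ;;
      forLt (varReg v) (tmp (d + 2)) (tmp (d + 3))
        (e.compile (d + 3) ;; .instr (.add (tmp d) (tmp d) (tmp (d + 3)))) ;;
      copy (varReg v) (tmp (d + 1)) (tmp (d + 3))

/-- A bound for the running time of the code, if the bounds of the sums are at most `N`. -/
def Expr.time (N : ℕ) : Expr → ℕ
  | const _ => 1
  | var _ => 2
  | tape e => e.time N + 3
  | read a e => e.time N + (a + 7)
  | add e f | sub e f => e.time N + f.time N + 1
  | lt e f => e.time N + f.time N + 3
  | ite c e f => c.time N + e.time N + f.time N + 2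
  | sum _ _ e => N * (e.time N + 4) + 9

lemma runs_sumLoop {T d v n : ℕ} {e : Expr} {s : Store} {σ τ : State}
    (he : ∀ i < n, ∀ ρ, Represents ρ (s.setVar v i) →
      Runs (e.compile (d + 3)) T ρ (Returns (d + 3) ρ (s.setVar v i) (e.eval (s.setVar v i))))
    (h : Returns d σ s 0 τ) (hn : τ.reg (tmp (d + 2)) = n) :
    Runs (forLt (varReg v) (tmp (d + 2)) (tmp (d + 3))
        (e.compile (d + 3) ;; .instr (.add (tmp d) (tmp d) (tmp (d + 3)))))
      (2 + n * (T + 1 + 3)) τ fun υ => υ.reg (tmp (d + 1)) = τ.reg (tmp (d + 1)) ∧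
        Returns d σ (s.setVar v n) (∑ x ∈ range n, e.eval (s.setVar v x)) υ := by
  refine (runs_forLt (I := fun i υ => υ.reg (tmp (d + 2)) = n ∧
    υ.reg (tmp (d + 1)) = τ.reg (tmp (d + 1)) ∧
    Returns d σ (s.setVar v i) (∑ x ∈ range i, e.eval (s.setVar v x)) υ) (by simp)
    (fun i υ ⟨hn, _, hυ⟩ => ⟨by simpa using hυ.represents.var v, hn⟩) ?_ ?_).mono le_rfl
    fun _ hυ => hυ.2
  · exact ⟨by simpa using hn, by simp, h.represents.setReg_var v 0, h.keeps.setReg_var v 0, h.mem,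
      by simpa using h.result⟩
  · rintro i hi υ ⟨hn, hsaved, hυ⟩
    refine Runs.seq ((he i hi υ hυ.represents).mono le_rfl fun ω hω => runs_add ?_)
    have kept : ∀ c < d + 3, ω.reg (tmp c) = υ.reg (tmp c) := hω.keeps
    refine ⟨by simpa using hω.represents.var v, ?_, ?_, ?_, ?_, hω.mem.trans hυ.mem, ?_⟩
    · simp [kept (d + 2), hn]
    · simp [kept (d + 1), hsaved]
    · simpa using ((hω.represents.setReg_tmp d _).setReg_tmp (d + 3) 1).setReg_var v (i + 1)
    · exact (((hυ.keeps.trans hω.keeps (by omega)).setReg_tmp le_rfl _).setReg_tmp (by omega)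
        _).setReg_var _ _
    · simp [kept d, hω.result, hυ.result, sum_range_succ]

lemma runs_operands {e f : Expr} {P : Prog} {T T' T'' d x y : ℕ} {s : Store} {σ : State}
    {Q : State → Prop} (he : Runs (e.compile d) T σ (Returns d σ s x))
    (hf : ∀ τ, Represents τ s → Runs (f.compile (d + 1)) T' τ (Returns (d + 1) τ s y))
    (hP : ∀ τ, Returns d σ s x τ → τ.reg (tmp (d + 1)) = y → Runs P T'' τ Q) :
    Runs (e.compile d ;; f.compile (d + 1) ;; P) (T + T' + T'') σ Q := by
  refine (Runs.seq (he.mono le_rfl fun τ hτ => Runs.seq ((hf τ hτ.represents).mono le_rfl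
    fun υ hυ => hP υ (hτ.trans_succ hυ) hυ.result))).mono ?_ fun _ h => h
  rw [add_assoc]

lemma runs_sum {N T d v b : ℕ} {e : Expr} {s : Store} {σ : State} (hb : s.var b ≤ N)
    (he : ∀ i < s.var b, ∀ ρ, Represents ρ (s.setVar v i) →
      Runs (e.compile (d + 3)) T ρ (Returns (d + 3) ρ (s.setVar v i) (e.eval (s.setVar v i))))
    (h : Represents σ s) :
    Runs ((Expr.sum v b e).compile d) (N * (T + 4) + 9) σ
      (Returns d σ s ((Expr.sum v b e).eval s)) := by
  have time_le : s.var b * (T + 4) ≤ N * (T + 4) := Nat.mul_le_mul_right _ hb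
  refine (Runs.seq (runs_const (Runs.seq (runs_copy (by simp) (Runs.seq (runs_copy (by simp)
    (Runs.seq (T := 2 + s.var b * (T + 4)) (T' := 2) ?_))))))).mono (by omega) fun _ h => h
  refine (runs_sumLoop he ((((h.returns_setReg 0).setReg_tmp (by omega) 0).setReg_tmp
    (by omega) _).setReg_tmp (by omega) 0 |>.setReg_tmp (by omega) _)
    (by simp [h.var])).mono le_rfl fun τ ⟨hsaved, hτ⟩ => runs_copy (by simp) ?_
  have final := hτ.setReg_tmp (e := d + 3) (by omega) 0
  rw [show τ.reg (tmp (d + 1)) = s.var v by simpa [h.var] using hsaved]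
  exact ⟨by simpa using final.represents.setReg_var v (s.var v), final.keeps.setReg_var _ _,
    final.mem, by simpa [Expr.eval] using final.result⟩

lemma runs_tape {T d : ℕ} {e : Expr} {s : Store} {σ : State}
    (he : Runs (e.compile d) T σ (Returns d σ s (e.eval s))) :
    Runs ((Expr.tape e).compile d) (T + 3) σ (Returns d σ s ((Expr.tape e).eval s)) := by
  refine Runs.seq (he.mono le_rfl fun τ hτ => runs_ifLt (fun hlt => runs_load ?_)
    fun hge => runs_const ?_)
  · rw [hτ.result, hτ.represents.length] at hlt
    rw [hτ.result, hτ.represents.tape _ hlt]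
    exact hτ.setReg_result _
  · rw [hτ.result, hτ.represents.length] at hge
    simpa only [Expr.eval, List.getD_eq_default _ _ (not_lt.mp hge)] using hτ.setReg_result 0

lemma runs_read {T d a : ℕ} {e : Expr} {s : Store} {σ : State}
    (he : Runs (e.compile d) T σ (Returns d σ s (e.eval s))) :
    Runs ((Expr.read a e).compile d) (T + (a + 7)) σ
      (Returns d σ s ((Expr.read a e).eval s)) := by
  refine (Runs.seq (he.mono le_rfl fun τ hτ => Runs.seq <|
    (hτ.represents.runs_compileAddress hτ.result (a + 1)).mono le_rfl fun υ hυ =>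
      runs_load ?_)).mono (T := _ + (a + 1 + 5 + 1)) (by omega) fun _ h => h
  rw [hυ.result, hυ.represents.arr]
  exact (hτ.trans hυ).setReg_result _

lemma Expr.runs_compile {B : Set ℕ} {N : ℕ} (e : Expr) (he : e.BoundedBy B) {d : ℕ} {s : Store}
    {σ : State} (hs : ∀ b ∈ B, s.var b ≤ N) (h : Represents σ s) :
    Runs (e.compile d) (e.time N) σ (Returns d σ s (e.eval s)) := by
  induction e generalizing d s σ with
  | const c => exact runs_const (h.returns_setReg c)
  | var v =>
    refine runs_copy (by simp) ?_
    rw [h.var]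
    exact ⟨(h.setReg_tmp _ _).setReg_tmp _ _,
      (Keeps.refl.setReg_tmp (Nat.le_succ d) _).setReg_tmp le_rfl _, rfl, by simp [eval]⟩
  | tape e ih => exact runs_tape (ih he hs h)
  | read a e ih => exact runs_read (ih he hs h)
  | add e f ihe ihf =>
    refine runs_operands (ihe he.1 hs h) (fun _ hτ => ihf he.2 hs hτ) fun τ hτ hf => runs_add ?_
    rw [hτ.result, hf]
    exact hτ.setReg_result _
  | sub e f ihe ihf =>
    refine runs_operands (ihe he.1 hs h) (fun _ hτ => ihf he.2 hs hτ) fun τ hτ hf => runs_sub ?_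
    rw [hτ.result, hf]
    exact hτ.setReg_result _
  | lt e f ihe ihf =>
    refine runs_operands (ihe he.1 hs h) (fun _ hτ => ihf he.2 hs hτ) fun τ hτ hf =>
      runs_ifLt (T := 1) (T' := 1) (fun hlt => runs_const ?_) fun hge => runs_const ?_
    · rw [hτ.result, hf] at hlt
      simpa only [eval, if_pos hlt] using hτ.setReg_result 1
    · rw [hτ.result, hf] at hge
      simpa only [eval, if_neg hge] using hτ.setReg_result 0
  | ite c e f ihc ihe ihf =>
    refine (Runs.seq ((ihc he.1 hs h).mono le_rfl fun τ hτ => hτ.runs_branch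
      (fun hc υ hυ => (ihe he.2.1 hs hυ.represents).mono le_rfl fun ω hω => ?_)
      fun hc υ hυ => (ihf he.2.2 hs hυ.represents).mono le_rfl fun ω hω => ?_)).mono
      (by simp only [time]; omega) fun _ h => h
    · simpa only [eval, if_pos hc] using hυ.trans hω
    · simpa only [eval, if_neg hc] using hυ.trans hω
  | sum v b e ih =>
    refine runs_sum (hs b he.1) (fun i hi ρ => ih he.2 fun c hc => ?_) h
    rw [Store.var_setVar]
    split_ifs
    exacts [hi.le.trans (hs b he.1), hs c hc]

/-- Store the value of `e` in the entry `tmp (d + 4)` of the shadow array, machine array `0`. -/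
def fillEntry (e : Expr) (d : ℕ) : Prog :=
  e.compile (d + 5) ;; compileAddress 0 (d + 4) (d + 6) ;;
    .instr (.store (tmp (d + 6)) (tmp (d + 5))) ;; increment (tmp (d + 4)) (tmp (d + 5))

/-- Copy the first `tmp d` entries of the shadow array to the array `a`. -/
def copyShadow (a d : ℕ) : Prog :=
  forLt (tmp (d + 1)) (tmp d) (tmp (d + 2)) <|
    compileAddress 0 (d + 1) (d + 2) ;; .instr (.load (tmp (d + 2)) (tmp (d + 2))) ;;
      compileAddress (a + 1) (d + 1) (d + 3) ;; .instr (.store (tmp (d + 3)) (tmp (d + 2)))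

/-- The state after the first `k` entries `F 0, …, F (k - 1)` of a `fill` have been computed. -/
structure Filling (d : ℕ) (σ : State) (F : ℕ → ℕ) (s : Store) (k : ℕ) (τ : State) : Prop where
  represents : Represents τ s
  keeps : Keeps (d + 4) σ τ
  index : τ.reg (tmp (d + 4)) = k
  shadow : ∀ x < k, τ.mem (address s.tape.length 0 x) = F x

section

variable {d i j k n C T : ℕ} {σ τ : State} {s : Store} {e : Expr} {F : ℕ → ℕ}

lemma Filling.setReg_var (h : Filling d σ F s k τ) (v x : ℕ) :
    Filling d σ F (s.setVar v x) k (τ.setReg (varReg v) x) :=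
  ⟨h.represents.setReg_var v x, h.keeps.setReg_var v x, by simpa using h.index, h.shadow⟩

lemma Filling.setReg_tmp (h : Filling d σ F s k τ) (x : ℕ) :
    Filling d σ F s k (τ.setReg (tmp (d + 5)) x) :=
  ⟨h.represents.setReg_tmp _ x, h.keeps.setReg_tmp (by omega) x, by simpa using h.index, h.shadow⟩

lemma Filling.runs_fillEntry (h : Filling d σ F s k τ) (hF : F k = e.eval s)
    (he : ∀ ρ, Represents ρ s →
      Runs (e.compile (d + 5)) T ρ (Returns (d + 5) ρ s (e.eval s))) :
    Runs (fillEntry e d) (T + 8) τ (Filling d σ F s (k + 1)) := by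
  refine (Runs.seq ((he τ h.represents).mono le_rfl fun υ hυ => Runs.seq <|
    (hυ.represents.runs_compileAddress (x := k) ?_ 0).mono le_rfl
      fun ω hω => Runs.seq <| runs_store <| runs_increment (by simp) ?_)).mono
      (T := T + (0 + 5 + (1 + 2))) (by omega) fun _ h => h
  · rw [hυ.keeps _ (by omega), h.index]
  have index : ω.reg (tmp (d + 4)) = k := by
    rw [hω.keeps _ (by omega), hυ.keeps _ (by omega), h.index]
  have value : ω.reg (tmp (d + 5)) = F k := by rw [hω.keeps _ (by omega), hυ.result, hF]
  rw [hω.result, value]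
  refine ⟨(hω.represents.setMem_shadow k _).setReg_tmp _ _ |>.setReg_tmp _ _, ?_, by simp [index],
    fun x hx => ?_⟩
  · exact ((h.keeps.trans hυ.keeps (by omega)).trans hω.keeps (by omega)).setReg_tmp
      (by omega) _ |>.setReg_tmp le_rfl _
  · by_cases hxk : x = k
    · simp [hxk]
    · simpa [hxk, hω.mem, hυ.mem] using h.shadow x (by omega)

lemma Filling.runs_row (h : Filling d σ F s k τ) (hn : σ.reg (tmp (d + 3)) = n)
    (hF : ∀ y < n, F (k + y) = e.eval (s.setVar j y))
    (he : ∀ y < n, ∀ ρ, Represents ρ (s.setVar j y) →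
      Runs (e.compile (d + 5)) T ρ (Returns (d + 5) ρ (s.setVar j y) (e.eval (s.setVar j y)))) :
    Runs (forLt (varReg j) (tmp (d + 3)) (tmp (d + 5)) (fillEntry e d)) (2 + n * (T + 11)) τ
      (Filling d σ F (s.setVar j n) (k + n)) := by
  refine runs_forLt (I := fun y => Filling d σ F (s.setVar j y) (k + y)) (by simp)
    (fun y υ hυ => ⟨by simpa using hυ.represents.var j, ?_⟩) (h.setReg_var j 0)
    fun y hy υ hυ => (hυ.runs_fillEntry (hF y hy) (he y hy)).mono le_rfl fun ω hω => ⟨?_, ?_⟩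
  · rw [hυ.keeps _ (by omega), hn]
  · simpa using hω.represents.var j
  · simpa [add_assoc] using (hω.setReg_tmp 1).setReg_var j (y + 1)

lemma Filling.runs_rows (h : Filling d σ F s 0 τ) (hij : i ≠ j) (hn : σ.reg (tmp (d + 2)) = n)
    (hC : σ.reg (tmp (d + 3)) = C)
    (hF : ∀ x, F x = e.eval ((s.setVar i (x / C)).setVar j (x % C)))
    (he : ∀ x < n, ∀ y < C, ∀ ρ, Represents ρ ((s.setVar i x).setVar j y) →
      Runs (e.compile (d + 5)) T ρ (Returns (d + 5) ρ ((s.setVar i x).setVar j y)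
        (e.eval ((s.setVar i x).setVar j y)))) :
    Runs (forLt (varReg i) (tmp (d + 2)) (tmp (d + 5))
        (forLt (varReg j) (tmp (d + 3)) (tmp (d + 5)) (fillEntry e d)))
      (2 + n * (2 + C * (T + 11) + 3)) τ
      fun υ => ∃ y, Filling d σ F ((s.setVar i n).setVar j y) (n * C) υ := by
  refine runs_forLt
    (I := fun x υ => ∃ y, Filling d σ F ((s.setVar i x).setVar j y) (x * C) υ) (by simp) ?_ ?_ ?_
  · rintro x υ ⟨y, hυ⟩
    exact ⟨by simpa [hij] using hυ.represents.var i, by rw [hυ.keeps _ (by omega), hn]⟩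
  · exact ⟨(s.setVar i 0).var j, by simpa only [Store.setVar_var, zero_mul] using h.setReg_var i 0⟩
  · rintro x hx υ ⟨y, hυ⟩
    have entry (y) (hy : y < C) :
        F (x * C + y) = e.eval ((s.setVar i x).setVar j y) := by
      rw [hF, Nat.mul_add_mod', Nat.mod_eq_of_lt hy, mul_comm, Nat.mul_add_div (by omega),
        Nat.div_eq_of_lt hy, add_zero]
    refine (hυ.runs_row hC (by simpa using entry) (by simpa using he x hx)).mono le_rfl
      fun ω hω => ⟨by simpa [hij] using hω.represents.var i, C, ?_⟩
    simpa [Store.setVar_comm _ hij, Nat.succ_mul] using (hω.setReg_tmp 1).setReg_var i (x + 1)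

lemma runs_copyShadow {a : ℕ} (h : Represents σ s) (hn : σ.reg (tmp d) = n)
    (hF : ∀ x < n, σ.mem (address s.tape.length 0 x) = F x) :
    Runs (copyShadow a d) (2 + n * (a + 16)) σ fun τ =>
      Represents τ (s.setArr a fun x => if x < n then F x else s.arr a x) ∧ Keeps d σ τ := by
  refine (runs_forLt (I := fun y τ => τ.reg (tmp (d + 1)) = y ∧ τ.reg (tmp d) = n ∧
    (∀ x < n, τ.mem (address s.tape.length 0 x) = F x) ∧
    Represents τ (s.setArr a fun x => if x < y then F x else s.arr a x) ∧ Keeps d σ τ)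
    (by simp) (fun y τ hτ => ⟨hτ.1, hτ.2.1⟩) ?_ ?_).mono le_rfl fun τ hτ => hτ.2.2.2
  · exact ⟨by simp, by simpa using hn, hF, by simpa using h.setReg_tmp (d + 1) 0,
      Keeps.refl.setReg_tmp (Nat.le_succ d) 0⟩
  rintro y hy τ ⟨hc, hb, hshadow, hτ, hkeep⟩
  refine (Runs.seq ((hτ.runs_compileAddress hc 0).mono le_rfl fun υ hυ => Runs.seq <|
    runs_load <| Runs.seq <| Runs.mono (Represents.runs_compileAddress (x := y)
      (hυ.setReg_result _).represents ?_ (a + 1)) le_rfl fun ω hω => runs_store ?_)).mono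
      (T := 0 + 5 + (1 + (a + 1 + 5 + 1))) (by omega) fun _ h => h
  · simpa [hυ.keeps (d + 1)] using hc
  have hω' := (hυ.setReg_result _).trans_succ hω
  have value : ω.reg (tmp (d + 2)) = F y := by
    rw [hω'.result, hυ.result, hυ.mem]
    exact hshadow y hy
  rw [hω.result, value]
  have entry : Function.update (fun x => if x < y then F x else s.arr a x) y (F y) =
      fun x => if x < y + 1 then F x else s.arr a x := by
    funext x
    rcases lt_trichotomy x y with hxy | rfl | hxy
    · simp [hxy.ne, hxy, hxy.trans (Nat.lt_succ_self y)]
    · simp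
    · simp [hxy.ne', hxy.not_gt, show ¬ x < y + 1 by omega]
  have copied := hω'.represents.setMem_arr a y (F y)
  simp only [Store.setArr_setArr, Store.arr_setArr, if_true, entry] at copied
  refine ⟨by simpa [hω'.keeps (d + 1)] using hc, by simp,
    by simpa [hω'.keeps d] using hb, fun x hx => ?_,
    (copied.setReg_tmp _ _).setReg_tmp _ _, ?_⟩
  · simpa [hω'.mem] using hshadow x hx
  · exact ((hkeep.trans hω'.keeps (by omega)).setReg_tmp (by omega) _).setReg_tmp (by omega) _

end

/-- Save the variables `i` and `j`, and copy the dimensions `R` and `C`, for a `fill`. -/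
def beginFill (i j R C d : ℕ) : Prog :=
  copy (tmp d) (varReg i) (tmp (d + 5)) ;; copy (tmp (d + 1)) (varReg j) (tmp (d + 5)) ;;
    copy (tmp (d + 2)) (varReg R) (tmp (d + 5)) ;; copy (tmp (d + 3)) (varReg C) (tmp (d + 5)) ;;
    .instr (.const (tmp (d + 4)) 0)

/-- Code with the effect of the statement that uses only temporaries from `d` on. -/
def Stmt.compile : Stmt → ℕ → Prog
  | skip, _ => .skip
  | assign v e, d => e.compile d ;; copy (varReg v) (tmp d) (tmp (d + 1))
  | fill a i j R C e, d => beginFill i j R C d ;;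
      forLt (varReg i) (tmp (d + 2)) (tmp (d + 5))
        (forLt (varReg j) (tmp (d + 3)) (tmp (d + 5)) (fillEntry e d)) ;;
      copyShadow a (d + 4) ;;
      copy (varReg j) (tmp (d + 1)) (tmp (d + 2)) ;; copy (varReg i) (tmp d) (tmp (d + 2))
  | write e f, d => e.compile d ;; f.compile (d + 1) ;;
      .ifLt (tmp d) 1 (.instr (.store (tmp d) (tmp (d + 1)))) .skip
  | seq P Q, d => P.compile d ;; Q.compile d
  | ite c P Q, d => c.compile d ;; branch d (P.compile d) (Q.compile d)
  | loop v b P, d => copy (tmp d) (varReg b) (tmp (d + 1)) ;;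
      forLt (tmp (d + 1)) (tmp d) (tmp (d + 2))
        (copy (varReg v) (tmp (d + 1)) (tmp (d + 2)) ;; P.compile (d + 2))

/-- A bound for the running time of the code, if the bounds of the sums and loops are at most
`N`. -/
def Stmt.time (N : ℕ) : Stmt → ℕ
  | skip => 1
  | assign _ e => e.time N + 2
  | fill a _ _ _ _ e => N * (N * (e.time N + 11) + 5) + N * N * (a + 16) + 17
  | write e f => e.time N + f.time N + 3
  | seq P Q => P.time N + Q.time N
  | ite c P Q => c.time N + P.time N + Q.time N + 2
  | loop _ _ P => N * (P.time N + 5) + 4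

lemma runs_beginFill {i j R C d : ℕ} {s : Store} {σ : State} (h : Represents σ s) :
    Runs (beginFill i j R C d) 9 σ fun τ => Represents τ s ∧ Keeps d σ τ ∧
      τ.reg (tmp d) = s.var i ∧ τ.reg (tmp (d + 1)) = s.var j ∧ τ.reg (tmp (d + 2)) = s.var R ∧
      τ.reg (tmp (d + 3)) = s.var C ∧ τ.reg (tmp (d + 4)) = 0 := by
  refine Runs.seq <| runs_copy (by simp) <| Runs.seq (T' := 5) <| runs_copy (by simp) <|
    Runs.seq (T' := 3) <| runs_copy (by simp) <| Runs.seq (T' := 1) <| runs_copy (by simp) <|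
    runs_const ⟨?_, ?_, ?_⟩
  · repeat' apply Represents.setReg_tmp
    exact h
  · repeat' apply Keeps.setReg_tmp
    any_goals omega
    exact Keeps.refl
  · simp [h.var]

lemma Stmt.run_fill_eq {a i j R C : ℕ} {e : Expr} {s : Store} (hij : i ≠ j) (x y : ℕ) :
    (fill a i j R C e).run s = ((((s.setVar i x).setVar j y).setArr a fun k =>
      if k < s.var R * s.var C then e.eval ((s.setVar i (k / s.var C)).setVar j (k % s.var C))
      else s.arr a k).setVar j (s.var j)).setVar i (s.var i) := by
  change _ = ((((s.setVar i x).setVar j y).setVar j (s.var j)).setVar i (s.var i)).setArr a _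
  rw [Store.setVar_setVar, Store.setVar_comm s hij, Store.setVar_var, Store.setVar_setVar,
    Store.setVar_var, run]

lemma runs_fill {B : Set ℕ} {N a i j R C d : ℕ} {e : Expr} {s : Store} {σ : State}
    (hP : (Stmt.fill a i j R C e).BoundedBy B) (hs : ∀ b ∈ B, s.var b ≤ N)
    (h : Represents σ s) :
    Runs ((Stmt.fill a i j R C e).compile d) ((Stmt.fill a i j R C e).time N) σ fun τ =>
      Represents τ ((Stmt.fill a i j R C e).run s) ∧ Keeps d σ τ := by
  obtain ⟨hij, hR, hC, he⟩ := hP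
  set F : ℕ → ℕ := fun x => e.eval ((s.setVar i (x / s.var C)).setVar j (x % s.var C))
  have copy_time : s.var R * s.var C * (a + 16) ≤ N * N * (a + 16) :=
    Nat.mul_le_mul_right _ (Nat.mul_le_mul (hs R hR) (hs C hC))
  have rows_time : s.var R * (2 + s.var C * (e.time N + 11) + 3) ≤
      N * (N * (e.time N + 11) + 5) := by
    have := Nat.mul_le_mul_right (e.time N + 11) (hs C hC)
    exact Nat.mul_le_mul (hs R hR) (by omega)
  refine (Runs.seq <| (runs_beginFill h).mono le_rfl fun τ ⟨hτ, hkeep, hi, hj, hr, hc, h0⟩ =>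
    Runs.seq <| Runs.mono (Filling.runs_rows (F := F) (n := s.var R) (T := e.time N)
      ⟨hτ, Keeps.refl, h0, by simp⟩ hij hr hc (fun _ => rfl)
      fun x hx y hy ρ => e.runs_compile he fun b hb => ?_) le_rfl fun υ ⟨y, hυ⟩ =>
    Runs.seq <| (runs_copyShadow (n := s.var R * s.var C) hυ.represents hυ.index
      hυ.shadow).mono le_rfl fun ω ⟨hω, hkeep'⟩ => Runs.seq <| runs_copy (by simp) <|
    runs_copy (by simp) ?_).mono (by simp only [Stmt.time]; omega) fun _ h => h
  · simp only [Store.var_setVar]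
    have := hs b hb
    have := hs R hR
    have := hs C hC
    split_ifs <;> omega
  have saved (c : ℕ) (hcd : c < d + 4) : ω.reg (tmp c) = τ.reg (tmp c) := by
    rw [hkeep' c hcd, hυ.keeps c hcd]
  have final := (((hω.setReg_tmp (d + 2) 0).setReg_var j (s.var j)).setReg_tmp
    (d + 2) 0).setReg_var i (s.var i)
  have hi' : (((ω.setReg (tmp (d + 2)) 0).setReg (varReg j) (s.var j)).reg (tmp d)) = s.var i := by
    simp [saved d, hi]
  rw [saved _ (by omega), hj, hi', Stmt.run_fill_eq hij (s.var R) y]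
  refine ⟨final, ?_⟩
  exact ((((hkeep.trans (hυ.keeps.trans hkeep' le_rfl) (by omega)).setReg_tmp (by omega)
    _).setReg_var _ _).setReg_tmp (by omega) _).setReg_var _ _

lemma runs_write {T T' d : ℕ} {e f : Expr} {s : Store} {σ : State}
    (he : Runs (e.compile d) T σ (Returns d σ s (e.eval s)))
    (hf : ∀ τ, Represents τ s →
      Runs (f.compile (d + 1)) T' τ (Returns (d + 1) τ s (f.eval s))) :
    Runs ((Stmt.write e f).compile d) (T + T' + 3) σ fun τ =>
      Represents τ ((Stmt.write e f).run s) ∧ Keeps d σ τ := by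
  refine runs_operands he hf fun τ hτ hf => runs_ifLt (T := 1) (T' := 1)
    (fun hlt => runs_store ?_) fun hge => runs_skip ?_
  · rw [hτ.result, hτ.represents.length] at hlt
    rw [hτ.result, hf]
    exact ⟨hτ.represents.setMem_tape hlt _, hτ.keeps⟩
  · rw [hτ.result, hτ.represents.length] at hge
    simpa only [Stmt.run, List.set_eq_of_length_le (not_lt.mp hge)] using
      ⟨hτ.represents, hτ.keeps⟩

lemma runs_loop {N T d v b : ℕ} {P : Stmt} {s : Store} {σ : State} (hb : s.var b ≤ N)
    (hP : ∀ i τ, Represents τ ((rounds P.run v s i).setVar v i) → Runs (P.compile (d + 2)) T τ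
      fun υ => Represents υ (P.run ((rounds P.run v s i).setVar v i)) ∧ Keeps (d + 2) τ υ)
    (h : Represents σ s) :
    Runs ((Stmt.loop v b P).compile d) (N * (T + 5) + 4) σ fun τ =>
      Represents τ ((Stmt.loop v b P).run s) ∧ Keeps d σ τ := by
  have rounds_time : s.var b * (2 + T + 3) ≤ N * (T + 5) := by
    rw [show 2 + T + 3 = T + 5 by omega]
    exact Nat.mul_le_mul_right _ hb
  refine (Runs.seq <| runs_copy (by simp) <| (runs_forLt (n := s.var b) (T := 2 + T)
    (I := fun i τ => τ.reg (tmp (d + 1)) = i ∧ τ.reg (tmp d) = s.var b ∧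
      Represents τ (rounds P.run v s i) ∧ Keeps d σ τ) (by simp)
    (fun i τ hτ => ⟨hτ.1, hτ.2.1⟩) ?_ ?_).mono le_rfl fun τ hτ => hτ.2.2).mono
    (by omega) fun _ h => h
  · exact ⟨by simp, by simp [h.var], ((h.setReg_tmp _ _).setReg_tmp _ _).setReg_tmp _ _,
      ((Keeps.refl.setReg_tmp (by omega) _).setReg_tmp le_rfl _).setReg_tmp (by omega) _⟩
  rintro i - τ ⟨hc, hb, hτ, hkeep⟩
  refine Runs.seq <| runs_copy (by simp) ?_
  rw [hc]
  refine (hP i _ ((hτ.setReg_tmp _ _).setReg_var v i)).mono le_rfl fun υ ⟨hυ, hkeep'⟩ => ?_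
  have kept (c : ℕ) (hc : c < d + 2) : υ.reg (tmp c) = τ.reg (tmp c) := by
    simpa [hc.ne] using hkeep' c hc
  refine ⟨by rw [kept _ (by omega), hc], by simp, by simp [kept, hb],
    (hυ.setReg_tmp _ _).setReg_tmp _ _, ?_⟩
  refine Keeps.setReg_tmp (Keeps.setReg_tmp (hkeep.trans (e := d) (fun c hc => ?_) le_rfl)
    (by omega) _) (by omega) _
  exact kept c (by omega)

lemma Stmt.runs_compile {B : Set ℕ} {N : ℕ} (P : Stmt) (hP : P.BoundedBy B) {d : ℕ} {s : Store}
    {σ : State} (hs : ∀ b ∈ B, s.var b ≤ N) (h : Represents σ s) :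
    Runs (P.compile d) (P.time N) σ fun τ => Represents τ (P.run s) ∧ Keeps d σ τ := by
  induction P generalizing d s σ with
  | skip => exact runs_skip ⟨h, Keeps.refl⟩
  | assign v e =>
    refine Runs.seq ((e.runs_compile hP.2 hs h).mono le_rfl fun τ hτ => runs_copy (by simp) ?_)
    rw [hτ.result]
    exact ⟨(hτ.represents.setReg_tmp _ _).setReg_var _ _,
      (hτ.keeps.setReg_tmp (Nat.le_succ d) _).setReg_var _ _⟩
  | fill a i j R C e => exact runs_fill hP hs h
  | write e f =>
    exact runs_write (e.runs_compile hP.1 hs h) fun _ hτ => f.runs_compile hP.2 hs hτ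
  | seq P Q ihP ihQ =>
    refine Runs.seq ((ihP hP.1 hs h).mono le_rfl fun τ hτ => (ihQ hP.2 (fun b hb => ?_)
      hτ.1).mono le_rfl fun υ hυ => ⟨hυ.1, hτ.2.trans hυ.2 le_rfl⟩)
    exact (hP.1.run_var hb s).trans_le (hs b hb)
  | ite c P Q ihP ihQ =>
    refine (Runs.seq ((c.runs_compile hP.1 hs h).mono le_rfl fun τ hτ => hτ.runs_branch
      (fun hc υ hυ => (ihP hP.2.1 hs hυ.represents).mono le_rfl fun ω hω => ?_)
      fun hc υ hυ => (ihQ hP.2.2 hs hυ.represents).mono le_rfl fun ω hω => ?_)).mono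
      (by simp only [time]; omega) fun _ h => h
    · simpa only [run, if_pos hc] using ⟨hω.1, hυ.keeps.trans hω.2 le_rfl⟩
    · simpa only [run, if_neg hc] using ⟨hω.1, hυ.keeps.trans hω.2 le_rfl⟩
  | loop v b P ih =>
    refine runs_loop (hs b hP.2.1) (fun i ρ hρ => ih hP.2.2 (fun c hc => ?_) hρ) h
    have hcv : c ≠ v := ne_of_mem_of_not_mem hc hP.1
    rw [Store.var_setVar, if_neg hcv, rounds_var hcv (hP.2.2.run_var hc)]
    exact hs c hc

open Polynomial

/-- The store on the instance `(x, k)`: the variable `0` is `k`, the tape is `x`, and everything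
else is `0`. -/
def initStore (x : List ℕ) (k : ℕ) : Store where
  var := Function.update 0 0 k
  arr := 0
  tape := x

lemma represents_initState (x : List ℕ) (k : ℕ) :
    Represents (initState x k) (initStore x k) where
  var v := by simp only [initState, initStore, varReg, Function.update_apply, Pi.zero_apply]; grind
  length := rfl
  tape _ _ := rfl
  arr a y := List.getD_eq_default _ _ (lt_address _ _ _).le

lemma Expr.exists_time_eq_eval (e : Expr) : ∃ p : ℕ[X], ∀ N, e.time N = p.eval N := by
  induction e with
  | const c => exact ⟨1, by simp [time]⟩
  | var v => exact ⟨2, by simp [time]⟩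
  | tape e ih =>
    obtain ⟨p, hp⟩ := ih
    exact ⟨p + 3, by simp [time, hp]⟩
  | read a e ih =>
    obtain ⟨p, hp⟩ := ih
    exact ⟨p + C (a + 7), by simp [time, hp]⟩
  | add e f ihe ihf | sub e f ihe ihf =>
    obtain ⟨⟨p, hp⟩, q, hq⟩ := ihe, ihf
    exact ⟨p + q + 1, by simp [time, hp, hq]⟩
  | lt e f ihe ihf =>
    obtain ⟨⟨p, hp⟩, q, hq⟩ := ihe, ihf
    exact ⟨p + q + 3, by simp [time, hp, hq]⟩
  | ite c e f ihc ihe ihf =>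
    obtain ⟨⟨r, hr⟩, ⟨p, hp⟩, q, hq⟩ := ihc, ihe, ihf
    exact ⟨r + p + q + 2, by simp [time, hp, hq, hr]⟩
  | sum v b e ih =>
    obtain ⟨p, hp⟩ := ih
    exact ⟨X * (p + 4) + 9, by simp [time, hp]⟩

lemma Stmt.exists_time_eq_eval (P : Stmt) : ∃ p : ℕ[X], ∀ N, P.time N = p.eval N := by
  induction P with
  | skip => exact ⟨1, by simp [time]⟩
  | assign v e =>
    obtain ⟨p, hp⟩ := e.exists_time_eq_eval
    exact ⟨p + 2, by simp [time, hp]⟩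
  | fill a i j R C e =>
    obtain ⟨p, hp⟩ := e.exists_time_eq_eval
    exact ⟨X * (X * (p + 11) + 5) + X * X * Polynomial.C (a + 16) + 17, by simp [time, hp]⟩
  | write e f =>
    obtain ⟨⟨p, hp⟩, q, hq⟩ := e.exists_time_eq_eval, f.exists_time_eq_eval
    exact ⟨p + q + 3, by simp [time, hp, hq]⟩
  | seq P Q ihP ihQ =>
    obtain ⟨⟨p, hp⟩, q, hq⟩ := ihP, ihQ
    exact ⟨p + q, by simp [time, hp, hq]⟩
  | ite c P Q ihP ihQ =>
    obtain ⟨⟨r, hr⟩, ⟨p, hp⟩, q, hq⟩ := c.exists_time_eq_eval, ihP, ihQ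
    exact ⟨r + p + q + 2, by simp [time, hp, hq, hr]⟩
  | loop v b P ih =>
    obtain ⟨p, hp⟩ := ih
    exact ⟨X * (p + 5) + 4, by simp [time, hp]⟩

end LoopLang

open Polynomial in
lemma polynomial_eval_le (p : ℕ[X]) (x : ℕ) : p.eval x ≤ p.eval 1 * (x + 1) ^ p.natDegree := by
  rw [eval_eq_sum_range, eval_eq_sum_range, Finset.sum_mul]
  refine Finset.sum_le_sum fun i hi => ?_
  rw [one_pow, mul_one]
  have hpow : x ^ i ≤ (x + 1) ^ p.natDegree :=
    (Nat.pow_le_pow_left x.le_succ i).trans <|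
      Nat.pow_le_pow_right x.succ_pos (Nat.lt_succ_iff.1 (Finset.mem_range.1 hi))
  exact Nat.mul_le_mul_left _ hpow

/-! ## Sum-free sets of rows -/

section Classes

open Finset Submodule

variable {R V ι : Type*} [Ring R] [AddCommGroup V] [Module R V] {a : ι → V}
  {W W' W'' : Submodule R V} {u : ι}

/-- The vector `a u` cannot be chosen after the vectors that span `W'` modulo `W`: it vanishes
modulo `W'`, or coincides modulo `W'`, but not modulo `W`, with another vector. -/
def Blocked (a : ι → V) (W W' : Submodule R V) (u : ι) : Prop :=
  a u ∈ W' ∨ ∃ i, a i - a u ∈ W' ∧ a i - a u ∉ W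

lemma Blocked.mono (h : Blocked a W W' u) (hW : W' ≤ W'') : Blocked a W W'' u :=
  h.imp (@hW _) fun ⟨i, hi, hi'⟩ => ⟨i, hW hi, hi'⟩

variable [Fintype ι]

open Classical in
/-- The number of nonzero classes modulo `W` of the vectors `a i`. -/
noncomputable def classCount (a : ι → V) (W : Submodule R V) : ℕ :=
  #{x ∈ univ.image (W.mkQ ∘ a) | x ≠ 0}

lemma classCount_le_card : classCount a W ≤ Fintype.card ι := by
  classical exact (card_filter_le _ _).trans card_image_le

lemma classCount_eq_zero_iff : classCount a W = 0 ↔ ∀ i, a i ∈ W := by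
  simp only [classCount, card_eq_zero, filter_eq_empty_iff, mem_image, mem_univ, true_and,
    forall_exists_index, forall_apply_eq_imp_iff, Function.comp_apply, mkQ_apply, ne_eq,
    Quotient.mk_eq_zero, not_not]

theorem two_mul_classCount_le (hW : W ≤ W') (h : ∀ u, Blocked a W W' u) :
    2 * classCount a W' ≤ classCount a W := by
  classical
  -- Every nonzero class modulo `W'` contains at least two nonzero classes modulo `W`.
  refine (mul_card_image_le_card_of_maps_to (f := factor hW)
    (s := {x ∈ univ.image (W.mkQ ∘ a) | factor hW x ≠ 0}) ?_ 2 ?_).trans (card_le_card ?_)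
  · simp only [mem_filter, mem_image, mem_univ, true_and, Function.comp_apply]
    rintro _ ⟨⟨u, rfl⟩, hu⟩
    exact ⟨⟨u, rfl⟩, hu⟩
  · simp only [mem_filter, mem_image, mem_univ, true_and, Function.comp_apply]
    rintro _ ⟨⟨u, rfl⟩, hu⟩
    have mem_fibre (i) (hi : W'.mkQ (a i) = W'.mkQ (a u)) :
        W.mkQ (a i) ∈ ({x ∈ {x ∈ univ.image (W.mkQ ∘ a) | factor hW x ≠ 0} |
          factor hW x = W'.mkQ (a u)} : Finset (V ⧸ W)) :=
      mem_filter.2 ⟨mem_filter.2 ⟨mem_image_of_mem _ (mem_univ i), fun h => hu (hi ▸ h)⟩, hi⟩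
    rw [mkQ_apply, ne_eq, Quotient.mk_eq_zero] at hu
    obtain ⟨i, hi, hi'⟩ := (h u).resolve_left hu
    have hiu : factor hW (W.mkQ (a i)) = W'.mkQ (a u) := (Submodule.Quotient.eq W').2 hi
    refine one_lt_card.2 ⟨W.mkQ (a i), ?_, W.mkQ (a u), ?_, fun h =>
      hi' ((Submodule.Quotient.eq W).1 h)⟩
    · exact mem_fibre i hiu
    · exact mem_fibre u rfl
  · refine fun x hx => mem_filter.2 ⟨(mem_filter.1 hx).1, ?_⟩
    rintro rfl
    exact (mem_filter.1 hx).2 (map_zero _)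

end Classes

section SumFree

open Finset Submodule

variable {V ι : Type*} [AddCommGroup V] [Module (ZMod 2) V] {a : ι → V} {K S : Set ι}
  {W : Submodule (ZMod 2) V} {r i : ι}

/-- The vectors `a i` with `i ∈ K` are linearly independent, and no other vector of the family `a`
is a sum of some of them. -/
def SumFree (a : ι → V) (K : Set ι) : Prop :=
  LinearIndepOn (ZMod 2) a K ∧ ∀ i, a i ∈ span (ZMod 2) (a '' K) → i ∈ K

lemma mem_span_insert_iff {v x : V} {s : Set V} :
    x ∈ span (ZMod 2) (insert v s) ↔ x ∈ span (ZMod 2) s ∨ x - v ∈ span (ZMod 2) s := by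
  rw [Submodule.mem_span_insert]
  constructor
  · rintro ⟨c, z, hz, rfl⟩
    obtain rfl | rfl : c = 0 ∨ c = 1 := by decide +revert
    · exact Or.inl (by simpa using hz)
    · exact Or.inr (by simpa using hz)
  · rintro (hx | hx)
    · exact ⟨0, x, hx, by simp⟩
    · exact ⟨1, x - v, hx, by simp⟩

lemma sup_span_image_insert : W ⊔ span (ZMod 2) (a '' insert r K) =
    W ⊔ span (ZMod 2) (a '' K) ⊔ span (ZMod 2) {a r} := by
  rw [Set.image_insert_eq, span_insert, sup_comm (span _ {_}), sup_assoc]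

lemma sumFree_empty (ha : ∀ i, a i ≠ 0) : SumFree a ∅ := by
  refine ⟨linearIndepOn_empty _ _, fun i hi => (ha i ?_).elim⟩
  simpa using hi

theorem SumFree.insert (hK : SumFree a K) (ha : Function.Injective a)
    (hW : Disjoint W (span (ZMod 2) (a '' K))) (hr : ¬ Blocked a W (W ⊔ span (ZMod 2) (a '' K)) r) :
    SumFree a (insert r K) ∧ Disjoint W (span (ZMod 2) (a '' insert r K)) := by
  simp only [Blocked, not_or, not_exists, not_and, not_not] at hr
  obtain ⟨hr, hclass⟩ := hr
  have hrK : a r ∉ span (ZMod 2) (a '' K) := fun h => hr (mem_sup_right h)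
  refine ⟨⟨hK.1.insert hrK, fun i hi => ?_⟩, ?_⟩
  · rw [Set.image_insert_eq, mem_span_insert_iff] at hi
    obtain hi | hi := hi
    · exact Set.mem_insert_of_mem _ (hK.2 i hi)
    · have hir := disjoint_def.1 hW _ (hclass i (mem_sup_right hi)) hi
      exact Set.mem_insert_iff.2 (Or.inl (ha (sub_eq_zero.1 hir)))
  · rw [Set.image_insert_eq, span_insert, sup_comm]
    refine hW.disjoint_sup_right_of_disjoint_sup_left ?_
    exact (disjoint_span_singleton' fun h => hr (by rw [h]; exact zero_mem _)).2 hr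

lemma SumFree.notMem_span (hK : SumFree a K) (hS : S ⊆ K) (hr : r ∈ K) (hrS : r ∉ S) :
    a r ∉ span (ZMod 2) (a '' S) := fun h =>
  hK.1.notMem_span hr <| span_mono (Set.image_mono (Set.subset_sdiff_singleton hS hrS)) h

theorem SumFree.eq_of_sub_mem_span (hK : SumFree a K) (hS : S ⊆ K) (hr : r ∈ K) (hrS : r ∉ S)
    (h : a i - a r ∈ span (ZMod 2) (a '' S)) : i = r := by
  have hi : i ∈ K := hK.2 i <| by
    rw [← sub_add_cancel (a i) (a r)]
    exact add_mem (span_mono (Set.image_mono hS) h) (subset_span ⟨r, hr, rfl⟩)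
  by_contra hir
  refine hK.1.notMem_span hr ?_
  rw [← sub_sub_cancel (a i) (a r)]
  refine sub_mem (subset_span ⟨i, ⟨hi, hir⟩, rfl⟩) <|
    span_mono (Set.image_mono (Set.subset_sdiff_singleton hS hrS)) h

variable [Fintype ι] {k n : ℕ}

/-- After `n` failed passes of the greedy search for `k` vectors: the rejected vectors span a space
of dimension at most `n * k`, and each pass has halved the number of classes. -/
structure FailedPasses (a : ι → V) (k n : ℕ) (W : Submodule (ZMod 2) V) : Prop where
  finrank_le : Module.finrank (ZMod 2) W ≤ n * k
  classCount_le : 2 ^ n * classCount a W ≤ Fintype.card ι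

lemma failedPasses_zero : FailedPasses a k 0 ⊥ where
  finrank_le := by simp
  classCount_le := by simpa using classCount_le_card

lemma FailedPasses.succ [FiniteDimensional (ZMod 2) V]
    (h : FailedPasses a k n W) {K : Finset ι} (hK : #K ≤ k)
    (hblocked : ∀ u, Blocked a W (W ⊔ span (ZMod 2) (a '' K)) u) :
    FailedPasses a k (n + 1) (W ⊔ span (ZMod 2) (a '' K)) where
  finrank_le := by
    classical
    have hspan : Module.finrank (ZMod 2) (span (ZMod 2) (a '' K)) ≤ k := by
      rw [← coe_image]
      exact (finrank_span_finset_le_card _).trans (card_image_le.trans hK)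
    have := finrank_add_le_finrank_add_finrank W (span (ZMod 2) (a '' K))
    have := h.finrank_le
    lia
  classCount_le := by
    have := two_mul_classCount_le le_sup_left hblocked
    calc 2 ^ (n + 1) * classCount a (W ⊔ span (ZMod 2) (a '' K))
        = 2 ^ n * (2 * classCount a (W ⊔ span (ZMod 2) (a '' K))) := by ring
      _ ≤ 2 ^ n * classCount a W := by gcongr
      _ ≤ Fintype.card ι := h.classCount_le

lemma FailedPasses.finrank_le_of_lt_two_pow (h : FailedPasses a k n W)
    (ha : span (ZMod 2) (Set.range a) = ⊤) (hn : Fintype.card ι < 2 ^ n) :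
    Module.finrank (ZMod 2) V ≤ n * k := by
  have hclass : classCount a W = 0 :=
    Nat.eq_zero_of_not_pos fun hpos =>
      (h.classCount_le.trans_lt hn).not_ge (Nat.le_mul_of_pos_right _ hpos)
  have hW : W = ⊤ := top_le_iff.1 <| ha ▸ span_le.2 (Set.range_subset_iff.2 <|
    classCount_eq_zero_iff.1 hclass)
  rw [← finrank_top (ZMod 2) V, ← hW]
  exact h.finrank_le

end SumFree

/-! ## Elimination with a majority rule -/

/-- The affine functionals `z ↦ coeff i ⬝ᵥ z + rhs i`. -/
structure Tableau (ι κ : Type*) where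
  coeff : ι → κ → ZMod 2
  rhs : ι → ZMod 2

namespace Tableau

open Finset Submodule

variable {ι κ : Type*} {T T' T₀ : Tableau ι κ} {W : Submodule (ZMod 2) (κ → ZMod 2)} {r : ι} {j : κ}
  {c : ZMod 2} {w : ι → ℕ}

/-- The result of solving `coeff r ⬝ᵥ z = c` for `z j` and substituting. -/
def eliminate (T : Tableau ι κ) (r : ι) (j : κ) (c : ZMod 2) : Tableau ι κ where
  coeff i := T.coeff i + T.coeff i j • T.coeff r
  rhs i := T.rhs i + T.coeff i j * c

lemma ker_id_add_smulRight_proj {v : κ → ZMod 2} (hv : v j = 1) :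
    (LinearMap.id + (LinearMap.proj j).smulRight v :
      (κ → ZMod 2) →ₗ[ZMod 2] κ → ZMod 2).ker = span (ZMod 2) {v} := by
  ext x
  simp only [LinearMap.mem_ker, LinearMap.add_apply, LinearMap.id_apply,
    LinearMap.smulRight_apply, LinearMap.proj_apply, mem_span_singleton]
  constructor
  · exact fun hx => ⟨-x j, by rw [neg_smul, ← eq_neg_of_add_eq_zero_left hx]⟩
  · rintro ⟨c, rfl⟩
    rw [Pi.smul_apply, hv, smul_eq_mul, mul_one, ← add_smul, CharTwo.add_self_eq_zero, zero_smul]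

variable [Fintype κ]

/-- The values of the functionals. -/
def residual (T : Tableau ι κ) (z : κ → ZMod 2) (i : ι) : ZMod 2 := T.coeff i ⬝ᵥ z + T.rhs i

/-- `T` arises from `T₀` by a substitution that kills exactly the left-hand sides in `W`. -/
structure ReducesTo (T₀ : Tableau ι κ) (W : Submodule (ZMod 2) (κ → ZMod 2)) (T : Tableau ι κ) :
    Prop where
  coeff : ∃ φ : (κ → ZMod 2) →ₗ[ZMod 2] κ → ZMod 2,
    (∀ i, T.coeff i = φ (T₀.coeff i)) ∧ φ.ker = W
  residual : ∀ z, ∃ z₀, T₀.residual z₀ = T.residual z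

lemma ReducesTo.refl (T : Tableau ι κ) : T.ReducesTo ⊥ T where
  coeff := ⟨.id, fun _ => rfl, LinearMap.ker_id⟩
  residual z := ⟨z, rfl⟩

lemma ReducesTo.coeff_eq_iff (h : T₀.ReducesTo W T) {i r : ι} :
    T.coeff i = T.coeff r ↔ T₀.coeff i - T₀.coeff r ∈ W := by
  obtain ⟨φ, hφ, rfl⟩ := h.coeff
  rw [hφ, hφ, LinearMap.sub_mem_ker_iff]

lemma ReducesTo.coeff_eq_zero_iff (h : T₀.ReducesTo W T) {i : ι} :
    T.coeff i = 0 ↔ T₀.coeff i ∈ W := by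
  obtain ⟨φ, hφ, rfl⟩ := h.coeff
  rw [hφ, LinearMap.mem_ker]

lemma residual_eliminate [DecidableEq κ] (z : κ → ZMod 2) :
    (T.eliminate r j c).residual z =
      T.residual (z + (T.coeff r ⬝ᵥ z + c) • Pi.single j 1) := by
  ext i
  simp only [residual, eliminate, add_dotProduct, smul_dotProduct, dotProduct_add,
    dotProduct_smul, dotProduct_single, smul_eq_mul]
  ring

theorem ReducesTo.eliminate (h : T₀.ReducesTo W T) (hj : T.coeff r j = 1) (c : ZMod 2) :
    T₀.ReducesTo (W ⊔ span (ZMod 2) {T₀.coeff r}) (T.eliminate r j c) where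
  coeff := by
    obtain ⟨φ, hφ, rfl⟩ := h.coeff
    refine ⟨(.id + (LinearMap.proj j).smulRight (T.coeff r)) ∘ₗ φ,
      fun i => by simp [Tableau.eliminate, hφ], ?_⟩
    rw [LinearMap.ker_comp, ker_id_add_smulRight_proj hj, hφ, ← Set.image_singleton,
      ← map_span, comap_map_eq, sup_comm]
  residual z := by
    classical
    rw [residual_eliminate]
    exact h.residual _

/-- The weight `w` of an equation, if its residual `x` is zero, and `-w` otherwise. -/
def gain (x : ZMod 2) (w : ℕ) : ℤ := if x = 0 then w else -w

variable [Fintype ι]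

/-- The excess of the rows without variables. -/
def constantGain (T : Tableau ι κ) (w : ι → ℕ) : ℤ :=
  ∑ i with T.coeff i = 0, gain (T.rhs i) (w i)

/-- The excess, under `T.coeff r ⬝ᵥ z = c`, of the rows with the same left-hand side as `r`. -/
def classGain (T : Tableau ι κ) (w : ι → ℕ) (r : ι) (c : ZMod 2) : ℤ :=
  ∑ i with T.coeff i = T.coeff r, gain (T.rhs i + c) (w i)

lemma classGain_eq (r : ι) (c : ZMod 2) : T.classGain w r c =
    ((∑ i with T.coeff i = T.coeff r ∧ T.rhs i = c, w i : ℕ) : ℤ) -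
      (∑ i with T.coeff i = T.coeff r ∧ T.rhs i ≠ c, w i : ℕ) := by
  simp only [classGain, gain, CharTwo.add_eq_zero]
  rw [sum_ite, sum_neg_distrib, filter_filter, filter_filter, Nat.cast_sum, Nat.cast_sum,
    ← sub_eq_add_neg]

theorem constantGain_eliminate (hj : T.coeff r j = 1) :
    (T.eliminate r j c).constantGain w = T.constantGain w + T.classGain w r c := by
  classical
  have hr : T.coeff r ≠ 0 := fun h => by simp [h] at hj
  have hzero (i : ι) : (T.eliminate r j c).coeff i = 0 ↔ T.coeff i = 0 ∨ T.coeff i = T.coeff r := by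
    obtain hij | hij : T.coeff i j = 0 ∨ T.coeff i j = 1 := by
      generalize T.coeff i j = x
      decide +revert
    · have hir : T.coeff i ≠ T.coeff r := fun h => by simp [h, hj] at hij
      simp [eliminate, hij, hir]
    · have hi : T.coeff i ≠ 0 := fun h => by simp [h] at hij
      simp only [eliminate, hij, one_smul, hi, false_or]
      rw [← ZModModule.sub_eq_add, sub_eq_zero]
  have hdisj : Disjoint ({i | T.coeff i = 0} : Finset ι)
      ({i | T.coeff i = T.coeff r} : Finset ι) :=
    disjoint_filter.2 fun i _ hi hi' => hr (hi' ▸ hi)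
  simp only [constantGain, classGain, hzero, filter_or]
  rw [sum_union hdisj]
  congr 1
  · refine sum_congr rfl fun i hi => ?_
    simp [eliminate, (mem_filter.1 hi).2]
  · refine sum_congr rfl fun i hi => ?_
    simp [eliminate, (mem_filter.1 hi).2, hj]

/-- The row `r` is eliminated by a majority decision among the rows with the same left-hand side;
if it has no variables, nothing happens. -/
def Step (w : ι → ℕ) (r : ι) (T T' : Tableau ι κ) : Prop :=
  T.coeff r = 0 ∧ T' = T ∨
    ∃ j c, T.coeff r j = 1 ∧ 0 ≤ T.classGain w r c ∧ T' = T.eliminate r j c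

lemma ReducesTo.step (h : T₀.ReducesTo W T) (hT : Step w r T T') :
    T₀.ReducesTo (W ⊔ span (ZMod 2) {T₀.coeff r}) T' := by
  obtain ⟨hr, rfl⟩ | ⟨j, c, hj, -, rfl⟩ := hT
  · rwa [sup_eq_left.2 ((span_singleton_le_iff_mem _ _).2 (h.coeff_eq_zero_iff.1 hr))]
  · exact h.eliminate hj c

lemma Step.constantGain_le (hT : Step w r T T') : T.constantGain w ≤ T'.constantGain w := by
  obtain ⟨-, rfl⟩ | ⟨j, c, hj, hc, rfl⟩ := hT
  · exact le_rfl
  · rw [constantGain_eliminate hj]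
    lia

lemma Step.constantGain_add_le (hT : Step w r T T') (hr : T.coeff r ≠ 0)
    (hclass : ∀ i, T.coeff i = T.coeff r → i ≠ r → w i = 0) :
    T.constantGain w + w r ≤ T'.constantGain w := by
  obtain ⟨hr', -⟩ | ⟨j, c, hj, hc, rfl⟩ := hT
  · exact (hr hr').elim
  have hgain : T.classGain w r c = gain (T.rhs r + c) (w r) :=
    sum_eq_single_of_mem r (by simp) fun i hi hir => by
      simp [gain, hclass i (mem_filter.1 hi).2 hir]
  rw [constantGain_eliminate hj]
  rw [hgain] at hc ⊢
  unfold gain at *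
  split_ifs at * <;> lia

end Tableau

/-! ## Expressions of the program -/

local notation:60 P:61 ";;" Q:60 => LoopLang.Stmt.seq P Q

local notation "vK" => 0
local notation "vN" => 1
local notation "vEqs" => 2
local notation "vRows" => 3
local notation "vWidth" => 4
local notation "vWeight" => 5
local notation "vOne" => 6
local notation "vPow" => 7
local notation "vRow" => 8
local notation "vRound" => 9
local notation "vCount" => 10
local notation "vPivot" => 11
local notation "vChoice" => 12
local notation "vI" => 13
local notation "vJ" => 14
local notation "vL" => 15
local notation "vD" => 16
local notation "vFound" => 17

-- The tableau of the input, the tableau at the start of a pass, the current tableau, the marks of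
-- the selected equations, the current assignment, and the solution.
local notation "aX" => 0
local notation "aU" => 1
local notation "aV" => 2
local notation "aG" => 3
local notation "aZ" => 4
local notation "aY" => 5

namespace LoopLang

open Finset

namespace Expr

variable {e f : Expr} {s : Store} {v b : ℕ}

/-- Negation of a truth value. -/
def not (e : Expr) : Expr := .ite e (.const 0) (.const 1)

/-- Conjunction of truth values. -/
def and (e f : Expr) : Expr := .ite e f (.const 0)

/-- Equality test. -/
def eq (e f : Expr) : Expr := .not (.add (.lt e f) (.lt f e))

/-- Bounded universal quantification. -/
def all (v b : ℕ) (e : Expr) : Expr := .not (.sum v b (.not e))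

/-- Addition modulo `2` of two bits. -/
def xor (e f : Expr) : Expr := .ite e (.not f) f

/-- The quotient `⌊e / 2⌋`, as long as it is at most the variable `b`; the auxiliary variable `v`
must not occur in `e`. -/
def half (v b : ℕ) (e : Expr) : Expr := .sum v b (.lt (.add (.add (.var v) (.var v)) (.const 1)) e)

/-- The remainder of `e` modulo `2`, with the conventions of `Expr.half`. -/
def parity (v b : ℕ) (e : Expr) : Expr := .sub e (.add (.half v b e) (.half v b e))

lemma eval_not : e.not.eval s = if 0 < e.eval s then 0 else 1 := rfl

lemma eval_and : (e.and f).eval s = if 0 < e.eval s then f.eval s else 0 := rfl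

@[simp] lemma eval_lt_pos : 0 < (lt e f).eval s ↔ e.eval s < f.eval s := by
  simp only [eval]
  split_ifs <;> simp_all

@[simp] lemma eval_not_pos : 0 < e.not.eval s ↔ ¬ 0 < e.eval s := by
  simp only [eval_not]
  split_ifs <;> simp_all

@[simp] lemma eval_and_pos : 0 < (e.and f).eval s ↔ 0 < e.eval s ∧ 0 < f.eval s := by
  simp only [eval_and]
  split_ifs <;> simp_all

@[simp] lemma eval_eq_pos : 0 < (e.eq f).eval s ↔ e.eval s = f.eval s := by
  simp only [eq, eval_not_pos, eval]
  split_ifs <;> lia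

@[simp] lemma eval_all_pos :
    0 < (all v b e).eval s ↔ ∀ x < s.var b, 0 < e.eval (s.setVar v x) := by
  simp only [all, eval_not_pos, eval, sum_pos_iff, mem_range, not_exists, not_and, not_not]

lemma eval_xor {x y : ZMod 2} (he : e.eval s = x.val) (hf : f.eval s = y.val) :
    (e.xor f).eval s = (x + y).val := by
  simp only [xor, eval, eval_not, he, hf]
  clear he hf
  decide +revert

lemma eval_half (he : ∀ x, e.eval (s.setVar v x) = e.eval s) (hb : e.eval s ≤ 2 * s.var b + 1) :
    (half v b e).eval s = e.eval s / 2 := by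
  have hfilter : {x ∈ range (s.var b) | x + x + 1 < e.eval s} = range (e.eval s / 2) := by
    ext x
    simp only [mem_filter, mem_range]
    lia
  simp only [half, eval, he, Store.var_setVar, if_true, sum_boole, hfilter, card_range,
    Nat.cast_id]

lemma eval_parity (he : ∀ x, e.eval (s.setVar v x) = e.eval s)
    (hb : e.eval s ≤ 2 * s.var b + 1) : (parity v b e).eval s = e.eval s % 2 := by
  simp only [parity, eval, eval_half he hb]
  lia

end Expr

/-! ## Tableaux in the store -/

/-- The entry in row `u` and column `v` of the array `a`, for variables `u` and `v`. -/
def entry (a u v : ℕ) : Expr := .read a (.add (.sum vD vWidth (.var u)) (.var v))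

/-- The rows `vI` and `vRow` of the array `a` have the same coefficients. -/
def sameRow (a : ℕ) : Expr := .all vJ vN (.eq (entry a vI vJ) (entry a vRow vJ))

/-- All coefficients in the row `vRow` of the array `a` are zero. -/
def zeroRow (a : ℕ) : Expr := .all vJ vN (.not (entry a vRow vJ))

/-- The number of leading zeros in the row `vRow` of the array `a`. -/
def leadingZeros (a : ℕ) : Expr :=
  .sum vL vN <| .ite (.all vJ vN (.not (.and (entry a vRow vJ) (.not (.lt (.var vL) (.var vJ))))))
    (.const 1) (.const 0)

/-- The weight of the equations that have the same coefficients as the row `vRow` of the array `a`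
and satisfy the test `e` at `vI`. -/
def classWeight (a : ℕ) (e : Expr) : Expr :=
  .sum vI vRows (.ite (.and (sameRow a) e) (entry a vI vWeight) (.const 0))

/-- The right-hand side that has the majority among the equations with the same coefficients as the
row `vRow` of the array `a`. -/
def majority (a : ℕ) : Expr :=
  .lt (classWeight a (.not (entry a vI vN))) (classWeight a (entry a vI vN))

/-- The variables of the store that describe a system of `m` equations in `n` variables, and the
parameter `k`. -/
structure Sized (k n m : ℕ) (s : Store) : Prop where
  parameter : s.var vK = k
  cols : s.var vN = n
  equations : s.var vEqs = m
  rows : s.var vRows = m + n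
  width : s.var vWidth = n + 2
  weight : s.var vWeight = n + 1
  one : s.var vOne = 1

lemma Sized.setVar {k n m v : ℕ} {s : Store} (h : Sized k n m s) (hv : 6 < v) (x : ℕ) :
    Sized k n m (s.setVar v x) := by
  constructor <;> rw [Store.var_setVar, if_neg (by lia)]
  exacts [h.parameter, h.cols, h.equations, h.rows, h.width, h.weight, h.one]

lemma Sized.setArr {k n m : ℕ} {s : Store} (h : Sized k n m s) (a : ℕ) (f : ℕ → ℕ) :
    Sized k n m (s.setArr a f) := by
  constructor
  exacts [h.parameter, h.cols, h.equations, h.rows, h.width, h.weight, h.one]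

/-- The array `f` consists of the rows of `T`, each one followed by its weight. -/
structure _root_.Tableau.StoredIn {n M : ℕ} (T : Tableau (Fin M) (Fin n)) (w : Fin M → ℕ)
    (f : ℕ → ℕ) : Prop where
  coeff : ∀ (i : Fin M) (j : Fin n), f ((n + 2) * i + j) = (T.coeff i j).val
  rhs : ∀ i : Fin M, f ((n + 2) * i + n) = (T.rhs i).val
  weight : ∀ i : Fin M, f ((n + 2) * i + (n + 1)) = w i

section

variable {k n m a u v : ℕ} {s : Store} {T : Tableau (Fin (m + n)) (Fin n)} {w : Fin (m + n) → ℕ}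
  {i r : Fin (m + n)} {j : Fin n}

lemma eval_entry (hs : Sized k n m s) (hu : u ≠ vD) :
    (entry a u v).eval s = s.arr a ((n + 2) * s.var u + s.var v) := by
  simp [entry, Expr.eval, hu, hs.width]

lemma eval_entry_coeff (hs : Sized k n m s) (hT : T.StoredIn w (s.arr a)) (hu : s.var u = i)
    (hv : s.var v = j) (huD : u ≠ vD := by decide) :
    (entry a u v).eval s = (T.coeff i j).val := by
  rw [eval_entry hs huD, hu, hv, hT.coeff]

lemma eval_entry_rhs (hs : Sized k n m s) (hT : T.StoredIn w (s.arr a)) (hu : s.var u = i)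
    (huD : u ≠ vD := by decide) : (entry a u vN).eval s = (T.rhs i).val := by
  rw [eval_entry hs huD, hu, hs.cols, hT.rhs]

lemma eval_entry_weight (hs : Sized k n m s) (hT : T.StoredIn w (s.arr a)) (hu : s.var u = i)
    (huD : u ≠ vD := by decide) : (entry a u vWeight).eval s = w i := by
  rw [eval_entry hs huD, hu, hs.weight, hT.weight]

lemma Sized.forall_cols (hs : Sized k n m s) {p : ℕ → Prop} :
    (∀ x < s.var vN, p x) ↔ ∀ j : Fin n, p j := by
  rw [hs.cols, Fin.forall_iff]

lemma eval_sameRow (hs : Sized k n m s) (hT : T.StoredIn w (s.arr a)) (hi : s.var vI = i)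
    (hr : s.var vRow = r) : 0 < (sameRow a).eval s ↔ T.coeff i = T.coeff r := by
  simp only [sameRow, Expr.eval_all_pos, hs.forall_cols, Expr.eval_eq_pos, funext_iff]
  refine forall_congr' fun j => ?_
  have hs' : Sized k n m (s.setVar vJ j) := hs.setVar (by decide) _
  rw [eval_entry_coeff (u := vI) hs' hT hi (j := j) rfl,
    eval_entry_coeff (u := vRow) hs' hT hr (j := j) rfl,
    (ZMod.val_injective 2).eq_iff]

lemma eval_zeroRow (hs : Sized k n m s) (hT : T.StoredIn w (s.arr a)) (hr : s.var vRow = r) :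
    0 < (zeroRow a).eval s ↔ T.coeff r = 0 := by
  simp only [zeroRow, Expr.eval_all_pos, hs.forall_cols, Expr.eval_not_pos, funext_iff]
  refine forall_congr' fun j => ?_
  have hs' : Sized k n m (s.setVar vJ j) := hs.setVar (by decide) _
  rw [eval_entry_coeff (u := vRow) hs' hT hr (j := j) rfl, ZMod.val_pos, not_not,
    Pi.zero_apply]

lemma exists_eval_leadingZeros (hs : Sized k n m s) (hT : T.StoredIn w (s.arr a))
    (hr : s.var vRow = r) (h0 : T.coeff r ≠ 0) :
    ∃ j : Fin n, (leadingZeros a).eval s = j ∧ T.coeff r j = 1 := by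
  obtain ⟨j, hj, hmin⟩ : ∃ j, T.coeff r j ≠ 0 ∧ ∀ l < j, T.coeff r l = 0 := by
    obtain ⟨j, hj, hmin⟩ := exists_minimal_of_wellFoundedLT (fun j => T.coeff r j ≠ 0)
      (Function.ne_iff.1 h0)
    exact ⟨j, hj, fun l hl => not_not.1 fun h => hl.not_ge (hmin h hl.le)⟩
  have hbefore (l : ℕ) : 0 < (Expr.all vJ vN (.not (.and (entry a vRow vJ)
      (.not (.lt (.var vL) (.var vJ)))))).eval (s.setVar vL l) ↔ l < j := by
    have hs' : Sized k n m (s.setVar vL l) := hs.setVar (by decide) _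
    simp only [Expr.eval_all_pos, hs'.forall_cols, Expr.eval_not_pos, Expr.eval_and_pos,
      Expr.eval_lt_pos]
    have hentry (x : Fin n) : 0 < (entry a vRow vJ).eval ((s.setVar vL l).setVar vJ x) ↔
        T.coeff r x ≠ 0 := by
      have hs'' : Sized k n m ((s.setVar vL l).setVar vJ x) := hs'.setVar (by decide) _
      rw [eval_entry_coeff (u := vRow) hs'' hT hr (j := x) rfl, ZMod.val_pos]
    simp only [hentry, Expr.eval]
    constructor
    · intro h
      by_contra hl
      exact h j ⟨hj, hl⟩
    · rintro hl x ⟨hx, hlx⟩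
      exact hx (hmin x (Fin.lt_def.2 ((not_lt.1 hlx).trans_lt hl)))
  refine ⟨j, ?_, (ZMod.val_injective 2).eq_iff.1 ?_⟩
  · have hfilter : ({l ∈ range n | l < (j : ℕ)} : Finset ℕ) = range j := by
      ext l
      simp only [mem_filter, mem_range]
      lia
    simp only [leadingZeros, Expr.eval, hs.cols, hbefore]
    rw [sum_boole, hfilter, card_range, Nat.cast_id]
  · generalize T.coeff r j = x at hj
    decide +revert

lemma eval_classWeight (hs : Sized k n m s) (hT : T.StoredIn w (s.arr a)) (hr : s.var vRow = r)
    {e : Expr} {p : Fin (m + n) → Prop} [DecidablePred p]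
    (he : ∀ i : Fin (m + n), 0 < e.eval (s.setVar vI i) ↔ p i) :
    (classWeight a e).eval s = ∑ i with T.coeff i = T.coeff r ∧ p i, w i := by
  simp only [classWeight, Expr.eval, hs.rows, sum_range]
  rw [sum_filter]
  refine sum_congr rfl fun i _ => ?_
  have hs' : Sized k n m (s.setVar vI i) := hs.setVar (by decide) _
  rw [eval_entry_weight hs' hT (i := i) rfl]
  congr 1
  rw [Expr.eval_and_pos, eval_sameRow hs' hT (i := i) rfl hr, he]

lemma exists_eval_majority (hs : Sized k n m s) (hT : T.StoredIn w (s.arr a))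
    (hr : s.var vRow = r) :
    ∃ c : ZMod 2, (majority a).eval s = c.val ∧ 0 ≤ T.classGain w r c := by
  have hrhs (i : Fin (m + n)) : (entry a vI vN).eval (s.setVar vI i) = (T.rhs i).val := by
    have hs' : Sized k n m (s.setVar vI i) := hs.setVar (by decide) _
    exact eval_entry_rhs hs' hT rfl
  have h0 := eval_classWeight hs hT hr (e := .not (entry a vI vN)) (p := fun i => T.rhs i ≠ 1)
    fun i => by
      rw [Expr.eval_not_pos, hrhs]
      generalize T.rhs i = x
      decide +revert
  have h1 := eval_classWeight hs hT hr (e := entry a vI vN) (p := fun i => T.rhs i = 1)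
    fun i => by
      rw [hrhs]
      generalize T.rhs i = x
      decide +revert
  have hclass (i : Fin (m + n)) : T.rhs i = 0 ↔ T.rhs i ≠ 1 := by
    generalize T.rhs i = x
    decide +revert
  simp only [majority, Expr.eval, h0, h1]
  split_ifs with h
  · exact ⟨1, rfl, by rw [T.classGain_eq]; lia⟩
  · refine ⟨0, rfl, ?_⟩
    simp only [T.classGain_eq, ne_eq, hclass, not_not]
    lia

end

/-! ## Elimination in the store -/

lemma exists_run_fill (a i j R C : ℕ) (e : Expr) (s : Store) :
    ∃ f, (Stmt.fill a i j R C e).run s = s.setArr a f ∧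
      ∀ x < s.var R, ∀ y < s.var C,
        f (s.var C * x + y) = e.eval ((s.setVar i x).setVar j y) := by
  refine ⟨_, rfl, fun x hx y hy => ?_⟩
  have hlt : s.var C * x + y < s.var R * s.var C := by
    calc s.var C * x + y < s.var C * (x + 1) := by rw [mul_add, mul_one]; lia
      _ ≤ s.var C * s.var R := Nat.mul_le_mul_left _ hx
      _ = s.var R * s.var C := mul_comm _ _
  rw [if_pos hlt, Nat.mul_add_div (by lia), Nat.div_eq_of_lt hy, add_zero, Nat.mul_add_mod,
    Nat.mod_eq_of_lt hy]

/-- Assignment of the values of `e` for `j = 0, 1, …` to the first entries of the array `a`, as many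
as the variable `b` says. -/
def fillRow (a j b : ℕ) (e : Expr) : Stmt := .fill a vI j vOne b e

lemma exists_run_fillRow {a j b k n m : ℕ} {e : Expr} {s : Store} (hs : Sized k n m s) :
    ∃ f, (fillRow a j b e).run s = s.setArr a f ∧
      ∀ y < s.var b, f y = e.eval ((s.setVar vI 0).setVar j y) := by
  obtain ⟨f, hrun, hf⟩ := exists_run_fill a vI j vOne b e s
  refine ⟨f, hrun, fun y hy => ?_⟩
  have := hf 0 (by rw [hs.one]; exact one_pos) y hy
  rwa [mul_zero, zero_add] at this

/-- Assignment of the tableau in the array `b` to the array `a`. -/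
def copyRows (a b : ℕ) : Stmt := .fill a vI vJ vRows vWidth (entry b vI vJ)

/-- The entry in row `vI` and column `vJ` of the tableau in `aV` after the elimination of the
variable `vPivot` with the row `vRow`, where `vChoice` is the new right-hand side of this row. -/
def eliminatedEntry : Expr :=
  .ite (.lt (.var vJ) (.var vN))
    (.xor (entry aV vI vJ) (.and (entry aV vI vPivot) (entry aV vRow vJ)))
    (.ite (.lt (.var vN) (.var vJ)) (entry aV vI vJ)
      (.xor (entry aV vI vJ) (.and (entry aV vI vPivot) (.var vChoice))))

/-- The row `vRow` of the tableau in `aV` is eliminated by a majority decision. -/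
def eliminateRow : Stmt :=
  .ite (zeroRow aV) .skip <|
    .assign vPivot (leadingZeros aV) ;;
    .assign vChoice (majority aV) ;;
    .fill aV vI vJ vRows vWidth eliminatedEntry

variable {k n m a b : ℕ} {s : Store} {T : Tableau (Fin (m + n)) (Fin n)} {w : Fin (m + n) → ℕ}
  {r : Fin (m + n)}

lemma exists_run_copyRows (hs : Sized k n m s) (hT : T.StoredIn w (s.arr b)) :
    ∃ f, T.StoredIn w f ∧ (copyRows a b).run s = s.setArr a f := by
  obtain ⟨f, hrun, hf⟩ := exists_run_fill a vI vJ vRows vWidth (entry b vI vJ) s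
  rw [hs.rows, hs.width] at hf
  have hcopy (x : Fin (m + n)) (y : ℕ) (hy : y < n + 2) :
      f ((n + 2) * x + y) = s.arr b ((n + 2) * x + y) := by
    have hs' : Sized k n m ((s.setVar vI x).setVar vJ y) :=
      (hs.setVar (by decide) _).setVar (by decide) _
    rw [hf x x.2 y hy, eval_entry hs' (by decide)]
    rfl
  refine ⟨f, ⟨fun i j => ?_, fun i => ?_, fun i => ?_⟩, hrun⟩
  · rw [hcopy _ _ (by lia), hT.coeff]
  · rw [hcopy _ _ (by lia), hT.rhs]
  · rw [hcopy _ _ (by lia), hT.weight]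

lemma Expr.eval_and_val {e f : Expr} {x y : ZMod 2} (he : e.eval s = x.val)
    (hf : f.eval s = y.val) : (e.and f).eval s = (x * y).val := by
  rw [eval_and, he, hf]
  clear he hf
  decide +revert

lemma storedIn_eliminate {f : ℕ → ℕ} {p : Fin n} {c : ZMod 2} (hs : Sized k n m s)
    (hT : T.StoredIn w (s.arr aV)) (hr : s.var vRow = r) (hp : s.var vPivot = p)
    (hc : s.var vChoice = c.val)
    (hf : ∀ x < m + n, ∀ y < n + 2,
      f ((n + 2) * x + y) = eliminatedEntry.eval ((s.setVar vI x).setVar vJ y)) :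
    (T.eliminate r p c).StoredIn w f := by
  have hs' (x y : ℕ) : Sized k n m ((s.setVar vI x).setVar vJ y) :=
    (hs.setVar (by decide) _).setVar (by decide) _
  have hlt (x y : ℕ) :
      0 < (Expr.lt (.var vJ) (.var vN)).eval ((s.setVar vI x).setVar vJ y) ↔ y < n := by
    rw [Expr.eval_lt_pos]
    simp [Expr.eval, hs.cols]
  have hgt (x y : ℕ) :
      0 < (Expr.lt (.var vN) (.var vJ)).eval ((s.setVar vI x).setVar vJ y) ↔ n < y := by
    rw [Expr.eval_lt_pos]
    simp [Expr.eval, hs.cols]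
  have hpivot (i : Fin (m + n)) (y : ℕ) :
      (entry aV vI vPivot).eval ((s.setVar vI i).setVar vJ y) = (T.coeff i p).val :=
    eval_entry_coeff (hs' i y) hT rfl hp
  constructor
  · intro i j
    rw [hf i i.2 j (by lia), eliminatedEntry, Expr.eval, if_pos ((hlt _ _).2 j.2)]
    exact Expr.eval_xor (eval_entry_coeff (hs' i j) hT rfl rfl) <|
      Expr.eval_and_val (hpivot i j) (eval_entry_coeff (hs' i j) hT hr rfl)
  · intro i
    rw [hf i i.2 n (by lia), eliminatedEntry, Expr.eval, if_neg (by rw [hlt]; exact lt_irrefl n),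
      Expr.eval, if_neg (by rw [hgt]; exact lt_irrefl n)]
    refine Expr.eval_xor ?_ (Expr.eval_and_val (hpivot i n) hc)
    exact (eval_entry (hs' i n) (by decide)).trans (hT.rhs i)
  · intro i
    rw [hf i i.2 (n + 1) (by lia), eliminatedEntry, Expr.eval, if_neg (by rw [hlt]; lia),
      Expr.eval, if_pos ((hgt _ _).2 n.lt_succ_self)]
    exact (eval_entry (hs' i (n + 1)) (by decide)).trans (hT.weight i)

lemma exists_run_eliminateRow (hs : Sized k n m s) (hT : T.StoredIn w (s.arr aV))
    (hr : s.var vRow = r) :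
    ∃ T' f x y, Tableau.Step w r T T' ∧ T'.StoredIn w f ∧
      eliminateRow.run s = ((s.setVar vPivot x).setVar vChoice y).setArr aV f := by
  by_cases h0 : T.coeff r = 0
  · refine ⟨T, s.arr aV, s.var vPivot, s.var vChoice, Or.inl ⟨h0, rfl⟩, hT, ?_⟩
    simp [eliminateRow, Stmt.run, (eval_zeroRow hs hT hr).2 h0]
  obtain ⟨p, hp, hpivot⟩ := exists_eval_leadingZeros hs hT hr h0
  have hs₁ : Sized k n m (s.setVar vPivot p) := hs.setVar (by decide) _
  obtain ⟨c, hc, hgain⟩ := exists_eval_majority hs₁ hT hr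
  have hs₂ : Sized k n m ((s.setVar vPivot p).setVar vChoice c.val) := hs₁.setVar (by decide) _
  obtain ⟨f, hrun, hf⟩ := exists_run_fill aV vI vJ vRows vWidth eliminatedEntry
    ((s.setVar vPivot p).setVar vChoice c.val)
  rw [hs₂.rows, hs₂.width] at hf
  refine ⟨T.eliminate r p c, f, p, c.val, Or.inr ⟨p, c, hpivot, hgain, rfl⟩,
    storedIn_eliminate hs₂ hT hr rfl rfl hf, ?_⟩
  rw [eliminateRow, Stmt.run, if_neg (by rwa [eval_zeroRow hs hT hr]), Stmt.run, Stmt.run, Stmt.run,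
    Stmt.run, hp, hc, hrun]

end LoopLang

/-! ## The tableau of a system -/

namespace LinSystem

open Finset Submodule

variable {n m : ℕ} (S : LinSystem n m)

/-- The equations of a system, followed by the coordinate functionals, whose final values are the
values of the variables. -/
def tableau : Tableau (Fin (m + n)) (Fin n) where
  coeff := Fin.append S.A.row fun j => Pi.single j 1
  rhs := Fin.append S.b 0

/-- The weights of the rows of `LinSystem.tableau`. The coordinate functionals have weight zero. -/
def rowWeight : Fin (m + n) → ℕ := Fin.append S.w 0

@[simp] lemma tableau_coeff_castAdd (i : Fin m) : S.tableau.coeff (i.castAdd n) = S.A.row i := by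
  simp only [tableau, Fin.append_left]

@[simp] lemma tableau_coeff_natAdd (j : Fin n) : S.tableau.coeff (j.natAdd m) = Pi.single j 1 := by
  simp only [tableau, Fin.append_right]

@[simp] lemma tableau_rhs_castAdd (i : Fin m) : S.tableau.rhs (i.castAdd n) = S.b i :=
  Fin.append_left _ _ i

@[simp] lemma tableau_rhs_natAdd (j : Fin n) : S.tableau.rhs (j.natAdd m) = 0 :=
  Fin.append_right _ _ j

@[simp] lemma rowWeight_castAdd (i : Fin m) : S.rowWeight (i.castAdd n) = S.w i :=
  Fin.append_left _ _ i

@[simp] lemma rowWeight_natAdd (j : Fin n) : S.rowWeight (j.natAdd m) = 0 :=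
  Fin.append_right _ _ j

lemma excess_eq_sum_gain (z : Fin n → ZMod 2) :
    S.excess z = ∑ i, Tableau.gain (S.A.row i ⬝ᵥ z + S.b i) (S.w i) := by
  refine sum_congr rfl fun i _ => ?_
  simp only [Tableau.gain, CharTwo.add_eq_zero]
  rfl

variable {S}

lemma span_range_eq_top (hS : S.Irreducible) : span (ZMod 2) (Set.range S.A.row) = ⊤ := by
  refine eq_top_of_finrank_eq ?_
  rw [← S.A.rank_eq_finrank_span_row, hS.rank_eq, Module.finrank_fin_fun]

lemma span_coordinates_eq_top {W : Submodule (ZMod 2) (Fin n → ZMod 2)}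
    (hW : ∀ j : Fin n, S.tableau.coeff (j.natAdd m) ∈ W) : W = ⊤ := by
  rw [← top_le_iff, ← (Pi.basisFun (ZMod 2) (Fin n)).span_eq, span_le, Set.range_subset_iff]
  intro j
  rw [Pi.basisFun_apply, ← S.tableau_coeff_natAdd]
  exact hW j

lemma constantGain_tableau (hS : S.Irreducible) : S.tableau.constantGain S.rowWeight = 0 := by
  rw [Tableau.constantGain, filter_false_of_mem, sum_empty]
  intro i _
  refine Fin.addCases (fun i => ?_) (fun j => ?_) i
  · rw [tableau_coeff_castAdd]
    exact hS.row_ne_zero i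
  · rw [tableau_coeff_natAdd]
    exact Pi.single_ne_zero_iff.2 one_ne_zero

lemma exists_excess_eq_constantGain {T : Tableau (Fin (m + n)) (Fin n)}
    (hT : S.tableau.ReducesTo ⊤ T) :
    ∃ z, S.excess z = T.constantGain S.rowWeight ∧ ∀ j : Fin n, T.rhs (j.natAdd m) = z j := by
  have hcoeff (i) : T.coeff i = 0 := hT.coeff_eq_zero_iff.2 mem_top
  obtain ⟨z, hz⟩ := hT.residual 0
  have hrhs (i) : S.tableau.coeff i ⬝ᵥ z + S.tableau.rhs i = T.rhs i := by
    simpa only [Tableau.residual, dotProduct_zero, zero_add] using congrFun hz i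
  refine ⟨z, ?_, fun j => ?_⟩
  · rw [Tableau.constantGain, filter_true_of_mem fun i _ => hcoeff i, Fin.sum_univ_add,
      excess_eq_sum_gain]
    simp [← hrhs, Tableau.gain]
  · simp [← hrhs]

/-- At its turn, each row of a sum-free set has a left-hand side of its own, so that its elimination
is a clear gain. -/
lemma constantGain_lt_of_sumFree {K Q : Finset (Fin m)} {r : Fin m}
    {T T' : Tableau (Fin (m + n)) (Fin n)} (hK : SumFree S.A.row (K : Set (Fin m))) (hQ : Q ⊆ K)
    (hr : r ∈ K) (hrQ : r ∉ Q) (hT : S.tableau.ReducesTo (span (ZMod 2) (S.A.row '' Q)) T)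
    (hstep : Tableau.Step S.rowWeight (r.castAdd n) T T') :
    T.constantGain S.rowWeight < T'.constantGain S.rowWeight := by
  have hgain := hstep.constantGain_add_le ?_ ?_
  · have := S.w_pos r
    rw [rowWeight_castAdd] at hgain
    lia
  · rw [ne_eq, hT.coeff_eq_zero_iff, tableau_coeff_castAdd]
    exact hK.notMem_span hQ hr hrQ
  · intro i
    refine Fin.addCases (fun i hi hir => ?_) (fun j _ _ => S.rowWeight_natAdd j) i
    rw [hT.coeff_eq_iff, tableau_coeff_castAdd, tableau_coeff_castAdd] at hi
    exact (hir (congrArg _ (hK.eq_of_sub_mem_span hQ hr hrQ hi))).elim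

end LinSystem

/-! ## The greedy search -/

namespace LoopLang

open Finset Submodule

/-- The row `vRow` of the tableau in `aV` has a variable and is different from every row from which
it was different in the tableau in `aU`. -/
def freeRow : Expr :=
  .and (.not (zeroRow aV)) (.all vI vEqs (.ite (sameRow aV) (sameRow aU) (.const 1)))

/-- The row `vRow` is marked in `aG`. -/
def markRow : Stmt :=
  fillRow aG vJ vEqs (.ite (.eq (.var vJ) (.var vRow)) (.const 1) (.read aG (.var vJ))) ;;
    .assign vCount (.add (.var vCount) (.const 1))

/-- The row `vRow` is marked and eliminated, if it passes the test `freeRow`. -/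
def selectRow : Stmt :=
  .ite freeRow (markRow ;; eliminateRow) .skip

/-- Removal of all marks. -/
def clearMarks : Stmt := fillRow aG vJ vEqs (.const 0) ;; .assign vCount (.const 0)

/-- One pass of the greedy search. -/
def greedyPass : Stmt := copyRows aU aV ;; clearMarks ;; .loop vRow vEqs selectRow

/-- The greedy search for `vK` equations whose left-hand sides form a sum-free set. -/
def greedySearch : Stmt :=
  copyRows aV aX ;; clearMarks ;;
    .loop vRound vEqs (.ite (.lt (.var vCount) (.var vK)) greedyPass .skip)

variable {n m k : ℕ} {S : LinSystem n m} {s : Store} {W W' : Submodule (ZMod 2) (Fin n → ZMod 2)}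
  {K : Finset (Fin m)} {a v : ℕ} {f : ℕ → ℕ}

/-- The store holds the system `S` and the parameter `k`, and there is enough room for an assignment
on the tape. -/
structure Ready (S : LinSystem n m) (k : ℕ) (s : Store) : Prop where
  sized : Sized k n m s
  stored : S.tableau.StoredIn S.rowWeight (s.arr aX)
  length_le : n ≤ s.tape.length

/-- The array `f` holds a tableau that arises from the system `S` by a substitution whose
kernel is `W`. -/
def HoldsReduct (S : LinSystem n m) (W : Submodule (ZMod 2) (Fin n → ZMod 2)) (f : ℕ → ℕ) : Prop :=
  ∃ T, T.StoredIn S.rowWeight f ∧ S.tableau.ReducesTo W T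

/-- The set `K` is marked in `aG`, and `vCount` is its size. -/
structure Marked (K : Finset (Fin m)) (s : Store) : Prop where
  count : s.var vCount = #K
  marks : ∀ i : Fin m, s.arr aG i = if i ∈ K then 1 else 0

/-- The state of a pass of the greedy search that started modulo `W` and has selected `K`. -/
structure Selecting (S : LinSystem n m) (k : ℕ) (W : Submodule (ZMod 2) (Fin n → ZMod 2))
    (K : Finset (Fin m)) (s : Store) : Prop where
  ready : Ready S k s
  marked : Marked K s
  sumFree : SumFree S.A.row (K : Set (Fin m))
  disjoint : Disjoint W (span (ZMod 2) (S.A.row '' K))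
  initial : HoldsReduct S W (s.arr aU)
  current : HoldsReduct S (W ⊔ span (ZMod 2) (S.A.row '' K)) (s.arr aV)

lemma Ready.setVar (h : Ready S k s) (hv : 6 < v) (x : ℕ) : Ready S k (s.setVar v x) :=
  ⟨h.sized.setVar hv x, h.stored, h.length_le⟩

lemma Ready.setArr (h : Ready S k s) (ha : aX ≠ a) (f : ℕ → ℕ) : Ready S k (s.setArr a f) :=
  ⟨h.sized.setArr a f, by simpa [ha] using h.stored, h.length_le⟩

lemma Marked.setVar (h : Marked K s) (hv : vCount ≠ v) (x : ℕ) : Marked K (s.setVar v x) :=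
  ⟨by simpa [hv] using h.count, h.marks⟩

lemma Marked.setArr (h : Marked K s) (ha : aG ≠ a) (f : ℕ → ℕ) : Marked K (s.setArr a f) :=
  ⟨h.count, by simpa [ha] using h.marks⟩

lemma Selecting.setVar (h : Selecting S k W K s) (hv : 6 < v) (hv' : vCount ≠ v) (x : ℕ) :
    Selecting S k W K (s.setVar v x) :=
  ⟨h.ready.setVar hv x, h.marked.setVar hv' x, h.sumFree, h.disjoint, h.initial, h.current⟩

lemma eval_sameRow_iff_sub_mem (hs : Sized k n m s) (hW : HoldsReduct S W (s.arr a)) {i r : Fin m}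
    (hi : s.var vI = i) (hr : s.var vRow = r) :
    0 < (sameRow a).eval s ↔ S.A.row i - S.A.row r ∈ W := by
  obtain ⟨T, hT, hred⟩ := hW
  rw [eval_sameRow (i := i.castAdd n) (r := r.castAdd n) hs hT hi hr, hred.coeff_eq_iff,
    LinSystem.tableau_coeff_castAdd, LinSystem.tableau_coeff_castAdd]

lemma eval_zeroRow_iff_mem (hs : Sized k n m s) (hW : HoldsReduct S W (s.arr a)) {r : Fin m}
    (hr : s.var vRow = r) : 0 < (zeroRow a).eval s ↔ S.A.row r ∈ W := by
  obtain ⟨T, hT, hred⟩ := hW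
  rw [eval_zeroRow (r := r.castAdd n) hs hT hr, hred.coeff_eq_zero_iff,
    LinSystem.tableau_coeff_castAdd]

lemma Sized.forall_equations (hs : Sized k n m s) {p : ℕ → Prop} :
    (∀ x < s.var vEqs, p x) ↔ ∀ i : Fin m, p i := by
  rw [hs.equations, Fin.forall_iff]

lemma eval_freeRow (hs : Sized k n m s) (hU : HoldsReduct S W (s.arr aU))
    (hV : HoldsReduct S W' (s.arr aV)) {r : Fin m} (hr : s.var vRow = r) :
    0 < freeRow.eval s ↔ ¬ Blocked S.A.row W W' r := by
  have hsame (i : Fin m) :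
      0 < (Expr.ite (sameRow aV) (sameRow aU) (.const 1)).eval (s.setVar vI i) ↔
        (S.A.row i - S.A.row r ∈ W' → S.A.row i - S.A.row r ∈ W) := by
    have hs' : Sized k n m (s.setVar vI i) := hs.setVar (by decide) _
    have hV' := eval_sameRow_iff_sub_mem (i := i) hs' hV rfl hr
    have hU' := eval_sameRow_iff_sub_mem (i := i) hs' hU rfl hr
    rw [Expr.eval]
    split_ifs with h
    · rw [hU', forall_prop_of_true (hV'.1 h)]
    · simp [hV'.not.1 h, Expr.eval]
  rw [freeRow, Expr.eval_and_pos, Expr.eval_not_pos, eval_zeroRow_iff_mem hs hV hr,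
    Expr.eval_all_pos, hs.forall_equations]
  simp only [hsame, Blocked, not_or, not_exists, not_and, not_not]

lemma exists_run_eliminateRow_holdsReduct (hs : Sized k n m s) (hV : HoldsReduct S W (s.arr aV))
    {r : Fin (m + n)} (hr : s.var vRow = r) :
    ∃ f x y, HoldsReduct S (W ⊔ span (ZMod 2) {S.tableau.coeff r}) f ∧
      eliminateRow.run s = ((s.setVar vPivot x).setVar vChoice y).setArr aV f := by
  obtain ⟨T, hT, hred⟩ := hV
  obtain ⟨T', f, x, y, hstep, hf, hrun⟩ := exists_run_eliminateRow hs hT hr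
  exact ⟨f, x, y, ⟨T', hf, hred.step hstep⟩, hrun⟩

lemma exists_run_clearMarks (hs : Sized k n m s) :
    ∃ f, clearMarks.run s = (s.setArr aG f).setVar vCount 0 ∧
      Marked (∅ : Finset (Fin m)) (clearMarks.run s) := by
  obtain ⟨f, hrun, hf⟩ := exists_run_fillRow (a := aG) (j := vJ) (b := vEqs) (e := .const 0) hs
  have hclear : clearMarks.run s = (s.setArr aG f).setVar vCount 0 := by
    rw [clearMarks, Stmt.run, hrun, Stmt.run, Expr.eval]
  refine ⟨f, hclear, hclear ▸ ⟨rfl, fun i => ?_⟩⟩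
  have := hf i (by rw [hs.equations]; exact i.2)
  simpa [Expr.eval] using this

lemma exists_run_markRow (hs : Sized k n m s) (hK : Marked K s) {r : Fin m} (hr : s.var vRow = r)
    (hrK : r ∉ K) :
    ∃ f x, markRow.run s = (s.setArr aG f).setVar vCount x ∧
      Marked (insert r K) (markRow.run s) := by
  obtain ⟨f, hrun, hf⟩ := exists_run_fillRow (a := aG) (j := vJ) (b := vEqs)
    (e := .ite (.eq (.var vJ) (.var vRow)) (.const 1) (.read aG (.var vJ))) hs
  have hmark : markRow.run s = (s.setArr aG f).setVar vCount (#K + 1) := by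
    rw [markRow, Stmt.run, hrun, Stmt.run]
    simp [Expr.eval, hK.count]
  refine ⟨f, _, hmark, hmark ▸ ⟨(card_insert_of_notMem hrK).symm, fun i => ?_⟩⟩
  have := hf i (by rw [hs.equations]; exact i.2)
  simp only [Expr.eval, Expr.eval_eq_pos] at this
  simpa [Expr.eval, hr, hK.marks, Fin.val_inj, ite_or] using this

lemma exists_run_selectRow (hS : S.Irreducible) (h : Selecting S k W K s) {r : Fin m}
    (hr : s.var vRow = r) :
    ∃ K', K ⊆ K' ∧ Selecting S k W K' (selectRow.run s) ∧
      Blocked S.A.row W (W ⊔ span (ZMod 2) (S.A.row '' K')) r := by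
  classical
  have hfree := eval_freeRow h.ready.sized h.initial h.current hr
  by_cases hblocked : Blocked S.A.row W (W ⊔ span (ZMod 2) (S.A.row '' K)) r
  · rw [selectRow, Stmt.run, if_neg fun h => hfree.1 h hblocked]
    exact ⟨K, Subset.rfl, h, hblocked⟩
  have hrK : r ∉ K := fun hrK => hblocked (.inl (mem_sup_right (subset_span ⟨r, hrK, rfl⟩)))
  obtain ⟨hsumFree, hdisjoint⟩ := h.sumFree.insert hS.row_injective h.disjoint hblocked
  obtain ⟨g, x, hmark, hmarked⟩ := exists_run_markRow h.ready.sized h.marked hr hrK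
  have hready : Ready S k (markRow.run s) :=
    hmark ▸ (h.ready.setArr (by decide) _).setVar (by decide) _
  have hcurrent : HoldsReduct S (W ⊔ span (ZMod 2) (S.A.row '' K)) ((markRow.run s).arr aV) :=
    hmark ▸ h.current
  have hr' : (markRow.run s).var vRow = r.castAdd n := hmark ▸ hr
  obtain ⟨f, y, z, hf, hrun⟩ := exists_run_eliminateRow_holdsReduct hready.sized hcurrent hr'
  rw [LinSystem.tableau_coeff_castAdd, ← sup_span_image_insert, ← coe_insert] at hf
  rw [selectRow, Stmt.run, if_pos (hfree.2 hblocked), Stmt.run, hrun]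
  refine ⟨insert r K, subset_insert r K, ⟨?_, ?_, ?_, ?_, ?_, ?_⟩, ?_⟩
  · exact ((hready.setVar (by decide) _).setVar (by decide) _).setArr (by decide) _
  · exact ((hmarked.setVar (by decide) _).setVar (by decide) _).setArr (by decide) _
  · rwa [coe_insert]
  · rwa [coe_insert]
  · exact hmark ▸ h.initial
  · exact hf
  · exact .inl (mem_sup_right (subset_span ⟨r, mem_insert_self r K, rfl⟩))

lemma exists_run_greedyPass (hS : S.Irreducible) (h : Ready S k s)
    (hW : HoldsReduct S W (s.arr aV)) :
    ∃ K, Selecting S k W K (greedyPass.run s) ∧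
      ∀ u, Blocked S.A.row W (W ⊔ span (ZMod 2) (S.A.row '' K)) u := by
  obtain ⟨T, hT, hred⟩ := hW
  obtain ⟨f, hf, hcopy⟩ := exists_run_copyRows (a := aU) h.sized hT
  have hcopied : Ready S k ((copyRows aU aV).run s) := hcopy ▸ h.setArr (by decide) _
  obtain ⟨g, hclear, hmarked⟩ := exists_run_clearMarks (m := m) hcopied.sized
  set t := clearMarks.run ((copyRows aU aV).run s)
  have ht : Selecting S k W ∅ t := by
    refine ⟨?_, hmarked, ?_, ?_, ?_, ?_⟩
    · exact hclear ▸ (hcopied.setArr (by decide) _).setVar (by decide) _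
    · exact coe_empty ▸ sumFree_empty hS.row_ne_zero
    · simp
    · exact ⟨T, by simpa [hclear, hcopy] using hf, hred⟩
    · exact ⟨T, by simpa [hclear, hcopy] using hT, by simpa using hred⟩
  have hloop := Stmt.loop_induct (v := vRow) (b := vEqs) (P := selectRow) (s := t)
    (I := fun i s => ∃ K, Selecting S k W K s ∧ ∀ u : Fin m, u < i →
      Blocked S.A.row W (W ⊔ span (ZMod 2) (S.A.row '' K)) u)
    ⟨∅, ht, fun u hu => (Nat.not_lt_zero _ hu).elim⟩ ?_
  · obtain ⟨K, hK, hblocked⟩ := hloop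
    exact ⟨K, hK, fun u => hblocked u (ht.ready.sized.equations ▸ u.2)⟩
  rintro i hi s ⟨K, hK, hblocked⟩
  rw [ht.ready.sized.equations] at hi
  obtain ⟨K', hKK', hK', hi'⟩ := exists_run_selectRow hS (r := ⟨i, hi⟩)
    (hK.setVar (v := vRow) (by decide) (by decide) i) rfl
  refine ⟨K', hK', fun u hu => ?_⟩
  obtain hu | rfl : (u : ℕ) < i ∨ u = ⟨i, hi⟩ := by
    rw [Fin.ext_iff]
    exact Nat.lt_succ_iff_lt_or_eq.1 hu
  · exact (hblocked u hu).mono (sup_le_sup_left (span_mono (Set.image_mono hKK')) _)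
  · exact hi'

/-- The state of the greedy search after `i` passes. -/
structure Searching (S : LinSystem n m) (k i : ℕ) (K : Finset (Fin m))
    (W : Submodule (ZMod 2) (Fin n → ZMod 2)) (s : Store) : Prop where
  ready : Ready S k s
  marked : Marked K s
  sumFree : SumFree S.A.row (K : Set (Fin m))
  current : HoldsReduct S W (s.arr aV)
  outcome : k ≤ #K ∨ FailedPasses S.A.row k i W ∧ ∀ j ≤ i, m < 2 ^ j → n ≤ j * k

lemma Searching.exists_run_greedyPass {i : ℕ} (hS : S.Irreducible) (h : Searching S k i K W s)
    (hK : #K < k) : ∃ K' W', Searching S k (i + 1) K' W' (greedyPass.run s) := by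
  obtain ⟨K', hK', hblocked⟩ := LoopLang.exists_run_greedyPass hS h.ready h.current
  refine ⟨K', _, hK'.ready, hK'.marked, hK'.sumFree, hK'.current, ?_⟩
  refine or_iff_not_imp_left.2 fun hlt => ?_
  obtain ⟨hfailed, hsmall⟩ := h.outcome.resolve_left hK.not_ge
  have hfailed' := hfailed.succ (not_le.1 hlt).le hblocked
  refine ⟨hfailed', fun j hj hm => ?_⟩
  obtain hj | rfl := Nat.le_succ_iff.1 hj
  · exact hsmall j hj hm
  · have := hfailed'.finrank_le_of_lt_two_pow (LinSystem.span_range_eq_top hS)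
      (by rwa [Fintype.card_fin])
    rwa [Module.finrank_fin_fun] at this

lemma exists_run_greedySearch (hS : S.Irreducible) (h : Ready S k s) :
    ∃ K W, Searching S k m K W (greedySearch.run s) := by
  obtain ⟨f, hf, hcopy⟩ := exists_run_copyRows (a := aV) h.sized h.stored
  have hcopied : Ready S k ((copyRows aV aX).run s) := hcopy ▸ h.setArr (by decide) _
  obtain ⟨g, hclear, hmarked⟩ := exists_run_clearMarks (m := m) hcopied.sized
  set t := clearMarks.run ((copyRows aV aX).run s)
  have ht : Searching S k 0 ∅ ⊥ t := by
    refine ⟨?_, hmarked, ?_, ?_, ?_⟩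
    · exact hclear ▸ (hcopied.setArr (by decide) _).setVar (by decide) _
    · exact coe_empty ▸ sumFree_empty hS.row_ne_zero
    · exact ⟨_, by simpa [hclear, hcopy] using hf, .refl _⟩
    · refine .inr ⟨failedPasses_zero, fun j hj hm => ?_⟩
      have := failedPasses_zero (a := S.A.row) (k := k)
      obtain rfl := Nat.le_zero.1 hj
      simpa using this.finrank_le_of_lt_two_pow (LinSystem.span_range_eq_top hS)
        (by rwa [Fintype.card_fin])
  have hloop := Stmt.loop_induct (v := vRound) (b := vEqs)
    (P := .ite (.lt (.var vCount) (.var vK)) greedyPass .skip) (s := t)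
    (I := fun i s => ∃ K W, Searching S k i K W s) ⟨∅, ⊥, ht⟩ ?_
  · rwa [ht.ready.sized.equations] at hloop
  rintro i - s ⟨K, W, hK⟩
  have hK' : Searching S k i K W (s.setVar vRound i) :=
    ⟨hK.ready.setVar (by decide) i, hK.marked.setVar (by decide) i, hK.sumFree, hK.current,
      hK.outcome⟩
  rw [Stmt.run]
  have htest : 0 < (Expr.lt (.var vCount) (.var vK)).eval (s.setVar vRound i) ↔ #K < k := by
    rw [Expr.eval_lt_pos, Expr.eval, Expr.eval, hK'.marked.count, hK'.ready.sized.parameter]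
  split_ifs with hlt
  · exact hK'.exists_run_greedyPass hS (htest.1 hlt)
  · exact ⟨K, W, hK'.ready, hK'.marked, hK'.sumFree, hK'.current, .inl (not_lt.1 (htest.not.1 hlt))⟩

/-- Elimination of the rows that are marked in `aG`. -/
def eliminateMarked : Stmt := .loop vRow vEqs (.ite (.read aG (.var vRow)) eliminateRow .skip)

/-- Elimination of all rows. -/
def eliminateAll : Stmt := .loop vRow vRows eliminateRow

/-- The right-hand sides of the last `vN` rows of the tableau in `aV` are copied to `aY`. -/
def readSolution : Stmt :=
  fillRow aY vJ vN (.read aV (.add (.sum vD vWidth (.add (.var vEqs) (.var vJ))) (.var vN)))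

/-- The number of assignments is computed in `vPow`. -/
def countAssignments : Stmt :=
  .assign vPow (.const 1) ;; .loop vRow vN (.assign vPow (.add (.var vPow) (.var vPow)))

/-- If the greedy search succeeds, a solution is constructed in `aY`, and `vFound` is set. Otherwise
`vPow` becomes the number of assignments that remain to be tested. -/
def search : Stmt :=
  greedySearch ;;
    .ite (.lt (.var vCount) (.var vK))
      (.assign vFound (.const 0) ;; countAssignments)
      (copyRows aV aX ;; eliminateMarked ;; eliminateAll ;; readSolution ;;
        .assign vFound (.const 1) ;; .assign vPow (.const 0))

variable {n m k g : ℕ} {S : LinSystem n m} {s : Store} {W : Submodule (ZMod 2) (Fin n → ZMod 2)}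
  {K : Finset (Fin m)} {v : ℕ} {f : ℕ → ℕ}

/-- The array `f` holds a tableau that arises from the system `S` by a substitution with kernel `W`,
and its rows without variables have excess at least `g`. -/
def HoldsGain (S : LinSystem n m) (W : Submodule (ZMod 2) (Fin n → ZMod 2)) (g : ℕ) (f : ℕ → ℕ) :
    Prop :=
  ∃ T, T.StoredIn S.rowWeight f ∧ S.tableau.ReducesTo W T ∧ g ≤ T.constantGain S.rowWeight

/-- The assignment in `aY` has excess at least `k`. -/
def Solved (S : LinSystem n m) (k : ℕ) (s : Store) : Prop :=
  s.var vFound = 1 ∧ ∃ z, k ≤ S.excess z ∧ ∀ j : Fin n, s.arr aY j = (z j).val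

lemma exists_run_eliminateRow_of_mem (h : Ready S k s) (hK : SumFree S.A.row (K : Set (Fin m)))
    {Q : Finset (Fin m)} {r : Fin m} (hQ : Q ⊆ K) (hr : r ∈ K) (hrQ : r ∉ Q)
    (hV : HoldsGain S (span (ZMod 2) (S.A.row '' Q)) #Q (s.arr aV)) (hrow : s.var vRow = r) :
    ∃ f x y, HoldsGain S (span (ZMod 2) (S.A.row '' (insert r Q : Finset (Fin m))))
        #(insert r Q) f ∧
      eliminateRow.run s = ((s.setVar vPivot x).setVar vChoice y).setArr aV f := by
  obtain ⟨T, hT, hred, hgain⟩ := hV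
  obtain ⟨T', f, x, y, hstep, hf, hrun⟩ :=
    exists_run_eliminateRow (r := r.castAdd n) h.sized hT hrow
  refine ⟨f, x, y, ⟨T', hf, ?_, ?_⟩, hrun⟩
  · have := hred.step hstep
    rwa [LinSystem.tableau_coeff_castAdd, ← bot_sup_eq (span _ (_ '' _)),
      ← sup_span_image_insert, bot_sup_eq, ← coe_insert] at this
  · have := LinSystem.constantGain_lt_of_sumFree hK hQ hr hrQ hred hstep
    rw [card_insert_of_notMem hrQ]
    lia

lemma run_eliminateMarked (h : Ready S k s) (hmarked : Marked K s)
    (hK : SumFree S.A.row (K : Set (Fin m))) (hV : HoldsGain S ⊥ 0 (s.arr aV)) :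
    Ready S k (eliminateMarked.run s) ∧
      ∃ W, HoldsGain S W #K ((eliminateMarked.run s).arr aV) := by
  let Q (i : ℕ) : Finset (Fin m) := {u ∈ K | (u : ℕ) < i}
  have hloop := Stmt.loop_induct (v := vRow) (b := vEqs) (s := s)
    (P := .ite (.read aG (.var vRow)) eliminateRow .skip)
    (I := fun i t => Ready S k t ∧ Marked K t ∧
      HoldsGain S (span (ZMod 2) (S.A.row '' Q i)) #(Q i) (t.arr aV))
    ⟨h, hmarked, by simpa [Q] using hV⟩ ?_
  · obtain ⟨hready, -, hgain⟩ := hloop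
    have hQ : Q (s.var vEqs) = K := filter_true_of_mem fun u _ => h.sized.equations.symm ▸ u.2
    exact ⟨hready, _, hQ ▸ hgain⟩
  rintro i hi t ⟨hready, hmarked, hgain⟩
  rw [h.sized.equations] at hi
  have hready' : Ready S k (t.setVar vRow i) := hready.setVar (by decide) _
  have hmarked' : Marked K (t.setVar vRow i) := hmarked.setVar (by decide) _
  have hmark := hmarked'.marks ⟨i, hi⟩
  rw [Stmt.run, Expr.eval, Expr.eval, Store.var_setVar, if_pos rfl, hmark]
  by_cases hiK : ⟨i, hi⟩ ∈ K
  · have hQ : insert ⟨i, hi⟩ (Q i) = Q (i + 1) := by grind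
    rw [if_pos hiK, if_pos one_pos]
    obtain ⟨f, x, y, hf, hrun⟩ := exists_run_eliminateRow_of_mem (r := ⟨i, hi⟩) hready' hK
      (filter_subset _ K) hiK (by simp) hgain rfl
    rw [hrun]
    refine ⟨?_, ?_, hQ ▸ hf⟩
    · exact ((hready'.setVar (by decide) _).setVar (by decide) _).setArr (by decide) _
    · exact ((hmarked'.setVar (by decide) _).setVar (by decide) _).setArr (by decide) _
  · have hQ : Q i = Q (i + 1) := by grind
    rw [if_neg hiK, if_neg (lt_irrefl 0)]
    exact ⟨hready', hmarked', hQ ▸ hgain⟩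

lemma run_eliminateAll (h : Ready S k s) (hV : HoldsGain S W g (s.arr aV)) :
    Ready S k (eliminateAll.run s) ∧
      HoldsGain S ⊤ g ((eliminateAll.run s).arr aV) := by
  have hloop := Stmt.loop_induct (v := vRow) (b := vRows) (s := s) (P := eliminateRow)
    (I := fun i t => Ready S k t ∧ ∃ W, HoldsGain S W g (t.arr aV) ∧
      ∀ u : Fin (m + n), u < i → S.tableau.coeff u ∈ W)
    ⟨h, W, hV, fun u hu => (Nat.not_lt_zero _ hu).elim⟩ ?_
  · obtain ⟨hready, W', hgain, hW'⟩ := hloop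
    refine ⟨hready, ?_⟩
    rwa [LinSystem.span_coordinates_eq_top (S := S) (W := W') fun j =>
      hW' _ (h.sized.rows.symm ▸ (j.natAdd m).2)] at hgain
  rintro i hi t ⟨hready, W', ⟨T, hT, hred, hgain⟩, hW'⟩
  rw [h.sized.rows] at hi
  have hready' : Ready S k (t.setVar vRow i) := hready.setVar (by decide) _
  obtain ⟨T', f, x, y, hstep, hf, hrun⟩ :=
    exists_run_eliminateRow (r := ⟨i, hi⟩) hready'.sized hT rfl
  rw [hrun]
  refine ⟨((hready'.setVar (by decide) _).setVar (by decide) _).setArr (by decide) _, _,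
    ⟨T', hf, hred.step hstep, hgain.trans hstep.constantGain_le⟩, fun u hu => ?_⟩
  obtain hu | rfl : (u : ℕ) < i ∨ u = ⟨i, hi⟩ := by
    rw [Fin.ext_iff]
    exact Nat.lt_succ_iff_lt_or_eq.1 hu
  · exact mem_sup_left (hW' u hu)
  · exact mem_sup_right (mem_span_singleton_self _)

lemma exists_run_readSolution (h : Ready S k s) (hV : HoldsGain S ⊤ g (s.arr aV)) :
    ∃ f, readSolution.run s = s.setArr aY f ∧
      ∃ z, g ≤ S.excess z ∧ ∀ j : Fin n, f j = (z j).val := by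
  obtain ⟨T, hT, hred, hgain⟩ := hV
  obtain ⟨z, hz, hrhs⟩ := LinSystem.exists_excess_eq_constantGain hred
  obtain ⟨f, hrun, hf⟩ := exists_run_fillRow (a := aY) (j := vJ) (b := vN)
    (e := .read aV (.add (.sum vD vWidth (.add (.var vEqs) (.var vJ))) (.var vN))) h.sized
  refine ⟨f, hrun, z, hz ▸ hgain, fun j => ?_⟩
  rw [hf j (h.sized.cols.symm ▸ j.2), ← hrhs j, ← hT.rhs]
  simp [Expr.eval, h.sized.width, h.sized.cols, h.sized.equations]

/-- The state after the greedy search. -/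
structure Searched (S : LinSystem n m) (k : ℕ) (s : Store) : Prop where
  ready : Ready S k s
  outcome : Solved S k s ∧ s.var vPow = 0 ∨
    s.var vFound = 0 ∧ s.var vPow = 2 ^ n ∧ ∀ l, m < 2 ^ l → n ≤ l * k

lemma run_countAssignments (h : Ready S k s) (hfound : s.var vFound = 0) :
    Ready S k (countAssignments.run s) ∧ (countAssignments.run s).var vFound = 0 ∧
      (countAssignments.run s).var vPow = 2 ^ n := by
  have hloop := Stmt.loop_induct (v := vRow) (b := vN) (s := s.setVar vPow 1)
    (P := .assign vPow (.add (.var vPow) (.var vPow)))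
    (I := fun i t => Ready S k t ∧ t.var vFound = 0 ∧ t.var vPow = 2 ^ i)
    ⟨h.setVar (by decide) _, hfound, rfl⟩ ?_
  · rwa [Store.var_setVar, if_neg (by decide), h.sized.cols] at hloop
  rintro i - t ⟨hready, hfound, hpow⟩
  refine ⟨(hready.setVar (by decide) _).setVar (by decide) _, hfound, ?_⟩
  simp [Stmt.run, Expr.eval, hpow, pow_succ, mul_two]

lemma searched_run_search (hS : S.Irreducible) (h : Ready S k s) : Searched S k (search.run s) := by
  obtain ⟨K, W, hK⟩ := exists_run_greedySearch hS h
  rw [search, Stmt.run, Stmt.run]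
  set t := greedySearch.run s
  have htest : 0 < (Expr.lt (.var vCount) (.var vK)).eval t ↔ #K < k := by
    rw [Expr.eval_lt_pos, Expr.eval, Expr.eval, hK.marked.count, hK.ready.sized.parameter]
  split_ifs with hlt
  · obtain ⟨-, hsmall⟩ := hK.outcome.resolve_left (htest.1 hlt).not_ge
    obtain ⟨hready, hfound, hpow⟩ := run_countAssignments (s := t.setVar vFound 0)
      (hK.ready.setVar (by decide) _) rfl
    refine ⟨hready, .inr ⟨hfound, hpow, fun l hl => ?_⟩⟩
    obtain hlm | hlm := le_total l m
    · exact hsmall l hlm hl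
    · exact (hsmall m le_rfl m.lt_two_pow_self).trans (Nat.mul_le_mul_right k hlm)
  · obtain ⟨f, hf, hcopy⟩ := exists_run_copyRows (a := aV) hK.ready.sized hK.ready.stored
    rw [Stmt.run, hcopy]
    obtain ⟨hready, W', hgain⟩ := run_eliminateMarked (hK.ready.setArr (a := aV) (by decide) f)
      (hK.marked.setArr (by decide) f) hK.sumFree
      ⟨_, hf, .refl _, (LinSystem.constantGain_tableau hS).ge⟩
    obtain ⟨hready', hgain'⟩ := run_eliminateAll hready hgain
    obtain ⟨f', hrun, z, hz, hf'⟩ := exists_run_readSolution hready' hgain'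
    rw [Stmt.run, Stmt.run, Stmt.run, hrun]
    refine ⟨((hready'.setArr (by decide) _).setVar (by decide) _).setVar (by decide) _,
      .inl ⟨⟨rfl, z, ?_, hf'⟩, rfl⟩⟩
    exact (Nat.cast_le.2 (not_lt.1 (htest.not.1 hlt))).trans hz

end LoopLang

/-! ## The exhaustive search -/

/-- The assignment whose values are the binary digits of `t`. -/
def binaryAssignment (n t : ℕ) (j : Fin n) : ZMod 2 := if t.testBit j then 1 else 0

lemma exists_binaryAssignment_eq {n : ℕ} (z : Fin n → ZMod 2) :
    ∃ t < 2 ^ n, binaryAssignment n t = z := by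
  refine ⟨Nat.ofBits fun j => z j = 1, Nat.ofBits_lt_two_pow _, funext fun j => ?_⟩
  rw [binaryAssignment, Nat.testBit_ofBits_lt _ _ j.2, Fin.eta]
  generalize z j = x
  decide +revert

lemma testBit_add_one_iff (t j : ℕ) :
    (t + 1).testBit j ↔ ((∀ l < j, t.testBit l) ↔ ¬ t.testBit j) := by
  induction j generalizing t with
  | zero => simp [Nat.testBit_zero]; lia
  | succ j ih =>
    rw [Nat.forall_lt_succ_left]
    simp only [Nat.testBit_succ, Nat.testBit_zero, decide_eq_true_eq]
    obtain ht | ht := Nat.mod_two_eq_zero_or_one t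
    · have : (t + 1) / 2 = t / 2 := by lia
      simp [this, ht]
    · have : (t + 1) / 2 = t / 2 + 1 := by lia
      simp [this, ht, ih]

namespace LoopLang

open Finset

/-- The bit that tells whether the assignment in `aZ` falsifies the equation `vI`. -/
def falsified : Expr :=
  .parity vL vN <|
    .add (.sum vJ vN (.and (entry aX vI vJ) (.read aZ (.var vJ)))) (entry aX vI vN)

/-- The assignment in `aZ` has excess at least `vK`. -/
def solves : Expr :=
  .not <| .lt (.sum vI vEqs (.ite falsified (.const 0) (entry aX vI vWeight))) <|
    .add (.var vK) (.sum vI vEqs (.ite falsified (entry aX vI vWeight) (.const 0)))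

/-- The assignment in `aZ` is recorded as the solution, if it is one. -/
def testAssignment : Stmt :=
  .ite solves (fillRow aY vJ vN (.read aZ (.var vJ)) ;; .assign vFound (.const 1)) .skip

/-- The binary number in `aZ` is increased by one. -/
def nextAssignment : Stmt :=
  fillRow aZ vJ vN <|
    .xor (.all vL vN (.ite (.lt (.var vL) (.var vJ)) (.read aZ (.var vL)) (.const 1)))
      (.read aZ (.var vJ))

/-- The test of `vPow` assignments. -/
def exhaustiveSearch : Stmt :=
  fillRow aZ vJ vN (.const 0) ;; .loop vRound vPow (testAssignment ;; nextAssignment)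

variable {n m k t : ℕ} {S : LinSystem n m} {s : Store} {z : Fin n → ZMod 2}

lemma eval_falsified (h : Ready S k s) (hz : ∀ j : Fin n, s.arr aZ j = (z j).val) {i : Fin m}
    (hi : s.var vI = i) : falsified.eval s = (S.A.row i ⬝ᵥ z + S.b i).val := by
  have hprod (j : Fin n) : (Expr.and (entry aX vI vJ) (.read aZ (.var vJ))).eval (s.setVar vJ j) =
      (S.A.row i j * z j).val := by
    have hs : Sized k n m (s.setVar vJ j) := h.sized.setVar (by decide) _
    refine Expr.eval_and_val ?_ (hz j)
    rw [eval_entry_coeff (u := vI) (v := vJ) (i := i.castAdd n) (j := j) hs h.stored hi rfl,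
      LinSystem.tableau_coeff_castAdd]
  have hrhs : (entry aX vI vN).eval s = (S.b i).val := by
    rw [eval_entry_rhs (i := i.castAdd n) h.sized h.stored hi, LinSystem.tableau_rhs_castAdd]
  have hsum : (Expr.add (.sum vJ vN (.and (entry aX vI vJ) (.read aZ (.var vJ))))
      (entry aX vI vN)).eval s = ∑ j, (S.A.row i j * z j).val + (S.b i).val := by
    rw [Expr.eval, Expr.eval, h.sized.cols, sum_range, hrhs]
    simp only [hprod]
  have hle : ∑ j, (S.A.row i j * z j).val + (S.b i).val ≤ 2 * n + 1 := by
    have := sum_le_card_nsmul univ (fun j => (S.A.row i j * z j).val) 1 fun j _ =>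
      Nat.lt_succ_iff.1 (ZMod.val_lt _)
    have := ZMod.val_lt (S.b i)
    simp only [card_univ, Fintype.card_fin, smul_eq_mul, mul_one] at *
    lia
  rw [falsified, Expr.eval_parity (fun x => ?_) (by rwa [hsum, h.sized.cols]), hsum,
    ← ZMod.val_natCast]
  · simp [dotProduct]
  · simp [entry, Expr.eval, Expr.and]

lemma eval_solves (h : Ready S k s) (hz : ∀ j : Fin n, s.arr aZ j = (z j).val) :
    0 < solves.eval s ↔ k ≤ S.excess z := by
  let falsifiedBy (i : Fin m) : Prop := S.A.row i ⬝ᵥ z + S.b i ≠ 0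
  have hfalsified (i : Fin m) : 0 < falsified.eval (s.setVar vI i) ↔ falsifiedBy i := by
    rw [eval_falsified (h.setVar (by decide) i) hz rfl, ZMod.val_pos]
  have hweight (i : Fin m) : (entry aX vI vWeight).eval (s.setVar vI i) = S.w i := by
    have h' : Ready S k (s.setVar vI i) := h.setVar (by decide) _
    rw [eval_entry_weight (i := i.castAdd n) h'.sized h'.stored rfl, LinSystem.rowWeight_castAdd]
  have hexcess : S.excess z = ((∑ i, if falsifiedBy i then 0 else S.w i : ℕ) : ℤ) -
      (∑ i, if falsifiedBy i then S.w i else 0 : ℕ) := by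
    rw [S.excess_eq_sum_gain, Nat.cast_sum, Nat.cast_sum, ← sum_sub_distrib]
    refine sum_congr rfl fun i _ => ?_
    by_cases hi : S.A.row i ⬝ᵥ z + S.b i = 0 <;> simp [falsifiedBy, Tableau.gain, hi]
  simp only [solves, Expr.eval_not_pos, Expr.eval, h.sized.equations,
    h.sized.parameter, sum_range, hfalsified, hweight, hexcess]
  lia

lemma exists_run_nextAssignment (h : Ready S k s)
    (hz : ∀ j : Fin n, s.arr aZ j = (binaryAssignment n t j).val) :
    ∃ f, nextAssignment.run s = s.setArr aZ f ∧
      ∀ j : Fin n, f j = (binaryAssignment n (t + 1) j).val := by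
  obtain ⟨f, hrun, hf⟩ := exists_run_fillRow (a := aZ) (j := vJ) (b := vN) (e := .xor
    (.all vL vN (.ite (.lt (.var vL) (.var vJ)) (.read aZ (.var vL)) (.const 1)))
    (.read aZ (.var vJ))) h.sized
  refine ⟨f, hrun, fun j => ?_⟩
  rw [hf j (h.sized.cols.symm ▸ j.2)]
  have hdigit (l : Fin n) : 0 < s.arr aZ l ↔ t.testBit l := by
    rw [hz, ZMod.val_pos, binaryAssignment]
    split_ifs <;> simp_all
  have hcarry : 0 < (Expr.all vL vN (.ite (.lt (.var vL) (.var vJ)) (.read aZ (.var vL))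
      (.const 1))).eval ((s.setVar vI 0).setVar vJ j) ↔ ∀ l < (j : ℕ), t.testBit l := by
    have hs : Sized k n m ((s.setVar vI 0).setVar vJ j) :=
      (h.sized.setVar (by decide) _).setVar (by decide) _
    rw [Expr.eval_all_pos, hs.cols]
    simp only [Expr.eval, Store.var_setVar, Store.arr_setVar]
    constructor
    · intro hall l hl
      have := hall l (hl.trans j.2)
      simpa [hl, ← hdigit ⟨l, hl.trans j.2⟩] using this
    · intro hall l hl
      by_cases hlj : l < j
      · simpa [hlj, hdigit ⟨l, hl⟩] using hall l hlj
      · simp [hlj]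
  rw [Expr.xor, Expr.eval, Expr.eval_not]
  simp only [hcarry, Expr.eval, Store.arr_setVar, Store.var_setVar, if_true, hdigit]
  rw [hz, binaryAssignment, binaryAssignment]
  have hsucc := testBit_add_one_iff t j
  by_cases hall : ∀ l < (j : ℕ), t.testBit l <;> by_cases hbit : t.testBit j <;>
    simp_all [ZMod.val_one]

/-- The assignment in `aY` is a solution, or else there is none. -/
def Answered (S : LinSystem n m) (k : ℕ) (s : Store) : Prop :=
  Solved S k s ∨ s.var vFound = 0 ∧ S.maxExcess < k

/-- The state after the test of `t` assignments. -/
structure Testing (S : LinSystem n m) (k t : ℕ) (s : Store) : Prop where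
  ready : Ready S k s
  assignment : ∀ j : Fin n, s.arr aZ j = (binaryAssignment n t j).val
  outcome : Solved S k s ∨
    s.var vFound = 0 ∧ s.var vPow = 2 ^ n ∧ ∀ u < t, S.excess (binaryAssignment n u) < k

lemma Testing.run_testAssignment (h : Testing S k t s) :
    Ready S k (testAssignment.run s) ∧ (testAssignment.run s).arr aZ = s.arr aZ ∧
      (Solved S k (testAssignment.run s) ∨ (testAssignment.run s).var vFound = 0 ∧
        (testAssignment.run s).var vPow = 2 ^ n ∧
          ∀ u < t + 1, S.excess (binaryAssignment n u) < k) := by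
  rw [testAssignment, Stmt.run]
  have htest := eval_solves h.ready h.assignment
  split_ifs with hsolves
  · obtain ⟨f, hrun, hf⟩ := exists_run_fillRow (a := aY) (j := vJ) (b := vN)
      (e := .read aZ (.var vJ)) h.ready.sized
    rw [Stmt.run, hrun]
    refine ⟨(h.ready.setArr (by decide) f).setVar (by decide) _, rfl,
      .inl ⟨rfl, _, htest.1 hsolves, fun j => ?_⟩⟩
    rw [← h.assignment j]
    exact hf j (h.ready.sized.cols.symm ▸ j.2)
  · refine ⟨h.ready, rfl, h.outcome.imp_right fun ⟨hfound, hpow, hfail⟩ =>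
      ⟨hfound, hpow, fun u hu => ?_⟩⟩
    obtain hu | rfl := Nat.lt_succ_iff_lt_or_eq.1 hu
    · exact hfail u hu
    · exact not_le.1 (htest.not.1 hsolves)

lemma Testing.run_round (h : Testing S k t s) :
    Testing S k (t + 1) ((testAssignment ;; nextAssignment).run s) := by
  obtain ⟨hready, hassignment, houtcome⟩ := h.run_testAssignment
  obtain ⟨f, hrun, hf⟩ := exists_run_nextAssignment hready (hassignment ▸ h.assignment)
  rw [Stmt.run, hrun]
  exact ⟨hready.setArr (by decide) f, hf, houtcome⟩

lemma maxExcess_lt (h : ∀ t < 2 ^ n, S.excess (binaryAssignment n t) < k) : S.maxExcess < k := by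
  rw [LinSystem.maxExcess, sup'_lt_iff]
  intro z _
  obtain ⟨t, ht, rfl⟩ := exists_binaryAssignment_eq z
  exact h t ht

lemma answered_run_exhaustiveSearch (h : Searched S k s) :
    Ready S k (exhaustiveSearch.run s) ∧ Answered S k (exhaustiveSearch.run s) := by
  obtain ⟨f, hrun, hf⟩ := exists_run_fillRow (a := aZ) (j := vJ) (b := vN) (e := .const 0)
    h.ready.sized
  have hready : Ready S k (s.setArr aZ f) := h.ready.setArr (by decide) f
  rw [exhaustiveSearch, Stmt.run, hrun]
  obtain ⟨hsolved, hpow⟩ | ⟨hfound, hpow, -⟩ := h.outcome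
  · rw [Stmt.run, Store.var_setArr, hpow, rounds]
    exact ⟨hready, .inl hsolved⟩
  have hinitial : Testing S k 0 (s.setArr aZ f) := by
    refine ⟨hready, fun j => ?_, .inr ⟨hfound, hpow, fun u hu => (Nat.not_lt_zero _ hu).elim⟩⟩
    exact (hf j (h.ready.sized.cols.symm ▸ j.2)).trans (by simp [Expr.eval, binaryAssignment])
  have hloop := Stmt.loop_induct (v := vRound) (b := vPow) (P := testAssignment ;; nextAssignment)
    (I := fun i t => Testing S k i t) hinitial fun i _ t ht => Testing.run_round
      ⟨ht.ready.setVar (by decide) i, ht.assignment, ht.outcome⟩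
  rw [Store.var_setArr, hpow] at hloop
  exact ⟨hloop.ready, hloop.outcome.imp_right fun ho => ⟨ho.1, maxExcess_lt ho.2.2⟩⟩

/-- The solution is written to the tape, and the answer to the variable `0`. -/
def output : Stmt :=
  .loop vJ vN (.write (.var vJ) (.read aY (.var vJ))) ;; .assign vK (.var vFound)

lemma run_output (h : Ready S k s) :
    (output.run s).tape.length = s.tape.length ∧ (output.run s).var vK = s.var vFound ∧
      ∀ j < n, (output.run s).tape.getD j 0 = s.arr aY j := by
  have hloop := Stmt.loop_induct (v := vJ) (b := vN) (P := .write (.var vJ) (.read aY (.var vJ)))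
    (s := s) (I := fun i t => t.tape.length = s.tape.length ∧ t.var vFound = s.var vFound ∧
      t.arr = s.arr ∧ ∀ j < i, t.tape.getD j 0 = s.arr aY j)
    ⟨rfl, rfl, rfl, fun j hj => (Nat.not_lt_zero _ hj).elim⟩ ?_
  · obtain ⟨hlength, hfound, -, htape⟩ := hloop
    exact ⟨hlength, hfound, h.sized.cols ▸ htape⟩
  rintro i hi t ⟨hlength, hfound, harr, htape⟩
  have hi' : i < t.tape.length := by
    rw [h.sized.cols] at hi
    exact hi.trans_le (h.length_le.trans hlength.ge)
  refine ⟨by simpa [Stmt.run] using hlength, hfound, harr, fun j hj => ?_⟩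
  simp only [Stmt.run, Expr.eval, Store.var_setVar, if_true, Store.arr_setVar, Store.tape_setVar,
    harr]
  obtain hj | rfl := Nat.lt_succ_iff_lt_or_eq.1 hj
  · rw [List.getD_eq_getElem?_getD, List.getElem?_set_ne hj.ne', ← List.getD_eq_getElem?_getD,
      htape j hj]
  · rw [List.getD_eq_getElem?_getD, List.getElem?_set_self hi', Option.getD_some]

end LoopLang

lemma getElem?_flatMap {α β : Type*} {g : α → List β} {W : ℕ} (hg : ∀ a, (g a).length = W)
    (l : List α) {i j : ℕ} (hj : j < W) :
    (l.flatMap g)[W * i + j]? = l[i]?.bind fun a => (g a)[j]? := by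
  induction l generalizing i with
  | nil => rfl
  | cons a l ih =>
    rw [List.flatMap_cons, List.getElem?_append, hg]
    cases i with
    | zero => simp [hj]
    | succ i =>
      rw [if_neg (by rw [Nat.mul_succ]; lia), Nat.mul_succ,
        show W * i + W + j - W = W * i + j by lia, ih, List.getElem?_cons_succ]

namespace LinSystem

variable {n m k : ℕ} (S : LinSystem n m)

lemma length_encode : S.encode.length = 2 + m * (n + 2) := by
  simp [encode, List.length_flatMap]
  ring

lemma encode_getD (i : Fin m) {j : ℕ} (hj : j < n + 2) :
    S.encode.getD (2 + ((n + 2) * i + j)) 0 =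
      ((List.finRange n).map (fun j => (S.A i j).val) ++ [(S.b i).val, S.w i]).getD j 0 := by
  rw [encode, show 2 + ((n + 2) * (i : ℕ) + j) = (n + 2) * i + j + 1 + 1 by lia,
    List.getD_cons_succ, List.getD_cons_succ, List.getD_eq_getElem?_getD,
    getElem?_flatMap (W := n + 2) (by simp) _ hj, List.getD_eq_getElem?_getD]
  simp

lemma encode_coeff (i : Fin m) (j : Fin n) :
    S.encode.getD (2 + ((n + 2) * i + j)) 0 = (S.A i j).val := by
  rw [encode_getD S i (by lia), List.getD_append _ _ _ _ (by simp)]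
  simp

lemma encode_rhs (i : Fin m) : S.encode.getD (2 + ((n + 2) * i + n)) 0 = (S.b i).val := by
  rw [encode_getD S i (by lia), List.getD_append_right _ _ _ _ (by simp)]
  simp

lemma encode_weight (i : Fin m) : S.encode.getD (2 + ((n + 2) * i + (n + 1))) 0 = S.w i := by
  rw [encode_getD S i (by lia), List.getD_append_right _ _ _ _ (by simp)]
  simp

variable {S}

lemma Irreducible.card_vars_le (hS : S.Irreducible) : n ≤ m :=
  hS.rank_eq.symm.trans_le S.A.rank_le_height

variable (S)

/-- The output on the instance `(S, k)`, as it is required of a program that finds a solution. -/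
def Reports (k : ℕ) (σ : RAM.State) : Prop :=
  (σ.reg 0 = 1 ∧ ∃ z : Fin n → ZMod 2, k ≤ S.excess z ∧ ∀ j : Fin n, σ.mem j = (z j).val) ∨
    σ.reg 0 = 0 ∧ S.maxExcess < k

end LinSystem

namespace LoopLang

open Finset Polynomial

/-- The dimensions are read from the tape. -/
def setup : Stmt :=
  .assign vN (.tape (.const 0)) ;; .assign vEqs (.tape (.const 1)) ;;
    .assign vRows (.add (.var vEqs) (.var vN)) ;; .assign vWidth (.add (.var vN) (.const 2)) ;;
      .assign vWeight (.add (.var vN) (.const 1)) ;; .assign vOne (.const 1)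

/-- The entry `vJ` of the row `vI` in the tableau of the system on the tape. -/
def loadedEntry : Expr :=
  .ite (.lt (.var vI) (.var vEqs))
    (.tape (.add (.const 2) (.add (.sum vD vWidth (.var vI)) (.var vJ))))
    (.ite (.eq (.var vI) (.add (.var vEqs) (.var vJ))) (.const 1) (.const 0))

/-- The tableau of the system on the tape is stored in `aX`. -/
def load : Stmt := .fill aX vI vJ vRows vWidth loadedEntry

variable {n m k N : ℕ} {S : LinSystem n m} {s : Store}

lemma tape_run_setup : (setup.run s).tape = s.tape := rfl

lemma sized_run_setup : Sized k n m (setup.run (initStore S.encode k)) := by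
  constructor <;> rfl

lemma ready_run_load (hS : S.Irreducible) (hs : Sized k n m s) (htape : s.tape = S.encode) :
    Ready S k (load.run s) := by
  obtain ⟨f, hrun, hf⟩ := exists_run_fill aX vI vJ vRows vWidth loadedEntry s
  rw [hs.rows, hs.width] at hf
  have hequation (i : Fin m) (y : ℕ) (hy : y < n + 2) :
      f ((n + 2) * i + y) = S.encode.getD (2 + ((n + 2) * i + y)) 0 := by
    simp [hf i (by lia) y hy, loadedEntry, Expr.eval, hs.equations, hs.width, htape]
  have hcoordinate (j : Fin n) (y : ℕ) (hy : y < n + 2) :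
      f ((n + 2) * (m + j) + y) = if (j : ℕ) = y then 1 else 0 := by
    rw [hf (m + j) (by lia) y hy]
    simp [loadedEntry, Expr.eval, hs.equations]
  rw [load, hrun]
  refine ⟨hs.setArr _ _, ?_, ?_⟩
  · rw [Store.arr_setArr, if_pos rfl]
    refine ⟨fun i => ?_, fun i => ?_, fun i => ?_⟩ <;>
      refine Fin.addCases (fun i => ?_) (fun i => ?_) i
    · intro j
      rw [Fin.val_castAdd, hequation _ _ (by lia), S.encode_coeff, S.tableau_coeff_castAdd]
      rfl
    · intro j
      rw [Fin.val_natAdd, hcoordinate _ _ (by lia), S.tableau_coeff_natAdd, Pi.single_apply]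
      simp only [Fin.ext_iff, eq_comm (a := (j : ℕ))]
      split_ifs <;> rfl
    · rw [Fin.val_castAdd, hequation _ _ (by lia), S.encode_rhs, S.tableau_rhs_castAdd]
    · rw [Fin.val_natAdd, hcoordinate _ _ (by lia), if_neg i.2.ne, S.tableau_rhs_natAdd]
      rfl
    · rw [Fin.val_castAdd, hequation _ _ (by lia), S.encode_weight, S.rowWeight_castAdd]
    · rw [Fin.val_natAdd, hcoordinate _ _ (by lia), if_neg (by lia), S.rowWeight_natAdd]
  · rw [Store.tape_setArr, htape, S.length_encode]
    nlinarith [hS.card_vars_le]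

lemma boundedBy_setup : setup.BoundedBy ∅ := by
  simp [setup, Stmt.BoundedBy, Expr.BoundedBy]

lemma boundedBy_load_search : (load ;; search).BoundedBy (Set.Iic vOne) := by
  simp [load, loadedEntry, search, greedySearch, greedyPass, selectRow, freeRow, markRow,
    clearMarks, countAssignments, eliminateMarked, eliminateAll, eliminateRow, eliminatedEntry,
    readSolution, copyRows, fillRow, majority, classWeight, leadingZeros, zeroRow, sameRow, entry,
    Stmt.BoundedBy, Expr.BoundedBy, Expr.all, Expr.not, Expr.and, Expr.eq, Expr.xor]

lemma boundedBy_exhaustiveSearch : exhaustiveSearch.BoundedBy (Set.Iic vPow) := by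
  simp [exhaustiveSearch, testAssignment, nextAssignment, solves, falsified, fillRow, entry,
    Stmt.BoundedBy, Expr.BoundedBy, Expr.all, Expr.not, Expr.and, Expr.xor, Expr.parity, Expr.half]

lemma boundedBy_output : output.BoundedBy {vN} := by
  simp [output, Stmt.BoundedBy, Expr.BoundedBy]

lemma Sized.var_le (hs : Sized k n m s) (hN : m + n + k + 2 ≤ N) : ∀ b ≤ vOne, s.var b ≤ N := by
  intro b hb
  interval_cases b
  · rw [hs.parameter]; lia
  · rw [hs.cols]; lia
  · rw [hs.equations]; lia
  · rw [hs.rows]; lia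
  · rw [hs.width]; lia
  · rw [hs.weight]; lia
  · rw [hs.one]; lia

lemma Searched.var_le (h : Searched S k s) (hN : m + n + k + 2 ≤ N)
    (hpow : (∀ l, m < 2 ^ l → n ≤ l * k) → 2 ^ n ≤ N) : ∀ b ≤ vPow, s.var b ≤ N := by
  intro b hb
  obtain hb | rfl := Nat.lt_succ_iff_lt_or_eq.1 (Nat.lt_succ_of_le hb)
  · exact h.ready.sized.var_le hN b (Nat.le_of_lt_succ hb)
  · obtain ⟨-, hzero⟩ | ⟨-, heq, hsmall⟩ := h.outcome
    · exact hzero.trans_le N.zero_le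
    · exact heq.trans_le (hpow hsmall)

/-- The program that solves a system. -/
def solver : RAM.Prog :=
  .seq (setup.compile 0) <| .seq ((load ;; search).compile 0) <|
    .seq (exhaustiveSearch.compile 0) (output.compile 0)

lemma reports_of_represents {σ : RAM.State} (hready : Ready S k s) (h : Answered S k s)
    (hσ : Represents σ (output.run s)) : S.Reports k σ := by
  obtain ⟨hlength, hanswer, htape⟩ := run_output hready
  have hreg : σ.reg 0 = s.var vFound := (hσ.var vK).trans hanswer
  obtain ⟨hfound, z, hz, hy⟩ | ⟨hfound, hlt⟩ := h
  · refine .inl ⟨hreg.trans hfound, z, hz, fun j => ?_⟩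
    rw [hσ.tape j (j.2.trans_le (hready.length_le.trans hlength.ge)), htape j j.2, hy j]
  · exact .inr ⟨hreg.trans hfound, hlt⟩

lemma runs_solver (hS : S.Irreducible) (hN : m + n + k + 2 ≤ N)
    (hpow : (∀ l, m < 2 ^ l → n ≤ l * k) → 2 ^ n ≤ N) :
    RAM.Runs solver
      (setup.time N + ((load ;; search).time N + (exhaustiveSearch.time N + output.time N)))
      (RAM.initState S.encode k) (S.Reports k) := by
  have hsized : Sized k n m (setup.run (initStore S.encode k)) := sized_run_setup
  have hsearched := searched_run_search hS (ready_run_load hS hsized tape_run_setup)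
  obtain ⟨hready, hanswered⟩ := answered_run_exhaustiveSearch hsearched
  refine .seq <| (setup.runs_compile boundedBy_setup (fun b hb => hb.elim)
    (represents_initState _ _)).mono le_rfl fun σ₁ h₁ => ?_
  refine .seq <| ((load ;; search).runs_compile boundedBy_load_search (hsized.var_le hN)
    h₁.1).mono le_rfl fun σ₂ h₂ => ?_
  refine .seq <| (exhaustiveSearch.runs_compile boundedBy_exhaustiveSearch
    (hsearched.var_le hN hpow) h₂.1).mono le_rfl fun σ₃ h₃ => ?_
  refine (output.runs_compile boundedBy_output ?_ h₃.1).mono le_rfl fun σ₄ h₄ =>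
    reports_of_represents hready hanswered h₄.1
  rintro b rfl
  exact hready.sized.var_le hN _ (by decide)

lemma exists_runs_solver : ∃ p : ℕ[X], ∀ {n m k N : ℕ} {S : LinSystem n m}, S.Irreducible →
    m + n + k + 2 ≤ N → ((∀ l, m < 2 ^ l → n ≤ l * k) → 2 ^ n ≤ N) →
      RAM.Runs solver (p.eval N) (RAM.initState S.encode k) (S.Reports k) := by
  obtain ⟨p₁, h₁⟩ := setup.exists_time_eq_eval
  obtain ⟨p₂, h₂⟩ := (load ;; search).exists_time_eq_eval
  obtain ⟨p₃, h₃⟩ := exhaustiveSearch.exists_time_eq_eval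
  obtain ⟨p₄, h₄⟩ := output.exists_time_eq_eval
  refine ⟨p₁ + (p₂ + (p₃ + p₄)), fun hS hN hpow => ?_⟩
  simp only [eval_add, ← h₁, ← h₂, ← h₃, ← h₄]
  exact runs_solver hS hN hpow

end LoopLang

/-! ## Logarithmic cost of a computation -/

namespace RAM

/-- The maximal binary length of the constants in a program. -/
def Prog.constSize : Prog → ℕ
  | skip => 0
  | instr (.const _ c) => Nat.size c
  | instr _ => 0
  | seq P Q => max P.constSize Q.constSize
  | ifLt _ _ P Q => max P.constSize Q.constSize
  | whileLt _ _ P => P.constSize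

/-- All numbers in the state have at most `B` binary digits. -/
structure State.SizeLE (B : ℕ) (σ : State) : Prop where
  reg : ∀ i, Nat.size (σ.reg i) ≤ B
  mem : ∀ i, Nat.size (σ.mem i) ≤ B

lemma size_add_le {a b B : ℕ} (ha : Nat.size a ≤ B) (hb : Nat.size b ≤ B) :
    Nat.size (a + b) ≤ B + 1 := by
  rw [Nat.size_le] at *
  lia

lemma size_le_self (a : ℕ) : Nat.size a ≤ a :=
  Nat.size_le.2 Nat.lt_two_pow_self

section

variable {B C x t : ℕ} {σ τ : State} {i : Instr} {P : Prog}

lemma State.SizeLE.mono (h : σ.SizeLE B) (hBC : B ≤ C) : σ.SizeLE C :=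
  ⟨fun i => (h.reg i).trans hBC, fun i => (h.mem i).trans hBC⟩

lemma State.SizeLE.setReg (h : σ.SizeLE B) (r : ℕ) (hx : Nat.size x ≤ B) :
    (σ.setReg r x).SizeLE B := by
  refine ⟨fun i => ?_, h.mem⟩
  rw [reg_setReg]
  split_ifs
  exacts [hx, h.reg i]

lemma State.SizeLE.setMem (h : σ.SizeLE B) (a : ℕ) (hx : Nat.size x ≤ B) :
    (σ.setMem a x).SizeLE B := by
  refine ⟨h.reg, fun i => ?_⟩
  rw [mem_setMem]
  split_ifs
  exacts [hx, h.mem i]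

lemma State.SizeLE.run (h : σ.SizeLE B) (hi : (Prog.instr i).constSize ≤ B) :
    (i.run σ).SizeLE (B + 1) := by
  have hsucc : σ.SizeLE (B + 1) := h.mono B.le_succ
  cases i with
  | const d c => exact hsucc.setReg d (Nat.le_succ_of_le hi)
  | add d a b => exact hsucc.setReg d (size_add_le (h.reg a) (h.reg b))
  | sub d a b => exact hsucc.setReg d ((Nat.size_le_size (Nat.sub_le _ _)).trans (hsucc.reg a))
  | load d a => exact hsucc.setReg d (hsucc.mem _)
  | store a b => exact hsucc.setMem _ (hsucc.reg b)

lemma State.SizeLE.test_cost_le (h : σ.SizeLE B) (a b : ℕ) :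
    1 + logCost (σ.reg a) + logCost (σ.reg b) ≤ 1 + 2 * B := by
  have := h.reg a
  have := h.reg b
  simp only [logCost]
  lia

lemma State.SizeLE.cost_le (h : σ.SizeLE B) (hi : (Prog.instr i).constSize ≤ B) :
    i.cost logCost σ ≤ 1 + 2 * B := by
  cases i with
  | const d c =>
    simp only [Prog.constSize, Instr.cost, logCost] at hi ⊢
    lia
  | load d a =>
    have := h.reg a
    have := h.mem (σ.reg a)
    simp only [Instr.cost, logCost]
    lia
  | add d a b | sub d a b | store a b => exact h.test_cost_le a b

lemma Instr.cost_uniformCost (i : Instr) (σ : State) : i.cost uniformCost σ = 1 := by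
  cases i <;> rfl

/-- Each step lengthens the numbers by at most one binary digit. -/
theorem Exec.exists_logCost_le (h : Exec uniformCost P σ t τ) (hP : P.constSize ≤ B)
    (hσ : σ.SizeLE B) (hC : B + t ≤ C) :
    τ.SizeLE (B + t) ∧ ∃ t', Exec logCost P σ t' τ ∧ t' ≤ t * (1 + 2 * C) := by
  induction h generalizing B with
  | skip σ => exact ⟨hσ.mono (by lia), 1, .skip σ, by lia⟩
  | instr i σ =>
    rw [i.cost_uniformCost] at hC ⊢
    have := hσ.cost_le hP
    exact ⟨hσ.run hP, _, .instr i σ, by lia⟩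
  | seq _ _ ihP ihQ =>
    rw [Prog.constSize, max_le_iff] at hP
    obtain ⟨hυ, u, hu, hut⟩ := ihP hP.1 hσ (by lia)
    obtain ⟨hτ, v, hv, hvt⟩ := ihQ (hP.2.trans (Nat.le_add_right _ _)) hυ (by lia)
    refine ⟨hτ.mono (by lia), u + v, .seq hu hv, ?_⟩
    rw [add_mul]
    exact Nat.add_le_add hut hvt
  | @ifLt_true a b _ _ _ _ _ hab _ ih =>
    rw [Prog.constSize, max_le_iff] at hP
    obtain ⟨hτ, u, hu, hut⟩ := ih hP.1 hσ (by lia)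
    refine ⟨hτ.mono (by lia), _, .ifLt_true hab hu, ?_⟩
    have := hσ.test_cost_le a b
    simp only [uniformCost] at hC ⊢
    lia
  | @ifLt_false a b _ _ _ _ _ hab _ ih =>
    rw [Prog.constSize, max_le_iff] at hP
    obtain ⟨hτ, u, hu, hut⟩ := ih hP.2 hσ (by lia)
    refine ⟨hτ.mono (by lia), _, .ifLt_false hab hu, ?_⟩
    have := hσ.test_cost_le a b
    simp only [uniformCost] at hC ⊢
    lia
  | @whileLt_true a b _ _ _ _ _ _ hab _ _ ihP ihW =>
    obtain ⟨hυ, u, hu, hut⟩ := ihP hP hσ (by lia)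
    obtain ⟨hτ, v, hv, hvt⟩ := ihW (hP.trans (Nat.le_add_right _ _)) hυ (by lia)
    refine ⟨hτ.mono (by lia), _, .whileLt_true hab hu hv, ?_⟩
    have := hσ.test_cost_le a b
    simp only [uniformCost] at hC ⊢
    lia
  | @whileLt_false a b _ σ hab =>
    refine ⟨hσ.mono (by lia), _, .whileLt_false hab, ?_⟩
    have := hσ.test_cost_le a b
    simp only [uniformCost] at hC ⊢
    lia

end

end RAM

/-! ## The size of an instance -/

lemma length_le_bitSize (x : List ℕ) : x.length ≤ bitSize x := by
  rw [bitSize, ← List.length_map (f := fun a => Nat.size a + 1)]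
  refine List.length_le_sum_of_one_le _ fun a ha => ?_
  obtain ⟨b, -, rfl⟩ := List.mem_map.1 ha
  exact Nat.le_add_left 1 _

lemma size_le_bitSize {x : List ℕ} {a : ℕ} (h : a ∈ x) : Nat.size a ≤ bitSize x :=
  (Nat.le_succ _).trans (List.le_sum_of_mem (List.mem_map_of_mem (f := fun a => Nat.size a + 1) h))

lemma RAM.sizeLE_initState (x : List ℕ) (k : ℕ) :
    (initState x k).SizeLE (k + bitSize x) := by
  refine ⟨fun i => ?_, fun i => ?_⟩
  · have := size_le_self k
    have := (size_le_self x.length).trans (length_le_bitSize x)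
    simp only [initState]
    split_ifs
    · lia
    · lia
    · simp
  · change Nat.size (x.getD i 0) ≤ _
    obtain hi | hi := lt_or_ge i x.length
    · rw [List.getD_eq_getElem _ _ hi]
      exact (size_le_bitSize (List.getElem_mem hi)).trans (Nat.le_add_left _ _)
    · rw [List.getD_eq_default _ _ hi]
      simp

namespace LinSystem

variable {n m n' m' k : ℕ}

lemma lt_bitSize_encode (S : LinSystem n m) : m < bitSize S.encode := by
  refine lt_of_lt_of_le ?_ (length_le_bitSize _)
  rw [length_encode]
  nlinarith

lemma dims_eq_of_encode_eq {S : LinSystem n m} {T : LinSystem n' m'} (h : S.encode = T.encode) :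
    n = n' ∧ m = m' := by
  simp only [encode, List.cons.injEq] at h
  exact ⟨h.1, h.2.1⟩

lemma encode_injective : Function.Injective (encode (n := n) (m := m)) := by
  rintro S T h
  have hA : S.A = T.A := by
    ext i j
    exact ZMod.val_injective 2 (by rw [← encode_coeff, h, encode_coeff])
  have hb : S.b = T.b := by
    ext i
    exact ZMod.val_injective 2 (by rw [← encode_rhs, h, encode_rhs])
  have hw : S.w = T.w := by
    ext i
    rw [← encode_weight, h, encode_weight]
  cases S
  cases T
  simp_all only

lemma encode_mem_maxLinAA_iff (S : LinSystem n m) :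
    (S.encode, k) ∈ MaxLinAA ↔ k ≤ S.maxExcess := by
  refine ⟨?_, fun h => ⟨n, m, S, rfl, h⟩⟩
  rintro ⟨n', m', T, hT, hk⟩
  obtain ⟨rfl, rfl⟩ := dims_eq_of_encode_eq hT
  rwa [encode_injective hT]

open Classical in
lemma Reports.reg_zero_eq {S : LinSystem n m} {σ : RAM.State} (h : S.Reports k σ) :
    σ.reg 0 = if (S.encode, k) ∈ MaxLinAA then 1 else 0 := by
  rw [encode_mem_maxLinAA_iff]
  obtain ⟨hreg, z, hz, -⟩ | ⟨hreg, hlt⟩ := h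
  · have hk : k ≤ S.maxExcess := hz.trans (Finset.le_sup' S.excess (Finset.mem_univ z))
    rw [hreg, if_pos hk]
  · rw [hreg, if_neg (not_le.2 hlt)]

end LinSystem

/-! ## Fixed-parameter tractability -/

section

variable {p : ℕ → ℝ} {g N : ℕ → ℕ} {n m k : ℕ}

theorem SolutionFoundInTime.decidableInFPTTime (h : SolutionFoundInTime p g) :
    ∃ K, DecidableInFPTTime (SparseInstances p) MaxLinAA
      fun k => g k * (2 * k + 2 * g k + K) := by
  obtain ⟨P, c, hP⟩ := h
  refine ⟨2 * P.constSize + 3, P, c + (c + 1), ?_⟩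
  rintro _ k ⟨n, m, S, rfl, hS, hm⟩
  obtain ⟨t, σ, hexec, ht, hσ⟩ := hP n m S k hS hm
  obtain ⟨-, t', hexec', ht'⟩ := hexec.exists_logCost_le
    (B := P.constSize + (k + bitSize S.encode)) (Nat.le_add_right _ _)
    ((RAM.sizeLE_initState _ _).mono (Nat.le_add_left _ _)) le_rfl
  refine ⟨t', σ, hexec', ht'.trans ?_, LinSystem.Reports.reg_zero_eq hσ⟩
  have hm : m < bitSize S.encode := S.lt_bitSize_encode
  generalize bitSize S.encode = b at hm ⊢
  have htb : t ≤ g k * b ^ c := ht.trans (Nat.mul_le_mul_left _ (Nat.pow_le_pow_left hm c))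
  have hb : b ≤ b ^ (c + 1) := Nat.le_self_pow c.succ_ne_zero b
  have hone : 1 ≤ b ^ (c + 1) := Nat.one_le_pow _ _ (by lia)
  have hpow : g k * b ^ c ≤ g k * b ^ (c + 1) :=
    Nat.mul_le_mul_left _ (Nat.pow_le_pow_right (by lia) c.le_succ)
  have hdigits : 1 + 2 * (P.constSize + (k + b) + t) ≤
      (2 * k + 2 * g k + (2 * P.constSize + 3)) * b ^ (c + 1) := by
    nlinarith [Nat.mul_le_mul_left P.constSize hone, Nat.mul_le_mul_left k hone]
  calc t * (1 + 2 * (P.constSize + (k + b) + t))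
      ≤ g k * b ^ c * ((2 * k + 2 * g k + (2 * P.constSize + 3)) * b ^ (c + 1)) :=
        Nat.mul_le_mul htb hdigits
    _ = _ := by rw [pow_add b c (c + 1)]; ring

lemma exists_lt_two_pow_of_sublinear (hm : (m : ℝ) ≤ (2 : ℝ) ^ p n) (hn : 2 * k < n)
    (hp : ((2 * k : ℕ) : ℝ) * |p n| ≤ n) : ∃ l, m < 2 ^ l ∧ l * k < n := by
  refine ⟨⌊|p n|⌋₊ + 1, ?_, ?_⟩
  · have hlt : (2 : ℝ) ^ p n < 2 ^ ((⌊|p n|⌋₊ + 1 : ℕ) : ℝ) := by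
      refine Real.rpow_lt_rpow_of_exponent_lt one_lt_two ((le_abs_self _).trans_lt ?_)
      exact_mod_cast Nat.lt_floor_add_one |p n|
    rw [Real.rpow_natCast] at hlt
    exact_mod_cast hm.trans_lt hlt
  · have hfloor : ((2 * k * ⌊|p n|⌋₊ : ℕ) : ℝ) ≤ n := by
      rw [Nat.cast_mul]
      exact (mul_le_mul_of_nonneg_left (Nat.floor_le (abs_nonneg _)) (Nat.cast_nonneg _)).trans hp
    have hfloor : 2 * k * ⌊|p n|⌋₊ ≤ n := by exact_mod_cast hfloor
    nlinarith

/-- The hypothesis `hsmall` is what a failure of the greedy search means. -/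
lemma two_pow_le_of_sublinear (hN : ∀ j n : ℕ, N j ≤ n → (j : ℝ) * |p n| ≤ n)
    (hm : (m : ℝ) ≤ (2 : ℝ) ^ p n) (hsmall : ∀ l, m < 2 ^ l → n ≤ l * k) :
    2 ^ n ≤ 2 ^ (N (2 * k) + 2 * k) := by
  refine Nat.pow_le_pow_right two_pos (not_lt.1 fun hlt => ?_)
  obtain ⟨l, hml, hlk⟩ := exists_lt_two_pow_of_sublinear (k := k) hm (by lia) (hN _ n (by lia))
  exact hlk.not_ge (hsmall l hml)

theorem solutionFoundInTime_of_sublinear (hN : ∀ j n : ℕ, N j ≤ n → (j : ℝ) * |p n| ≤ n) :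
    ∃ C c, SolutionFoundInTime p fun k => C * (2 ^ (N (2 * k) + 2 * k) + k + 3) ^ c := by
  obtain ⟨q, hq⟩ := LoopLang.exists_runs_solver
  refine ⟨q.eval 1, q.natDegree, LoopLang.solver, q.natDegree, fun n m S k hS hm => ?_⟩
  have hnm : n ≤ m := hS.card_vars_le
  have hpow := two_pow_le_of_sublinear (k := k) hN hm
  dsimp only
  generalize 2 ^ (N (2 * k) + 2 * k) = a at hpow ⊢
  refine (hq hS (N := a + 2 * m + k + 2) (by lia) fun hl => (hpow hl).trans (by lia)).mono ?_
    fun _ => id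
  refine (polynomial_eval_le q _).trans ?_
  rw [mul_assoc, ← mul_pow]
  refine Nat.mul_le_mul_left _ (Nat.pow_le_pow_left ?_ _)
  nlinarith [Nat.zero_le (a * m), Nat.zero_le (k * m)]

lemma exists_sublinear_bound (hp : p =o[Filter.atTop] fun n : ℕ => (n : ℝ)) :
    ∃ N : ℕ → ℕ, ∀ j n : ℕ, N j ≤ n → (j : ℝ) * |p n| ≤ n := by
  suffices h : ∀ j : ℕ, ∃ N, ∀ n, N ≤ n → (j : ℝ) * |p n| ≤ n by
    choose N hN using h
    exact ⟨N, hN⟩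
  refine fun j => Filter.eventually_atTop.1 ?_
  have hj : (0 : ℝ) < 1 / (j + 1) := by positivity
  filter_upwards [Asymptotics.isLittleO_iff.1 hp hj] with n hn
  rw [Real.norm_eq_abs, Real.norm_natCast, one_div, inv_mul_eq_div, le_div_iff₀ (by positivity)]
    at hn
  nlinarith [abs_nonneg (p n)]

variable {f : ℕ → ℕ}

lemma computable_add (hf : Computable f) (hg : Computable g) : Computable fun k => f k + g k :=
  Primrec.nat_add.to_comp.comp hf hg

lemma computable_mul (hf : Computable f) (hg : Computable g) : Computable fun k => f k * g k :=
  Primrec.nat_mul.to_comp.comp hf hg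

lemma computable_pow (hf : Computable f) (hg : Computable g) : Computable fun k => f k ^ g k :=
  (Primrec₂.unpaired'.1 Nat.Primrec.pow).to_comp.comp hf hg

lemma computable_two_mul : Computable fun k => 2 * k :=
  computable_mul (.const 2) .id

lemma computable_solutionTime (hN : Computable N) (C c : ℕ) :
    Computable fun k => C * (2 ^ (N (2 * k) + 2 * k) + k + 3) ^ c :=
  have hexp := computable_add (hN.comp computable_two_mul) computable_two_mul
  have hbase := computable_add (computable_add (computable_pow (.const 2) hexp) .id) (.const 3)
  computable_mul (.const C) (computable_pow hbase (.const c))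

lemma computable_decisionTime (hg : Computable g) (K : ℕ) :
    Computable fun k => g k * (2 * k + 2 * g k + K) :=
  computable_mul hg <| computable_add
    (computable_add computable_two_mul (computable_mul (.const 2) hg)) (.const K)

end

theorem mainTheorem4 (p : ℕ → ℝ) (hp : p =o[Filter.atTop] fun n : ℕ => (n : ℝ)) :
    (IsUniformlyFPTOn (SparseInstances p) MaxLinAA ∧ ∃ g : ℕ → ℕ, SolutionFoundInTime p g) ∧
    (EffectivelySublinear p →
      IsFPTOn (SparseInstances p) MaxLinAA ∧
        ∃ g : ℕ → ℕ, Computable g ∧ SolutionFoundInTime p g) := by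
  refine ⟨?_, ?_⟩
  · obtain ⟨N, hN⟩ := exists_sublinear_bound hp
    obtain ⟨C, c, hfound⟩ := solutionFoundInTime_of_sublinear hN
    obtain ⟨K, hdecided⟩ := hfound.decidableInFPTTime
    exact ⟨⟨_, hdecided⟩, _, hfound⟩
  · rintro ⟨N, hcomputable, hN⟩
    obtain ⟨C, c, hfound⟩ := solutionFoundInTime_of_sublinear hN
    obtain ⟨K, hdecided⟩ := hfound.decidableInFPTTime
    have hg := computable_solutionTime hcomputable C c
    exact ⟨⟨_, computable_decisionTime hg K, hdecided⟩, _, hg, hfound⟩
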